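/- Let $G=(V,E)$ be a connected, infinite, locally finite graph with graph distance $d_G$, let $o\in V$, and let $B_k=\{x\in V: d_G(o,x)\le k\}$. Assume that there are $d\ge 1$ and $c,C>0$ with $c\,k^d\le |B_k|\le C\,k^d$ for all integers $k\ge 1$. Let $\Gamma$ be a subgroup of $\mathrm{Aut}(G)$ acting transitively on $V$. Let $J=(J_{x,y})_{x,y\in V}$ be real numbers such that: (C1) $J_{x,y}\ge 0$ for all $x,y$; (C2) $J_{\gamma x,\gamma y}=J_{x,y}$ for all $\gamma\in\Gamma$ and all $x,y$; (C3) for all $x,y\in V$ there is a finite sequence $x_0=x,\dots,x_k=y$ with $J_{x_0,x_1}\cdots J_{x_{k-1},x_k}>0$; (C4) there are $C',\varepsilon>0$ with $J_{x,y}\le C'\,d_G(x,y)^{-(d+\varepsilon)}$ for all $x\ne y$. Fix $g>0$, $a\in\mathbb R$ and $\beta>0$. For $\Lambda\subset V$ finite and $h\in\mathbb R$, let $\langle\cdot\rangle^0_{\Lambda,\beta,h}$ be the probability measure on $\mathbb R^\Lambda$ proportional to $$\exp\Big(\beta\sum_{x,y\in\Lambda}J_{x,y}\varphi_x\varphi_y+\beta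 h\sum_{x\in\Lambda}\varphi_x\Big)\prod_{x\in\Lambda}e^{-g\varphi_x^4-a\varphi_x^2}\,d\varphi_x ,$$ viewed as a measure on $\mathbb R^V$ by setting $\varphi_x=0$ for $x\notin\Lambda$. Let $\langle\cdot\rangle^0_{\beta,h}=\lim_{\Lambda\uparrow V}\langle\cdot\rangle^0_{\Lambda,\beta,h}$, and define the plus and minus measures by $$\langle\cdot\rangle^+_\beta=\lim_{h\downarrow 0}\langle\cdot\rangle^0_{\beta,h},\qquad \langle\cdot\rangle^-_\beta=\lim_{h\uparrow 0}\langle\cdot\rangle^0_{\beta,h},$$ all limits being weak limits of probability measures on $\mathbb R^V$ with the product topology. Then $\langle\cdot\rangle^+_\beta$ and $\langle\cdot\rangle^-_\beta$ are well defined (the limits exist and are unique), and they are mixing under $\Gamma$: for each $\#\in\{+,-\}$ and all bounded measurable functions $f_1,f_2:\mathbb R^V\to\mathbb R$ that each depend on finitely many coordinates, $$\lim_{d_G(o,x)\to\infty}\langle f_1\cdot\gamma_x f_2\rangle^\#_\beta=\langle f_1\rangle^\#_\beta\,\langle f_2\rangle^\#_\beta ,$$ uniformly over all $\gamma_x\in\Gamma$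 with $\gamma_x o=x$, where $(\gamma f)(\varphi)=f\big((\varphi_{\gamma y})_{y\in V}\big)$. -/

import Mathlib

open MeasureTheory Filter Topology
open scoped BoundedContinuousFunction

noncomputable section

namespace PhiFour

variable {V : Type*}

/-- Polynomial growth of dimension `d`: the balls `B_k` of radius `k` around `o` satisfy
`c k ^ d ≤ |B_k| ≤ C k ^ d` for all `k ≥ 1`, for some constants `c, C > 0`. -/
def HasPolynomialGrowth (G : SimpleGraph V) (o : V) (d : ℝ) : Prop :=
  ∃ c C : ℝ, 0 < c ∧ 0 < C ∧ ∀ k : ℕ, 1 ≤ k →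
    c * (k : ℝ) ^ d ≤ ({x : V | G.dist o x ≤ k}.ncard : ℝ) ∧
      ({x : V | G.dist o x ≤ k}.ncard : ℝ) ≤ C * (k : ℝ) ^ d

/-- A group of graph automorphisms acting transitively on the vertices. -/
def IsVertexTransitive {G : SimpleGraph V} (Γ : Subgroup (G ≃g G)) : Prop :=
  ∀ x y : V, ∃ γ ∈ Γ, γ x = y

/-- Admissible interactions with respect to a graph `G` of dimension `d` and a group `Γ` of
automorphisms of `G`. -/
structure IsAdmissible (G : SimpleGraph V) (Γ : Subgroup (G ≃g G)) (d : ℝ) (J : V → V → ℝ) :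
    Prop where
  ferromagnetic : ∀ x y, 0 ≤ J x y
  invariant : ∀ γ ∈ Γ, ∀ x y, J (γ x) (γ y) = J x y
  irreducible : ∀ x y, Relation.ReflTransGen (fun u v => 0 < J u v) x y
  integrable : ∃ C ε : ℝ, 0 < C ∧ 0 < ε ∧
    ∀ x y, x ≠ y → J x y ≤ C * (G.dist x y : ℝ) ^ (-(d + ε))

/-- The single-site probability measure on `ℝ` with density proportional to
`exp (-g t ^ 4 - a t ^ 2)`. -/
def singleSite (g a : ℝ) : Measure ℝ :=
  (volume : Measure ℝ).tilted fun t => -g * t ^ 4 - a * t ^ 2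

/-- The Hamiltonian in the finite volume `Λ`, with zero boundary condition (so that there is no
boundary term) and constant external field `h`. -/
def hamiltonian (J : V → V → ℝ) (h : ℝ) (Λ : Finset V) (φ : Λ → ℝ) : ℝ :=
  -(∑ x : Λ, ∑ y : Λ, J x y * φ x * φ y) - ∑ x : Λ, h * φ x

/-- The finite-volume `φ⁴` measure on `ℝ^Λ` with zero boundary condition: the probability measure
proportional to `exp (-β H(φ)) ∏ x, dρ (φ x)`. -/
def finiteVolume (J : V → V → ℝ) (g a β h : ℝ) (Λ : Finset V) : Measure (Λ → ℝ) :=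
  (Measure.pi fun _ : Λ => singleSite g a).tilted fun φ => -β * hamiltonian J h Λ φ

/-- The finite-volume measure viewed as a measure on `ℝ^V`: configurations on `Λ` are extended by
the boundary condition `0` outside `Λ`. -/
def freeMeasureOn (J : V → V → ℝ) (g a β h : ℝ) (Λ : Finset V) : Measure (V → ℝ) :=
  (finiteVolume J g a β h Λ).map fun φ => Function.extend (Subtype.val : Λ → V) φ 0

/-- Weak convergence of measures on `ℝ^V` (with the product topology) along a filter, with a
probability measure as limit. -/
def WeakLimit {ι : Type*} (ν : ι → Measure (V → ℝ)) (l : Filter ι) (μ : Measure (V → ℝ)) : Prop :=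
  IsProbabilityMeasure μ ∧
    ∀ F : (V → ℝ) →ᵇ ℝ, Tendsto (fun i => ∫ φ, F φ ∂ν i) l (𝓝 (∫ φ, F φ ∂μ))

/-- `μ` is the infinite-volume free measure with field `h`, the weak limit of the finite-volume
measures with zero boundary condition as `Λ ↑ V`. -/
def IsFreeMeasure (J : V → V → ℝ) (g a β h : ℝ) (μ : Measure (V → ℝ)) : Prop :=
  WeakLimit (fun Λ : Finset V => freeMeasureOn J g a β h Λ) atTop μ

/-- `μ` is the plus measure: the weak limit of the infinite-volume free measures as `h ↓ 0`. -/
def IsPlusMeasure (J : V → V → ℝ) (g a β : ℝ) (μ : Measure (V → ℝ)) : Prop :=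
  ∃ ν : ℝ → Measure (V → ℝ),
    (∀ h : ℝ, 0 < h → IsFreeMeasure J g a β h (ν h)) ∧ WeakLimit ν (𝓝[>] 0) μ

/-- `μ` is the minus measure: the weak limit of the infinite-volume free measures as `h ↑ 0`. -/
def IsMinusMeasure (J : V → V → ℝ) (g a β : ℝ) (μ : Measure (V → ℝ)) : Prop :=
  ∃ ν : ℝ → Measure (V → ℝ),
    (∀ h : ℝ, h < 0 → IsFreeMeasure J g a β h (ν h)) ∧ WeakLimit ν (𝓝[<] 0) μ

/-- A bounded measurable function on `ℝ^V` that depends on finitely many coordinates. -/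
def IsLocalBounded (f : (V → ℝ) → ℝ) : Prop :=
  Measurable f ∧ (∃ C : ℝ, ∀ φ, |f φ| ≤ C) ∧ ∃ Λ : Finset V, DependsOn f (Λ : Set V)

/-- The action of an automorphism on functions on `ℝ^V`: `(γ f)(φ) = f (φ ∘ γ)`. If `f` depends on
the coordinates in `Λ`, then `γ f` depends on those in `γ Λ`. -/
def translate {G : SimpleGraph V} (γ : G ≃g G) (f : (V → ℝ) → ℝ) : (V → ℝ) → ℝ :=
  fun φ => f fun x => φ (γ x)

/-- Mixing under `Γ`: for all local bounded `f₁, f₂`, the expectation of `f₁ · γ f₂` tends to the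
product of the expectations as `d_G(o, γ o) → ∞`, uniformly over such `γ ∈ Γ`. -/
def IsMixing {G : SimpleGraph V} (Γ : Subgroup (G ≃g G)) (o : V) (μ : Measure (V → ℝ)) : Prop :=
  ∀ f₁ f₂ : (V → ℝ) → ℝ, IsLocalBounded f₁ → IsLocalBounded f₂ →
    Tendsto (fun γ : Γ => ∫ φ, f₁ φ * translate (γ : G ≃g G) f₂ φ ∂μ)
      (comap (fun γ : Γ => G.dist o ((γ : G ≃g G) o)) atTop)
      (𝓝 ((∫ φ, f₁ φ ∂μ) * ∫ φ, f₂ φ ∂μ))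

end PhiFour

end

open MeasureTheory Filter Topology
open scoped BoundedContinuousFunction

noncomputable section

namespace PhiFour

variable {V : Type*}

/-! ### Integrability of functions of exponential growth under product measures. -/

section Tame

variable {E : Type*} [MeasurableSpace E]

/-! A spin flip exchanges the plus and minus measures, so only the plus measure needs work.

Existence rests on Griffiths' inequalities in Ginibre's form. For two independent copies of the
spins, sums and differences of even or odd increasing functions generate a cone of functions with
nonnegative integral (`integral_mul_exp_nonneg`). Hence, for nonnegative fields, expectations of
monomials in a bounded odd increasing function of the spins increase with the volume and the field
(`gibbs_energy_mono`). Monomials determine a measure on `ℝ^V`, so monotone limits of their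
expectations give weak limits once tightness is known (`exists_weakLimit`). Tightness comes from
`exists_moment_bound`: Jensen's inequality controls the average second moment over a volume, and
transitivity, monotonicity and polynomial growth turn the average into a bound at every site.

For mixing, the FKG inequality bounds covariances of monomials by sums of covariances of pairs of
bounded spins (`abs_cov_monomial_le`). It then suffices that, for given `x` and `η > 0`, only
finitely many `y` have covariance at least `η` with `x` (`IsPlusMeasure.finite_cov_ge`). Otherwise,
take a small field `h` and add a bounded source at many such `y`, one at a time. By Griffiths'
inequalities all pair correlations stay above their values at field `h` and all one-point
expectations below their values at field `2h`. Since the plus measure is the limit `h ↓ 0`, the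
covariances with `x` remain bounded below throughout, so each source raises the expectation of the
bounded spin at `x` by a fixed amount. That expectation is at most `1`, so the number of sources is
bounded. Density of monomials in `L²` and invariance of the measure extend the decay to all bounded
local functions (`tendsto_integral_mul_of_monomial`). -/

lemma integrable_prod_infinitePi (m : Measure E) [IsProbabilityMeasure m] (A : Finset V)
    (p : V → E → ℝ) (hp : ∀ x, Integrable (p x) m) :
    Integrable (fun ω : V → E => ∏ x ∈ A, p x (ω x)) (Measure.infinitePi fun _ : V => m) := by
  have h1 : Integrable (fun ω : A → E => ∏ x : A, p x (ω x)) (Measure.pi fun _ : A => m) :=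
    Integrable.fintype_prod_dep (f := fun x : A => p x) fun x => hp x
  rw [← Measure.infinitePi_map_restrict (fun _ : V => m) (I := A)] at h1
  have h2 := h1.comp_measurable (Finset.measurable_restrict A)
  refine h2.congr (ae_of_all _ fun ω => ?_)
  simp [Function.comp, Finset.restrict]

lemma integral_prod_infinitePi (m : Measure E) [IsProbabilityMeasure m] (A : Finset V)
    (p : V → E → ℝ) (hp : ∀ x, Measurable (p x)) :
    ∫ ω : V → E, ∏ x ∈ A, p x (ω x) ∂(Measure.infinitePi fun _ : V => m) =
      ∏ x ∈ A, ∫ t, p x t ∂m := by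
  have h1 := integral_fintype_prod_eq_prod (μ := fun _ : A => m) (f := fun x : A => p x)
  rw [← integral_restrict_infinitePi (μ := fun _ : V => m)] at h1
  · rw [← Finset.prod_coe_sort A (fun x => ∫ t, p x t ∂m), ← h1]
    refine integral_congr_ae (ae_of_all _ fun ω => ?_)
    simp [Finset.restrict]
  · have : Measurable (fun ω : A → E => ∏ x : A, p x (ω x)) := by
      refine Finset.measurable_fun_prod _ fun x _ => (hp x).comp (measurable_pi_apply x)
    exact this.aestronglyMeasurable

/-- Measurable functions of a configuration bounded by the exponential of a finite sum of the
weights `n`. -/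
def Tame (n : E → ℝ) (F : (V → E) → ℝ) : Prop :=
  Measurable F ∧ ∃ (A : Finset V) (C c : ℝ), 0 ≤ C ∧ 0 ≤ c ∧
    ∀ ω, |F ω| ≤ C * Real.exp (c * ∑ x ∈ A, n (ω x))

/-- Measurable functions of a configuration bounded by a multiple of a finite sum of the
weights `n`. -/
def QuadBounded (n : E → ℝ) (H : (V → E) → ℝ) : Prop :=
  Measurable H ∧ ∃ (A : Finset V) (C c : ℝ), 0 ≤ C ∧ 0 ≤ c ∧
    ∀ ω, |H ω| ≤ C + c * ∑ x ∈ A, n (ω x)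

variable {n : E → ℝ}

lemma exists_common_exp_bound (hn : ∀ t, 0 ≤ n t) {F G : (V → E) → ℝ} (hF : Tame n F)
    (hG : Tame n G) : ∃ (A : Finset V) (C c : ℝ), 0 ≤ C ∧ 0 ≤ c ∧
      (∀ ω, |F ω| ≤ C * Real.exp (c * ∑ x ∈ A, n (ω x))) ∧
      ∀ ω, |G ω| ≤ C * Real.exp (c * ∑ x ∈ A, n (ω x)) := by
  classical
  obtain ⟨-, A, C, c, hC, hc, h⟩ := hF
  obtain ⟨-, A', C', c', hC', hc', h'⟩ := hG
  have key : ∀ (B B' : Finset V) (b b' : ℝ), B ⊆ B' → 0 ≤ b → b ≤ b' → ∀ ω : V → E,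
      Real.exp (b * ∑ x ∈ B, n (ω x)) ≤ Real.exp (b' * ∑ x ∈ B', n (ω x)) := by
    intro B B' b b' hB hb hbb ω
    have h1 : ∑ x ∈ B, n (ω x) ≤ ∑ x ∈ B', n (ω x) :=
      Finset.sum_le_sum_of_subset_of_nonneg hB fun _ _ _ => hn _
    have h2 : 0 ≤ ∑ x ∈ B, n (ω x) := Finset.sum_nonneg fun _ _ => hn _
    exact Real.exp_le_exp.2 (mul_le_mul hbb h1 h2 (hb.trans hbb))
  refine ⟨A ∪ A', max C C', max c c', hC.trans (le_max_left _ _), hc.trans (le_max_left _ _),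
    fun ω => (h ω).trans ?_, fun ω => (h' ω).trans ?_⟩
  · exact mul_le_mul (le_max_left _ _)
      (key _ _ _ _ Finset.subset_union_left hc (le_max_left _ _) ω) (Real.exp_pos _).le
      (hC.trans (le_max_left _ _))
  · exact mul_le_mul (le_max_right _ _)
      (key _ _ _ _ Finset.subset_union_right hc' (le_max_right _ _) ω) (Real.exp_pos _).le
      (hC.trans (le_max_left _ _))

lemma Tame.add (hn : ∀ t, 0 ≤ n t) {F G : (V → E) → ℝ} (hF : Tame n F) (hG : Tame n G) :
    Tame n (fun ω => F ω + G ω) := by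
  obtain ⟨A, C, c, hC, hc, h, h'⟩ := exists_common_exp_bound hn hF hG
  refine ⟨hF.1.add hG.1, A, C + C, c, by positivity, hc, fun ω => (abs_add_le _ _).trans ?_⟩
  rw [add_mul]
  exact add_le_add (h ω) (h' ω)

lemma Tame.mul (hn : ∀ t, 0 ≤ n t) {F G : (V → E) → ℝ} (hF : Tame n F) (hG : Tame n G) :
    Tame n (fun ω => F ω * G ω) := by
  obtain ⟨A, C, c, hC, hc, h, h'⟩ := exists_common_exp_bound hn hF hG
  refine ⟨hF.1.mul hG.1, A, C * C, c + c, by positivity, by positivity, fun ω => ?_⟩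
  rw [abs_mul, add_mul, Real.exp_add, mul_mul_mul_comm]
  exact mul_le_mul (h ω) (h' ω) (abs_nonneg _) (by positivity)

lemma Tame.of_bounded {F : (V → E) → ℝ} (hF : Measurable F) {C : ℝ} (h : ∀ ω, |F ω| ≤ C) :
    Tame n F := by
  refine ⟨hF, ∅, |C|, 0, abs_nonneg _, le_rfl, fun ω => ?_⟩
  simpa using (h ω).trans (le_abs_self C)

lemma Tame.const (C : ℝ) : Tame n (fun _ : V → E => C) :=
  Tame.of_bounded measurable_const fun _ => le_rfl

lemma Tame.integrable {F : (V → E) → ℝ} (hF : Tame n F) {m : Measure E}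
    [IsProbabilityMeasure m] (hm : ∀ c, Integrable (fun t => Real.exp (c * n t)) m) :
    Integrable F (Measure.infinitePi fun _ : V => m) := by
  obtain ⟨h0, A, C, c, hC, hc, h⟩ := hF
  refine ((integrable_prod_infinitePi m A (fun _ t => Real.exp (c * n t))
    fun _ => hm c).const_mul C).mono' h0.aestronglyMeasurable (ae_of_all _ fun ω => ?_)
  rw [Real.norm_eq_abs, ← Real.exp_sum, ← Finset.mul_sum]
  exact h ω

lemma QuadBounded.add (hn : ∀ t, 0 ≤ n t) {F G : (V → E) → ℝ} (hF : QuadBounded n F)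
    (hG : QuadBounded n G) : QuadBounded n (fun ω => F ω + G ω) := by
  classical
  obtain ⟨h0, A, C, c, hC, hc, h⟩ := hF
  obtain ⟨h0', A', C', c', hC', hc', h'⟩ := hG
  refine ⟨h0.add h0', A ∪ A', C + C', c + c', by positivity, by positivity, fun ω =>
    (abs_add_le _ _).trans ?_⟩
  have h1 : ∑ x ∈ A, n (ω x) ≤ ∑ x ∈ A ∪ A', n (ω x) :=
    Finset.sum_le_sum_of_subset_of_nonneg Finset.subset_union_left fun _ _ _ => hn _
  have h2 : ∑ x ∈ A', n (ω x) ≤ ∑ x ∈ A ∪ A', n (ω x) :=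
    Finset.sum_le_sum_of_subset_of_nonneg Finset.subset_union_right fun _ _ _ => hn _
  nlinarith [h ω, h' ω, mul_le_mul_of_nonneg_left h1 hc, mul_le_mul_of_nonneg_left h2 hc']

lemma QuadBounded.const_mul {F : (V → E) → ℝ} (hF : QuadBounded n F) (r : ℝ) :
    QuadBounded n (fun ω => r * F ω) := by
  obtain ⟨h0, A, C, c, hC, hc, h⟩ := hF
  refine ⟨h0.const_mul r, A, |r| * C, |r| * c, by positivity, by positivity, fun ω => ?_⟩
  rw [abs_mul, mul_assoc, ← mul_add]
  exact mul_le_mul_of_nonneg_left (h ω) (abs_nonneg _)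

lemma QuadBounded.const (r : ℝ) : QuadBounded n (fun _ : V → E => r) :=
  ⟨measurable_const, ∅, |r|, 0, abs_nonneg _, le_rfl, fun ω => by simp⟩

lemma QuadBounded.sum (hn : ∀ t, 0 ≤ n t) {ι : Type*} (s : Finset ι) (F : ι → (V → E) → ℝ)
    (hF : ∀ i ∈ s, QuadBounded n (F i)) : QuadBounded n (fun ω => ∑ i ∈ s, F i ω) := by
  classical
  induction s using Finset.induction_on with
  | empty => simpa using QuadBounded.const 0
  | insert i s hi ih =>
    simp only [Finset.sum_insert hi]
    exact (hF i (by simp)).add hn (ih fun j hj => hF j (by simp [hj]))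

lemma QuadBounded.tame_exp_abs {H : (V → E) → ℝ} (hH : QuadBounded n H) :
    Tame n (fun ω => Real.exp |H ω|) := by
  obtain ⟨h0, A, C, c, hC, hc, h⟩ := hH
  refine ⟨Real.measurable_exp.comp (measurable_norm.comp h0), A, Real.exp C, c, (Real.exp_pos _).le,
    hc, fun ω => ?_⟩
  rw [abs_of_pos (Real.exp_pos _), ← Real.exp_add]
  exact Real.exp_le_exp.2 (h ω)

lemma QuadBounded.tame_exp {H : (V → E) → ℝ} (hH : QuadBounded n H) :
    Tame n (fun ω => Real.exp (H ω)) := by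
  obtain ⟨-, A, C, c, hC, hc, h⟩ := hH.tame_exp_abs
  refine ⟨Real.measurable_exp.comp hH.1, A, C, c, hC, hc, fun ω => le_trans ?_ (h ω)⟩
  rw [abs_of_pos (Real.exp_pos _), abs_of_pos (Real.exp_pos _)]
  exact Real.exp_le_exp.2 (le_abs_self _)

lemma QuadBounded.tame {H : (V → E) → ℝ} (hH : QuadBounded n H) : Tame n H := by
  obtain ⟨-, A, C, c, hC, hc, h⟩ := hH.tame_exp_abs
  refine ⟨hH.1, A, C, c, hC, hc, fun ω => le_trans ?_ (h ω)⟩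
  rw [abs_of_pos (Real.exp_pos _)]
  exact (by linarith [Real.add_one_le_exp |H ω|])

end Tame

/-! ### The single-site measure. -/

/-- Even probability measures on `ℝ` with all Gaussian moments. -/
structure IsSiteMeasure (ρ : Measure ℝ) : Prop where
  isProb : IsProbabilityMeasure ρ
  map_neg : ρ.map (fun t => -t) = ρ
  integrable_exp : ∀ c : ℝ, Integrable (fun t => Real.exp (c * t ^ 2)) ρ

/-- The quartic term beats any quadratic one: completing the square in `t ^ 2` bounds the density
times `exp (c t ^ 2)` by a multiple of `exp (-t ^ 2)`. -/
lemma isSiteMeasure_singleSite {g : ℝ} (a : ℝ) (hg : 0 < g) : IsSiteMeasure (singleSite g a) := by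
  have key : ∀ c : ℝ, Integrable (fun t : ℝ => Real.exp (-g * t ^ 4 - a * t ^ 2 + c * t ^ 2)) := by
    intro c
    have h0 := (integrable_exp_neg_mul_sq (b := 1) one_pos).const_mul
      (Real.exp ((1 + c - a) ^ 2 / (4 * g)))
    refine h0.mono' (by fun_prop) (ae_of_all _ fun t => ?_)
    rw [Real.norm_eq_abs, abs_of_pos (Real.exp_pos _), ← Real.exp_add]
    refine Real.exp_le_exp.2 ?_
    have h1 : (1 + c - a) ^ 2 / (4 * g) + -1 * t ^ 2 - (-g * t ^ 4 - a * t ^ 2 + c * t ^ 2) =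
        (2 * g * t ^ 2 - (1 + c - a)) ^ 2 / (4 * g) := by
      field_simp
      ring
    have h2 : 0 ≤ (2 * g * t ^ 2 - (1 + c - a)) ^ 2 / (4 * g) := by positivity
    linarith
  have h0 : Integrable (fun t : ℝ => Real.exp (-g * t ^ 4 - a * t ^ 2)) := by
    simpa using key 0
  have hne : NeZero (volume : Measure ℝ) := inferInstance
  refine ⟨isProbabilityMeasure_tilted h0, ?_, fun c => ?_⟩
  · unfold singleSite
    ext s hs
    rw [Measure.map_apply measurable_neg hs, tilted_apply' _ _ hs,
      tilted_apply' _ _ (measurable_neg hs)]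
    have hmp : MeasurePreserving (fun t : ℝ => -t) volume volume := Measure.measurePreserving_neg _
    rw [← hmp.setLIntegral_comp_preimage hs (by fun_prop)]
    simp only [neg_sq, Even.neg_pow (show Even 4 by decide)]
  · rw [singleSite, integrable_tilted_iff h0]
    refine (key c).congr (ae_of_all _ fun t => ?_)
    simp [← Real.exp_add]

/-! ### Ginibre's inequality for duplicated spins. -/

section

/-- Even or odd functions that are nonnegative and monotone on `[0, ∞)`. -/
structure IsGriffiths (f : ℝ → ℝ) : Prop where
  measurable : Measurable f
  parity : (∀ t, f (-t) = f t) ∨ ∀ t, f (-t) = -f t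
  nonneg : ∀ t, 0 ≤ t → 0 ≤ f t
  mono : MonotoneOn f (Set.Ici 0)
  growth : ∃ C c : ℝ, 0 ≤ C ∧ 0 ≤ c ∧ ∀ t, |f t| ≤ C * Real.exp (c * t ^ 2)

/-- Functions of two copies of a spin that are equivariant under `(s, t) ↦ (t, s)` and
`(s, t) ↦ (-t, -s)` and nonnegative on the fundamental domain `|t| ≤ s`. -/
structure IsDuplicate (p : ℝ × ℝ → ℝ) : Prop where
  measurable : Measurable p
  swap : ∃ e : ℝ, (e = 1 ∨ e = -1) ∧ ∀ s t, p (t, s) = e * p (s, t)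
  reflect : ∃ e : ℝ, (e = 1 ∨ e = -1) ∧ ∀ s t, p (-t, -s) = e * p (s, t)
  nonneg : ∀ s t, |t| ≤ s → 0 ≤ p (s, t)
  growth : ∃ C c : ℝ, 0 ≤ C ∧ 0 ≤ c ∧ ∀ z, |p z| ≤ C * Real.exp (c * (z.1 ^ 2 + z.2 ^ 2))

lemma exists_common_growth {X : Type*} {n : X → ℝ} (hn : ∀ x, 0 ≤ n x) {f g : X → ℝ}
    (hf : ∃ C c : ℝ, 0 ≤ C ∧ 0 ≤ c ∧ ∀ t, |f t| ≤ C * Real.exp (c * n t))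
    (hg : ∃ C c : ℝ, 0 ≤ C ∧ 0 ≤ c ∧ ∀ t, |g t| ≤ C * Real.exp (c * n t)) :
    ∃ C c : ℝ, 0 ≤ C ∧ 0 ≤ c ∧ (∀ t, |f t| ≤ C * Real.exp (c * n t)) ∧
      ∀ t, |g t| ≤ C * Real.exp (c * n t) := by
  obtain ⟨C, c, hC, hc, h⟩ := hf
  obtain ⟨C', c', hC', hc', h'⟩ := hg
  have key : ∀ b b' : ℝ, b ≤ b' → ∀ t, Real.exp (b * n t) ≤ Real.exp (b' * n t) :=
    fun b b' hb t => Real.exp_le_exp.2 (mul_le_mul_of_nonneg_right hb (hn t))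
  exact ⟨max C C', max c c', hC.trans (le_max_left _ _), hc.trans (le_max_left _ _),
    fun t => (h t).trans (mul_le_mul (le_max_left _ _) (key _ _ (le_max_left _ _) t)
      (Real.exp_pos _).le (hC.trans (le_max_left _ _))),
    fun t => (h' t).trans (mul_le_mul (le_max_right _ _) (key _ _ (le_max_right _ _) t)
      (Real.exp_pos _).le (hC.trans (le_max_left _ _)))⟩

/-- The signs under the two symmetries multiply. This allows several factors at one site to be
merged into one. -/
lemma IsDuplicate.mul {p q : ℝ × ℝ → ℝ} (hp : IsDuplicate p) (hq : IsDuplicate q) :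
    IsDuplicate fun z => p z * q z := by
  obtain ⟨e, he, hs⟩ := hp.swap
  obtain ⟨e', he', hs'⟩ := hq.swap
  obtain ⟨r, hr, ht⟩ := hp.reflect
  obtain ⟨r', hr', ht'⟩ := hq.reflect
  refine ⟨hp.measurable.mul hq.measurable, ⟨e * e', ?_, fun s t => ?_⟩, ⟨r * r', ?_, fun s t => ?_⟩,
    fun s t h => mul_nonneg (hp.nonneg s t h) (hq.nonneg s t h), ?_⟩
  · rcases he with rfl | rfl <;> rcases he' with rfl | rfl <;> simp
  · rw [hs, hs']; ring
  · rcases hr with rfl | rfl <;> rcases hr' with rfl | rfl <;> simp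
  · rw [ht, ht']; ring
  · obtain ⟨C, c, hC, hc, h, h'⟩ := exists_common_growth (n := fun z : ℝ × ℝ => z.1 ^ 2 + z.2 ^ 2)
      (fun z => by positivity) hp.growth hq.growth
    refine ⟨C * C, c + c, by positivity, by positivity, fun z => ?_⟩
    rw [abs_mul, add_mul, Real.exp_add, mul_mul_mul_comm]
    exact mul_le_mul (h z) (h' z) (abs_nonneg _) (by positivity)

lemma isDuplicate_const {r : ℝ} (hr : 0 ≤ r) : IsDuplicate fun _ => r :=
  ⟨measurable_const, ⟨1, by simp, by simp⟩, ⟨1, by simp, by simp⟩, fun _ _ _ => hr,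
    ⟨r, 0, hr, le_rfl, fun z => by simp [abs_of_nonneg hr]⟩⟩

lemma isGriffiths_const {r : ℝ} (hr : 0 ≤ r) : IsGriffiths fun _ => r :=
  ⟨measurable_const, Or.inl (by simp), fun _ _ => hr, fun _ _ _ _ _ => le_rfl,
    ⟨r, 0, hr, le_rfl, fun z => by simp [abs_of_nonneg hr]⟩⟩

lemma isGriffiths_id : IsGriffiths fun t => t := by
  refine ⟨measurable_id, Or.inr (by simp), fun _ h => h, fun _ _ _ _ h => h,
    1, 1, by simp, by simp, fun t => ?_⟩
  have h1 := Real.add_one_le_exp (t ^ 2)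
  rw [one_mul, one_mul]
  refine le_trans ?_ h1
  rw [← sq_abs]
  nlinarith [sq_nonneg (|t| - 1), abs_nonneg t]

/-- On `|t| ≤ s`, parity and monotonicity give `|f t| = f |t| ≤ f s`, so both the sum and the
difference are nonnegative there. -/
lemma IsGriffiths.isDuplicate {f : ℝ → ℝ} (hf : IsGriffiths f) {e : ℝ} (he : e = 1 ∨ e = -1) :
    IsDuplicate fun z => f z.1 + e * f z.2 := by
  have hee : e * e = 1 := by rcases he with rfl | rfl <;> simp
  obtain ⟨r, hr, hfr⟩ : ∃ r : ℝ, (r = 1 ∨ r = -1) ∧ ∀ t, f (-t) = r * f t := by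
    rcases hf.parity with h | h
    · exact ⟨1, by simp, by simpa using h⟩
    · exact ⟨-1, by simp, by simpa using h⟩
  have hm := hf.measurable
  refine ⟨by fun_prop, ⟨e, he, fun s t => ?_⟩, ⟨r * e, ?_, fun s t => ?_⟩, fun s t h => ?_, ?_⟩
  · linear_combination (-f t) * hee
  · rcases he with rfl | rfl <;> rcases hr with rfl | rfl <;> simp
  · simp only [hfr]
    linear_combination (-r * f t) * hee
  · have h1 : |f t| ≤ f s := by
      have h2 : |f t| = f |t| := by
        rcases abs_cases t with ⟨h3, h4⟩ | ⟨h3, h4⟩ <;> rw [h3]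
        · exact abs_of_nonneg (hf.nonneg t h4)
        · have h5 := hf.nonneg (-t) (by linarith)
          rw [hfr] at h5 ⊢
          rcases hr with rfl | rfl
          · rw [abs_of_nonneg] <;> linarith
          · rw [abs_of_nonpos] <;> linarith
      rw [h2]
      exact hf.mono (abs_nonneg t) ((abs_nonneg t).trans h) h
    rcases he with rfl | rfl
    · linarith [neg_abs_le (f t)]
    · linarith [le_abs_self (f t)]
  · obtain ⟨C, c, hC, hc, h⟩ := hf.growth
    refine ⟨C + C, c, by positivity, hc, fun z => ?_⟩
    have key : ∀ t r : ℝ, t ^ 2 ≤ r → |f t| ≤ C * Real.exp (c * r) := fun t r htr =>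
      (h t).trans (mul_le_mul_of_nonneg_left
        (Real.exp_le_exp.2 (mul_le_mul_of_nonneg_left htr hc)) hC)
    have h1 := key z.1 (z.1 ^ 2 + z.2 ^ 2) (by nlinarith [sq_nonneg z.2])
    have h2 := key z.2 (z.1 ^ 2 + z.2 ^ 2) (by nlinarith [sq_nonneg z.1])
    refine (abs_add_le _ _).trans ?_
    rw [abs_mul, add_mul]
    have h3 : |e| = 1 := by rcases he with rfl | rfl <;> simp
    rw [h3, one_mul]
    exact add_le_add h1 h2

/-- Both symmetries preserve `ρ × ρ`. If one of the signs is `-1`, the integral equals its own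
negative. If both are `+1`, the images of `|t| ≤ s` under the symmetries cover the plane, so `p` is
nonnegative everywhere. -/
lemma IsDuplicate.integral_nonneg {p : ℝ × ℝ → ℝ} (hp : IsDuplicate p) {ρ : Measure ℝ}
    (hρ : IsSiteMeasure ρ) : 0 ≤ ∫ z, p z ∂(ρ.prod ρ) := by
  have := hρ.isProb
  obtain ⟨e, he, hs⟩ := hp.swap
  obtain ⟨r, hr, ht⟩ := hp.reflect
  have hswap : MeasurePreserving (Prod.swap : ℝ × ℝ → ℝ × ℝ) (ρ.prod ρ) (ρ.prod ρ) :=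
    Measure.measurePreserving_swap
  have hneg : MeasurePreserving (fun t : ℝ => -t) ρ ρ := ⟨measurable_neg, hρ.map_neg⟩
  have hrefl := (hneg.prod hneg).comp hswap
  have h1 : ∫ z, p z ∂(ρ.prod ρ) = e * ∫ z, p z ∂(ρ.prod ρ) := by
    have h := integral_map (μ := ρ.prod ρ) hswap.measurable.aemeasurable (f := p)
      hp.measurable.aestronglyMeasurable
    rw [hswap.map_eq] at h
    rw [← integral_const_mul]
    exact h.trans (integral_congr_ae (ae_of_all _ fun z => hs z.1 z.2))
  have h2 : ∫ z, p z ∂(ρ.prod ρ) = r * ∫ z, p z ∂(ρ.prod ρ) := by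
    have h := integral_map (μ := ρ.prod ρ) hrefl.measurable.aemeasurable (f := p)
      hp.measurable.aestronglyMeasurable
    rw [hrefl.map_eq] at h
    rw [← integral_const_mul]
    exact h.trans (integral_congr_ae (ae_of_all _ fun z => ht z.1 z.2))
  rcases he with rfl | rfl
  swap
  · linarith
  rcases hr with rfl | rfl
  swap
  · linarith
  simp only [one_mul] at hs ht
  refine MeasureTheory.integral_nonneg fun z => ?_
  obtain ⟨s, t⟩ := z
  change 0 ≤ p (s, t)
  rcases le_total |t| |s| with h | h
  · rcases abs_cases s with ⟨h3, -⟩ | ⟨h3, -⟩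
    · exact hp.nonneg s t (h3 ▸ h)
    · rw [← ht s t, ← hs]
      exact hp.nonneg _ _ (by rw [abs_neg]; exact h3 ▸ h)
  · rcases abs_cases t with ⟨h3, -⟩ | ⟨h3, -⟩
    · rw [← hs s t]
      exact hp.nonneg _ _ (h3 ▸ h)
    · rw [← ht s t]
      exact hp.nonneg _ _ (by rw [abs_neg]; exact h3 ▸ h)

/-- The cone generated by products of one-spin Griffiths functions. -/
def griffithsCone (V : Type*) : Subsemiring ((V → ℝ) → ℝ) :=
  Subsemiring.closure {F | ∃ (x : V) (f : ℝ → ℝ), IsGriffiths f ∧ F = fun φ => f (φ x)}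

/-- The cone generated by products of one-site functions of duplicated spins. -/
def duplicateCone (V : Type*) : Subsemiring ((V → ℝ × ℝ) → ℝ) :=
  Subsemiring.closure {F | ∃ (x : V) (p : ℝ × ℝ → ℝ), IsDuplicate p ∧ F = fun ω => p (ω x)}

lemma mem_duplicateCone (x : V) {p : ℝ × ℝ → ℝ} (hp : IsDuplicate p) :
    (fun ω : V → ℝ × ℝ => p (ω x)) ∈ duplicateCone V :=
  Subsemiring.subset_closure ⟨x, p, hp, rfl⟩

lemma mem_griffithsCone (x : V) {f : ℝ → ℝ} (hf : IsGriffiths f) :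
    (fun φ : V → ℝ => f (φ x)) ∈ griffithsCone V :=
  Subsemiring.subset_closure ⟨x, f, hf, rfl⟩

lemma const_mul_mem_duplicateCone [Nonempty V] {r : ℝ} (hr : 0 ≤ r) {F : (V → ℝ × ℝ) → ℝ}
    (hF : F ∈ duplicateCone V) : (fun ω => r * F ω) ∈ duplicateCone V :=
  mul_mem (mem_duplicateCone (Classical.arbitrary V) (isDuplicate_const hr)) hF

lemma const_mul_mem_griffithsCone [Nonempty V] {r : ℝ} (hr : 0 ≤ r) {F : (V → ℝ) → ℝ}
    (hF : F ∈ griffithsCone V) : (fun φ => r * F φ) ∈ griffithsCone V :=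
  mul_mem (mem_griffithsCone (Classical.arbitrary V) (isGriffiths_const hr)) hF

/-- The squared norm of a pair of spins. -/
def pairSq (z : ℝ × ℝ) : ℝ := z.1 ^ 2 + z.2 ^ 2

lemma pairSq_nonneg (z : ℝ × ℝ) : 0 ≤ pairSq z := by unfold pairSq; positivity

lemma tame_of_mem_duplicateCone {F : (V → ℝ × ℝ) → ℝ} (hF : F ∈ duplicateCone V) :
    Tame pairSq F := by
  induction hF using Subsemiring.closure_induction with
  | mem F h =>
    obtain ⟨x, p, hp, rfl⟩ := h
    obtain ⟨C, c, hC, hc, h⟩ := hp.growth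
    exact ⟨hp.measurable.comp (measurable_pi_apply x), {x}, C, c, hC, hc,
      fun ω => by simpa [pairSq] using h (ω x)⟩
  | zero => exact Tame.const 0
  | one => exact Tame.const 1
  | add F G _ _ hF hG => exact hF.add pairSq_nonneg hG
  | mul F G _ _ hF hG => exact hF.mul pairSq_nonneg hG

lemma tame_of_mem_griffithsCone {F : (V → ℝ) → ℝ} (hF : F ∈ griffithsCone V) :
    Tame (fun t => t ^ 2) F := by
  induction hF using Subsemiring.closure_induction with
  | mem F h =>
    obtain ⟨x, p, hp, rfl⟩ := h
    obtain ⟨C, c, hC, hc, h⟩ := hp.growth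
    exact ⟨hp.measurable.comp (measurable_pi_apply x), {x}, C, c, hC, hc,
      fun ω => by simpa using h (ω x)⟩
  | zero => exact Tame.const 0
  | one => exact Tame.const 1
  | add F G _ _ hF hG => exact hF.add (fun t => sq_nonneg t) hG
  | mul F G _ _ hF hG => exact hF.mul (fun t => sq_nonneg t) hG

/-- Products are handled by `FG ± F'G' = ((F + F')(G ± G') + (F - F')(G ∓ G')) / 2`, where primes
denote the second copy. Sum and difference must therefore be carried through the induction together.
-/
lemma duplicate_mem_duplicateCone [Nonempty V] {F : (V → ℝ) → ℝ} (hF : F ∈ griffithsCone V) :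
    (fun ω : V → ℝ × ℝ => F (fun x => (ω x).1) + F (fun x => (ω x).2)) ∈ duplicateCone V ∧
    (fun ω : V → ℝ × ℝ => F (fun x => (ω x).1) - F (fun x => (ω x).2)) ∈ duplicateCone V := by
  induction hF using Subsemiring.closure_induction with
  | mem F h =>
    obtain ⟨x, f, hf, rfl⟩ := h
    refine ⟨?_, ?_⟩
    · simpa using mem_duplicateCone x (hf.isDuplicate (e := 1) (by simp))
    · simpa [sub_eq_add_neg] using mem_duplicateCone x (hf.isDuplicate (e := -1) (by simp))
  | zero =>
    simp only [Pi.zero_apply, add_zero, sub_zero]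
    exact ⟨zero_mem _, zero_mem _⟩
  | one =>
    simp only [Pi.one_apply, sub_self]
    exact ⟨add_mem (one_mem (duplicateCone V)) (one_mem (duplicateCone V)), zero_mem _⟩
  | add F G _ _ hF hG =>
    refine ⟨?_, ?_⟩
    · convert add_mem hF.1 hG.1 using 1
      ext ω
      simp only [Pi.add_apply]
      ring
    · convert add_mem hF.2 hG.2 using 1
      ext ω
      simp only [Pi.add_apply]
      ring
  | mul F G _ _ hF hG =>
    have h2 : (0 : ℝ) ≤ 1 / 2 := by norm_num
    refine ⟨?_, ?_⟩
    · convert const_mul_mem_duplicateCone h2 (add_mem (mul_mem hF.1 hG.1) (mul_mem hF.2 hG.2))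
        using 1
      ext ω
      simp only [Pi.add_apply, Pi.mul_apply]
      ring
    · convert const_mul_mem_duplicateCone h2 (add_mem (mul_mem hF.2 hG.1) (mul_mem hF.1 hG.2))
        using 1
      ext ω
      simp only [Pi.add_apply, Pi.mul_apply]
      ring

section

variable {ρ : Measure ℝ}

lemma IsSiteMeasure.integrable_pairSq (hρ : IsSiteMeasure ρ) (c : ℝ) :
    Integrable (fun z => Real.exp (c * pairSq z)) (ρ.prod ρ) := by
  have := hρ.isProb
  refine ((hρ.integrable_exp c).mul_prod (hρ.integrable_exp c)).congr (ae_of_all _ fun z => ?_)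
  simp [pairSq, mul_add, Real.exp_add]

lemma exists_prod_of_mem_closure {F : (V → ℝ × ℝ) → ℝ}
    (hF : F ∈ Submonoid.closure
      {F | ∃ (x : V) (p : ℝ × ℝ → ℝ), IsDuplicate p ∧ F = fun ω : V → ℝ × ℝ => p (ω x)}) :
    ∃ (A : Finset V) (p : V → ℝ × ℝ → ℝ), (∀ x, IsDuplicate (p x)) ∧
      ∀ ω, F ω = ∏ x ∈ A, p x (ω x) := by
  classical
  -- Requiring the factors to be `1` off `A` lets two products be padded to the common support `A ∪
  -- B`.
  suffices ∃ (A : Finset V) (p : V → ℝ × ℝ → ℝ), (∀ x, IsDuplicate (p x)) ∧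
      (∀ x ∉ A, p x = fun _ => 1) ∧ ∀ ω, F ω = ∏ x ∈ A, p x (ω x) by
    obtain ⟨A, p, h1, -, h2⟩ := this
    exact ⟨A, p, h1, h2⟩
  induction hF using Submonoid.closure_induction with
  | mem F h =>
    obtain ⟨x, p, hp, rfl⟩ := h
    refine ⟨{x}, fun y => if y = x then p else fun _ => 1, fun y => ?_, fun y hy => ?_, ?_⟩
    · dsimp only
      split_ifs
      · exact hp
      · exact isDuplicate_const zero_le_one
    · exact if_neg (by simpa using hy)
    · simp
  | one => exact ⟨∅, fun _ _ => 1, fun _ => isDuplicate_const zero_le_one, by simp, by simp⟩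
  | mul F G _ _ hF hG =>
    obtain ⟨A, p, h1, h2, h3⟩ := hF
    obtain ⟨B, q, k1, k2, k3⟩ := hG
    refine ⟨A ∪ B, fun x z => p x z * q x z, fun x => (h1 x).mul (k1 x), fun x hx => ?_,
      fun ω => ?_⟩
    · rw [Finset.mem_union, not_or] at hx
      simp [h2 x hx.1, k2 x hx.2]
    · rw [Pi.mul_apply, h3, k3, Finset.prod_mul_distrib]
      congr 1
      · exact Finset.prod_subset Finset.subset_union_left fun x _ hx => by rw [h2 x hx]
      · exact Finset.prod_subset Finset.subset_union_right fun x _ hx => by rw [k2 x hx]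

/-- An element of the cone is a sum of products of one-site factors, and each product integrates to
a product of nonnegative one-site integrals. -/
lemma integral_nonneg_of_mem_duplicateCone (hρ : IsSiteMeasure ρ) {F : (V → ℝ × ℝ) → ℝ}
    (hF : F ∈ duplicateCone V) : 0 ≤ ∫ ω, F ω ∂(Measure.infinitePi fun _ : V => ρ.prod ρ) := by
  have := hρ.isProb
  -- Membership is kept in the induction because it supplies the integrability needed to split the
  -- integral of a sum.
  suffices F ∈ duplicateCone V ∧ 0 ≤ ∫ ω, F ω ∂(Measure.infinitePi fun _ : V => ρ.prod ρ) from
    this.2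
  rw [duplicateCone, Subsemiring.mem_closure_iff] at hF
  induction hF using AddSubmonoid.closure_induction with
  | mem F h =>
    refine ⟨?_, ?_⟩
    · rw [duplicateCone, Subsemiring.mem_closure_iff]
      exact AddSubmonoid.subset_closure h
    · obtain ⟨A, p, h1, h2⟩ := exists_prod_of_mem_closure h
      simp only [h2]
      rw [integral_prod_infinitePi _ _ _ fun x => (h1 x).measurable]
      exact Finset.prod_nonneg fun x _ => (h1 x).integral_nonneg hρ
  | zero => exact ⟨zero_mem _, by simp⟩
  | add F G _ _ hF hG =>
    refine ⟨add_mem hF.1 hG.1, ?_⟩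
    simp only [Pi.add_apply]
    rw [integral_add ((tame_of_mem_duplicateCone hF.1).integrable hρ.integrable_pairSq)
      ((tame_of_mem_duplicateCone hG.1).integrable hρ.integrable_pairSq)]
    exact add_nonneg hF.2 hG.2

/-- Ginibre's positivity of duplicated correlations. -/
lemma integral_mul_exp_nonneg [Nonempty V] (hρ : IsSiteMeasure ρ) {F H : (V → ℝ × ℝ) → ℝ}
    (hF : F ∈ duplicateCone V) (hH : H ∈ duplicateCone V) (hq : QuadBounded pairSq H) :
    0 ≤ ∫ ω, F ω * Real.exp (H ω) ∂(Measure.infinitePi fun _ : V => ρ.prod ρ) := by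
  have := hρ.isProb
  -- Expanding the exponential leaves partial sums of `F H ^ k / k!`, which lie in the cone and are
  -- dominated by `|F| exp |H|`.
  have hlim : Tendsto (fun N : ℕ => ∫ ω, F ω * ∑ k ∈ Finset.range N, H ω ^ k / k.factorial
      ∂(Measure.infinitePi fun _ : V => ρ.prod ρ)) atTop
      (𝓝 (∫ ω, F ω * Real.exp (H ω) ∂(Measure.infinitePi fun _ : V => ρ.prod ρ))) := by
    have hT := tame_of_mem_duplicateCone hF
    refine tendsto_integral_of_dominated_convergence (fun ω => |F ω * Real.exp (|H ω|)|)
      (fun N => ?_) ((hT.mul pairSq_nonneg hq.tame_exp_abs).integrable hρ.integrable_pairSq).abs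
      (fun N => ae_of_all _ fun ω => ?_) (ae_of_all _ fun ω => ?_)
    · have h1 := hT.1
      have h2 := hq.1
      exact Measurable.aestronglyMeasurable (by fun_prop)
    · rw [Real.norm_eq_abs, abs_mul, abs_mul, abs_of_pos (Real.exp_pos |H ω|)]
      refine mul_le_mul_of_nonneg_left ?_ (abs_nonneg _)
      refine (Finset.abs_sum_le_sum_abs _ _).trans ?_
      refine le_trans (le_of_eq (Finset.sum_congr rfl fun k _ => ?_))
        (Real.sum_le_exp_of_nonneg (abs_nonneg (H ω)) N)
      rw [abs_div, abs_pow, Nat.abs_cast]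
    · refine Tendsto.const_mul _ ?_
      have h := (NormedSpace.expSeries_div_hasSum_exp (H ω)).tendsto_sum_nat
      rwa [← Real.exp_eq_exp_ℝ] at h
  refine ge_of_tendsto' hlim fun N => integral_nonneg_of_mem_duplicateCone hρ ?_
  refine mul_mem hF ?_
  have : (fun ω => ∑ k ∈ Finset.range N, H ω ^ k / k.factorial) =
      ∑ k ∈ Finset.range N, fun ω => (k.factorial : ℝ)⁻¹ * (H ^ k) ω := by
    ext ω
    simp [Finset.sum_apply, div_eq_inv_mul]
  rw [this]
  exact sum_mem fun k _ => const_mul_mem_duplicateCone (by positivity) (pow_mem hH k)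

/-- A field of independent pairs is a pair of independent fields: the two measures agree on products
of cylinders, which generate. This turns Ginibre's integrals into products of ordinary ones. -/
lemma infinitePi_prod_map (ρ : Measure ℝ) [IsProbabilityMeasure ρ] :
    (Measure.infinitePi fun _ : V => ρ.prod ρ).map
      (fun ω => ((fun x => (ω x).1), fun x => (ω x).2)) =
    (Measure.infinitePi fun _ : V => ρ).prod (Measure.infinitePi fun _ : V => ρ) := by
  classical
  have hm : Measurable fun ω : V → ℝ × ℝ => ((fun x => (ω x).1), fun x => (ω x).2) := by fun_prop
  have hpi : IsPiSystem (squareCylinders fun _ : V => {s : Set ℝ | MeasurableSet s}) :=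
    isPiSystem_squareCylinders (fun _ => MeasurableSpace.isPiSystem_measurableSet) (by simp)
  have hgen := generateFrom_squareCylinders (ι := V) (α := fun _ => ℝ)
  have huniv : Set.univ ∈ squareCylinders fun _ : V => {s : Set ℝ | MeasurableSet s} :=
    ⟨∅, fun _ => Set.univ, by simp, by simp⟩
  have hspan : (Measure.infinitePi fun _ : V => ρ).FiniteSpanningSetsIn
      (squareCylinders fun _ : V => {s : Set ℝ | MeasurableSet s}) :=
    ⟨fun _ => Set.univ, fun _ => huniv, fun _ => measure_lt_top _ _,
      Set.iUnion_const _⟩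
  refine (Measure.prod_eq_generateFrom hgen hgen hpi hpi hspan hspan ?_).symm
  rintro _ ⟨A, s, hs, rfl⟩ _ ⟨B, t, ht, rfl⟩
  have hs' : ∀ x, MeasurableSet (s x) := fun x => hs x (Set.mem_univ x)
  have ht' : ∀ x, MeasurableSet (t x) := fun x => ht x (Set.mem_univ x)
  rw [Measure.map_apply hm ((MeasurableSet.pi A.countable_toSet fun x _ => hs' x).prod
    (MeasurableSet.pi B.countable_toSet fun x _ => ht' x))]
  have hset : (fun ω : V → ℝ × ℝ => ((fun x => (ω x).1), fun x => (ω x).2)) ⁻¹'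
      ((A : Set V).pi s ×ˢ (B : Set V).pi t) = ((A ∪ B : Finset V) : Set V).pi fun x =>
        (if x ∈ A then s x else Set.univ) ×ˢ (if x ∈ B then t x else Set.univ) := by
    ext ω
    simp only [Set.mem_preimage, Set.mem_prod, Set.mem_pi, Finset.mem_coe, Finset.mem_union]
    constructor
    · rintro ⟨h1, h2⟩ x hx
      refine ⟨?_, ?_⟩
      · split_ifs with h
        · exact h1 x h
        · trivial
      · split_ifs with h
        · exact h2 x h
        · trivial
    · intro h
      refine ⟨fun x hx => ?_, fun x hx => ?_⟩
      · simpa [hx] using (h x (Or.inl hx)).1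
      · simpa [hx] using (h x (Or.inr hx)).2
  rw [hset, Measure.infinitePi_pi, Measure.infinitePi_pi _ fun x _ => hs' x,
    Measure.infinitePi_pi _ fun x _ => ht' x]
  · simp only [Measure.prod_prod, Finset.prod_mul_distrib]
    congr 1
    · rw [← Finset.prod_subset (Finset.subset_union_left (s₁ := A) (s₂ := B))
        fun x _ hx => by simp [hx]]
      exact Finset.prod_congr rfl fun x hx => by simp [hx]
    · rw [← Finset.prod_subset (Finset.subset_union_right (s₁ := A) (s₂ := B))
        fun x _ hx => by simp [hx]]
      exact Finset.prod_congr rfl fun x hx => by simp [hx]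
  · intro x _
    refine MeasurableSet.prod ?_ ?_
    · split_ifs
      exacts [hs' x, MeasurableSet.univ]
    · split_ifs
      exacts [ht' x, MeasurableSet.univ]

lemma integral_mul_integral_eq (hρ : IsSiteMeasure ρ) {F G : (V → ℝ) → ℝ}
    (hF : Tame (fun t => t ^ 2) F) (hG : Tame (fun t => t ^ 2) G) :
    Integrable (fun ω : V → ℝ × ℝ => F (fun x => (ω x).1) * G fun x => (ω x).2)
      (Measure.infinitePi fun _ : V => ρ.prod ρ) ∧
    ∫ ω : V → ℝ × ℝ, F (fun x => (ω x).1) * G (fun x => (ω x).2)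
      ∂(Measure.infinitePi fun _ : V => ρ.prod ρ) =
    (∫ φ, F φ ∂(Measure.infinitePi fun _ : V => ρ)) *
      ∫ φ, G φ ∂(Measure.infinitePi fun _ : V => ρ) := by
  have := hρ.isProb
  have hm : Measurable fun ω : V → ℝ × ℝ => ((fun x => (ω x).1), fun x => (ω x).2) := by fun_prop
  have h1 := hF.1
  have h2 := hG.1
  have hFG : Measurable fun z : (V → ℝ) × (V → ℝ) => F z.1 * G z.2 := by fun_prop
  rw [← integral_prod_mul, ← infinitePi_prod_map,
    integral_map hm.aemeasurable hFG.aestronglyMeasurable]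
  refine ⟨?_, rfl⟩
  have h3 := (hF.integrable hρ.integrable_exp).mul_prod (hG.integrable hρ.integrable_exp)
  rw [← infinitePi_prod_map] at h3
  exact h3.comp_measurable hm

end

end

/-! ### Gibbs measures and Griffiths' inequalities. -/

section

/-- The Gibbs measure on `ℝ^V` with single-spin measure `ρ` and energy `-H`. -/
def gibbs (ρ : Measure ℝ) (H : (V → ℝ) → ℝ) : Measure (V → ℝ) :=
  (Measure.infinitePi fun _ : V => ρ).tilted H

/-- Functions bounded by a quadratic polynomial in finitely many spins. -/
abbrev IsQuadratic (H : (V → ℝ) → ℝ) : Prop := QuadBounded (fun t : ℝ => t ^ 2) H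

/-- Functions bounded by a Gaussian exponential in finitely many spins. -/
abbrev IsTame (F : (V → ℝ) → ℝ) : Prop := Tame (fun t : ℝ => t ^ 2) F

variable {ρ : Measure ℝ}

lemma IsTame.integrable (hρ : IsSiteMeasure ρ) {F : (V → ℝ) → ℝ} (hF : IsTame F) :
    Integrable F (Measure.infinitePi fun _ : V => ρ) := by
  have := hρ.isProb
  exact Tame.integrable hF hρ.integrable_exp

lemma IsTame.integrable_gibbs (hρ : IsSiteMeasure ρ) {F H : (V → ℝ) → ℝ} (hF : IsTame F)
    (hH : IsQuadratic H) : Integrable F (gibbs ρ H) := by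
  rw [gibbs, integrable_tilted_iff (IsTame.integrable hρ hH.tame_exp)]
  exact IsTame.integrable hρ (hH.tame_exp.mul (fun t => sq_nonneg t) hF)

lemma isProbabilityMeasure_gibbs (hρ : IsSiteMeasure ρ) {H : (V → ℝ) → ℝ} (hH : IsQuadratic H) :
    IsProbabilityMeasure (gibbs ρ H) := by
  have := hρ.isProb
  exact isProbabilityMeasure_tilted (IsTame.integrable hρ hH.tame_exp)

lemma partition_pos (hρ : IsSiteMeasure ρ) {H : (V → ℝ) → ℝ} (hH : IsQuadratic H) :
    0 < ∫ φ, Real.exp (H φ) ∂(Measure.infinitePi fun _ : V => ρ) := by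
  have := hρ.isProb
  exact integral_exp_pos (IsTame.integrable hρ hH.tame_exp)

lemma integral_gibbs (F H : (V → ℝ) → ℝ) :
    ∫ φ, F φ ∂(gibbs ρ H) = (∫ φ, F φ * Real.exp (H φ) ∂(Measure.infinitePi fun _ : V => ρ)) /
      ∫ φ, Real.exp (H φ) ∂(Measure.infinitePi fun _ : V => ρ) := by
  rw [gibbs, integral_tilted, ← integral_div]
  congr 1
  ext φ
  rw [smul_eq_mul]
  ring

lemma QuadBounded.comp_fst {H : (V → ℝ) → ℝ} (hH : IsQuadratic H) :
    QuadBounded pairSq (fun ω : V → ℝ × ℝ => H fun x => (ω x).1) := by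
  obtain ⟨h0, A, C, c, hC, hc, h⟩ := hH
  refine ⟨by fun_prop, A, C, c, hC, hc, fun ω => (h _).trans ?_⟩
  have : ∑ x ∈ A, (ω x).1 ^ 2 ≤ ∑ x ∈ A, pairSq (ω x) :=
    Finset.sum_le_sum fun x _ => by unfold pairSq; nlinarith [sq_nonneg (ω x).2]
  linarith [mul_le_mul_of_nonneg_left this hc]

lemma QuadBounded.comp_snd {H : (V → ℝ) → ℝ} (hH : IsQuadratic H) :
    QuadBounded pairSq (fun ω : V → ℝ × ℝ => H fun x => (ω x).2) := by
  obtain ⟨h0, A, C, c, hC, hc, h⟩ := hH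
  refine ⟨by fun_prop, A, C, c, hC, hc, fun ω => (h _).trans ?_⟩
  have : ∑ x ∈ A, (ω x).2 ^ 2 ≤ ∑ x ∈ A, pairSq (ω x) :=
    Finset.sum_le_sum fun x _ => by unfold pairSq; nlinarith [sq_nonneg (ω x).1]
  linarith [mul_le_mul_of_nonneg_left this hc]

variable [Nonempty V]

/-- Griffiths' first inequality. -/
lemma gibbs_nonneg (hρ : IsSiteMeasure ρ) {F H : (V → ℝ) → ℝ} (hF : F ∈ griffithsCone V)
    (hH : H ∈ griffithsCone V) (hq : IsQuadratic H) : 0 ≤ ∫ φ, F φ ∂(gibbs ρ H) := by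
  -- With `F + F'` and weight `exp (H + H')`, the duplicated integral is twice the integral of `F
  -- exp H` times the partition function.
  have h := integral_mul_exp_nonneg hρ (duplicate_mem_duplicateCone hF).1
    (duplicate_mem_duplicateCone hH).1 (hq.comp_fst.add pairSq_nonneg hq.comp_snd)
  have hFt := tame_of_mem_griffithsCone hF
  have h1 := integral_mul_integral_eq hρ (hFt.mul (fun t => sq_nonneg t) hq.tame_exp) hq.tame_exp
  have h2 := integral_mul_integral_eq hρ hq.tame_exp (hFt.mul (fun t => sq_nonneg t) hq.tame_exp)
  have hsum := integral_add h1.1 h2.1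
  rw [h1.2, h2.2] at hsum
  replace h := h.trans_eq ((integral_congr_ae (ae_of_all _ fun ω => by
    simp only [Real.exp_add]
    ring)).trans hsum)
  rw [integral_gibbs]
  have hZ := partition_pos hρ hq
  refine div_nonneg ?_ hZ.le
  by_contra hneg
  push Not at hneg
  nlinarith [mul_neg_of_neg_of_pos hneg hZ]

/-- Correlations of Griffiths functions increase when a Griffiths function is added to the
energy. -/
lemma gibbs_mono (hρ : IsSiteMeasure ρ) {F H D : (V → ℝ) → ℝ} (hF : F ∈ griffithsCone V)
    (hH : H ∈ griffithsCone V) (hq : IsQuadratic H) (hD : D ∈ griffithsCone V)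
    (hqD : IsQuadratic D) :
    ∫ φ, F φ ∂(gibbs ρ H) ≤ ∫ φ, F φ ∂(gibbs ρ fun φ => H φ + D φ) := by
  have hqs : IsQuadratic fun φ => H φ + D φ := hq.add (fun t => sq_nonneg t) hqD
  -- The first copy has energy `H + D` and the second `H`; writing `D` of the first copy as `((D +
  -- D') + (D - D')) / 2` keeps the total in the cone.
  have hE : (fun ω : V → ℝ × ℝ => (H (fun x => (ω x).1) + D fun x => (ω x).1) +
      H fun x => (ω x).2) ∈ duplicateCone V := by
    have h2 : (0 : ℝ) ≤ 1 / 2 := by norm_num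
    convert add_mem (duplicate_mem_duplicateCone hH).1 (const_mul_mem_duplicateCone h2
      (add_mem (duplicate_mem_duplicateCone hD).1 (duplicate_mem_duplicateCone hD).2)) using 1
    ext ω
    simp only [Pi.add_apply]
    ring
  have h := integral_mul_exp_nonneg hρ (duplicate_mem_duplicateCone hF).2 hE
    (hqs.comp_fst.add pairSq_nonneg hq.comp_snd)
  have hFt := tame_of_mem_griffithsCone hF
  have h1 := integral_mul_integral_eq hρ (hFt.mul (fun t => sq_nonneg t) hqs.tame_exp) hq.tame_exp
  have h2 := integral_mul_integral_eq hρ hqs.tame_exp (hFt.mul (fun t => sq_nonneg t) hq.tame_exp)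
  have hsum := integral_sub h1.1 h2.1
  rw [h1.2, h2.2] at hsum
  replace h := h.trans_eq ((integral_congr_ae (ae_of_all _ fun ω => by
    simp only [Real.exp_add]
    ring)).trans hsum)
  rw [integral_gibbs, integral_gibbs, div_le_div_iff₀ (partition_pos hρ hq) (partition_pos hρ hqs)]
  linarith

/-- Griffiths' second inequality, in Ginibre's form. -/
lemma gibbs_griffiths (hρ : IsSiteMeasure ρ) {F G H : (V → ℝ) → ℝ} (hF : F ∈ griffithsCone V)
    (hG : G ∈ griffithsCone V) (hH : H ∈ griffithsCone V) (hq : IsQuadratic H) :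
    (∫ φ, F φ ∂(gibbs ρ H)) * ∫ φ, G φ ∂(gibbs ρ H) ≤ ∫ φ, F φ * G φ ∂(gibbs ρ H) := by
  -- The duplicated integral of `(F - F')(G - G')` is twice the covariance times the squared
  -- partition function.
  have h := integral_mul_exp_nonneg hρ
    (mul_mem (duplicate_mem_duplicateCone hF).2 (duplicate_mem_duplicateCone hG).2)
    (duplicate_mem_duplicateCone hH).1 (hq.comp_fst.add pairSq_nonneg hq.comp_snd)
  have hs : ∀ t : ℝ, 0 ≤ t ^ 2 := fun t => sq_nonneg t
  have hFt := (tame_of_mem_griffithsCone hF)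
  have hGt := (tame_of_mem_griffithsCone hG)
  have hFe := hFt.mul hs hq.tame_exp
  have hGe := hGt.mul hs hq.tame_exp
  have hFGe := (hFt.mul hs hGt).mul hs hq.tame_exp
  have h1 := integral_mul_integral_eq hρ hFGe hq.tame_exp
  have h2 := integral_mul_integral_eq hρ hFe hGe
  have h3 := integral_mul_integral_eq hρ hGe hFe
  have h4 := integral_mul_integral_eq hρ hq.tame_exp hFGe
  have hsum := integral_add (h1.1.sub h2.1) (h4.1.sub h3.1)
  simp only [Pi.sub_apply] at hsum
  rw [integral_sub h1.1 h2.1, integral_sub h4.1 h3.1, h1.2, h2.2, h3.2, h4.2] at hsum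
  replace h := h.trans_eq ((integral_congr_ae (ae_of_all _ fun ω => by
    simp only [Pi.mul_apply, Real.exp_add]
    ring)).trans hsum)
  have hZ := partition_pos hρ hq
  rw [integral_gibbs, integral_gibbs, integral_gibbs, div_mul_div_comm,
    div_le_div_iff₀ (mul_pos hZ hZ) hZ, ← mul_assoc]
  refine mul_le_mul_of_nonneg_right ?_ hZ.le
  linarith

end

/-! ### Finite-volume energies and monotonicity in volume and field. -/

section

lemma IsQuadratic.spin (x : V) : IsQuadratic fun φ : V → ℝ => φ x := by
  refine ⟨measurable_pi_apply x, {x}, 1, 1, zero_le_one, zero_le_one, fun φ => ?_⟩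
  rw [Finset.sum_singleton]
  change |φ x| ≤ 1 + 1 * φ x ^ 2
  rw [← sq_abs (φ x)]
  nlinarith [sq_nonneg (|φ x| - 1), abs_nonneg (φ x)]

lemma IsQuadratic.spin_mul (x y : V) : IsQuadratic fun φ : V → ℝ => φ x * φ y := by
  classical
  have key : ∀ z : V, IsQuadratic fun φ : V → ℝ => φ z ^ 2 := fun z =>
    ⟨(measurable_pi_apply z).pow_const 2, {z}, 0, 1, le_rfl, zero_le_one,
      fun φ => by simp⟩
  obtain ⟨-, A, C, c, hC, hc, h⟩ := (key x).add (fun t => sq_nonneg t) (key y)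
  refine ⟨(measurable_pi_apply x).mul (measurable_pi_apply y), A, C, c, hC, hc,
    fun φ => le_trans ?_ (h φ)⟩
  rw [abs_mul, abs_of_nonneg (by positivity : 0 ≤ φ x ^ 2 + φ y ^ 2), ← sq_abs (φ x),
    ← sq_abs (φ y)]
  nlinarith [sq_nonneg (|φ x| - |φ y|), abs_nonneg (φ x), abs_nonneg (φ y), sq_nonneg |φ x|,
    sq_nonneg |φ y|]

lemma IsQuadratic.of_bounded {F : (V → ℝ) → ℝ} (hF : Measurable F) {C : ℝ} (h : ∀ φ, |F φ| ≤ C) :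
    IsQuadratic F :=
  ⟨hF, ∅, |C|, 0, abs_nonneg _, le_rfl, fun φ => by simpa using (h φ).trans (le_abs_self C)⟩

lemma IsQuadratic.add {F G : (V → ℝ) → ℝ} (hF : IsQuadratic F) (hG : IsQuadratic G) :
    IsQuadratic fun φ => F φ + G φ :=
  QuadBounded.add (fun t => sq_nonneg t) hF hG

lemma IsQuadratic.sub {F G : (V → ℝ) → ℝ} (hF : IsQuadratic F) (hG : IsQuadratic G) :
    IsQuadratic fun φ => F φ - G φ := by
  simpa [sub_eq_add_neg] using hF.add (QuadBounded.const_mul hG (-1))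

/-- The exponent of a finite-volume Gibbs weight with couplings `K` and fields `b`. -/
def pairEnergy (K : V → V → ℝ) (b : V → ℝ) (Λ : Finset V) (φ : V → ℝ) : ℝ :=
  ∑ x ∈ Λ, ∑ y ∈ Λ, K x y * (φ x * φ y) + ∑ x ∈ Λ, b x * φ x

lemma isQuadratic_pairEnergy (K : V → V → ℝ) (b : V → ℝ) (Λ : Finset V) :
    IsQuadratic (pairEnergy K b Λ) := by
  have hs : ∀ t : ℝ, 0 ≤ t ^ 2 := fun t => sq_nonneg t
  refine QuadBounded.add hs (QuadBounded.sum hs _ _ fun x _ => QuadBounded.sum hs _ _ fun y _ => ?_)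
    (QuadBounded.sum hs _ _ fun x _ => ?_)
  · exact QuadBounded.const_mul (IsQuadratic.spin_mul x y) _
  · exact QuadBounded.const_mul (IsQuadratic.spin x) _

lemma sum_mem_griffithsCone {ι : Type*} (s : Finset ι) (F : ι → (V → ℝ) → ℝ)
    (hF : ∀ i ∈ s, F i ∈ griffithsCone V) : (fun φ => ∑ i ∈ s, F i φ) ∈ griffithsCone V := by
  have : (fun φ => ∑ i ∈ s, F i φ) = ∑ i ∈ s, F i := by
    ext φ
    simp
  rw [this]
  exact sum_mem hF

lemma pairEnergy_mem_griffithsCone [Nonempty V] {K : V → V → ℝ} {b : V → ℝ} {Λ : Finset V}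
    (hK : ∀ x ∈ Λ, ∀ y ∈ Λ, 0 ≤ K x y) (hb : ∀ x ∈ Λ, 0 ≤ b x) :
    pairEnergy K b Λ ∈ griffithsCone V := by
  refine add_mem (sum_mem_griffithsCone _ _ fun x hx => sum_mem_griffithsCone _ _ fun y hy => ?_)
    (sum_mem_griffithsCone _ _ fun x hx => ?_)
  · exact const_mul_mem_griffithsCone (hK x hx y hy)
      (mul_mem (mem_griffithsCone x isGriffiths_id) (mem_griffithsCone y isGriffiths_id))
  · exact const_mul_mem_griffithsCone (hb x hx) (mem_griffithsCone x isGriffiths_id)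

/-- The exponent of the Gibbs weight in the volume `Λ` with constant field `h`. -/
def energy (J : V → V → ℝ) (β h : ℝ) (Λ : Finset V) : (V → ℝ) → ℝ :=
  pairEnergy (fun x y => β * J x y) (fun _ => β * h) Λ

/-- The difference is again a pair energy on `Λ'`, with the couplings inside `Λ` removed and the
field there reduced; all its coefficients are nonnegative. -/
lemma energy_sub_mem_griffithsCone [Nonempty V] {J : V → V → ℝ} {β h h' : ℝ} {Λ Λ' : Finset V}
    (hJ : ∀ x y, 0 ≤ J x y) (hβ : 0 ≤ β) (h0 : 0 ≤ h) (hh : h ≤ h') (hΛ : Λ ⊆ Λ') :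
    (fun φ => energy J β h' Λ' φ - energy J β h Λ φ) ∈ griffithsCone V := by
  classical
  have : (fun φ => energy J β h' Λ' φ - energy J β h Λ φ) = pairEnergy
      (fun x y => β * J x y - if x ∈ Λ then if y ∈ Λ then β * J x y else 0 else 0)
      (fun x => β * h' - if x ∈ Λ then β * h else 0) Λ' := by
    ext φ
    simp only [energy, pairEnergy, sub_mul, Finset.sum_sub_distrib, ite_mul, zero_mul]
    have e1 : ∀ f : V → ℝ, (∑ x ∈ Λ', if x ∈ Λ then f x else 0) = ∑ x ∈ Λ, f x := fun f => by
      rw [← Finset.sum_filter, Finset.filter_mem_eq_inter, Finset.inter_eq_right.2 hΛ]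
    have e2 : (∑ x ∈ Λ', ∑ y ∈ Λ', if x ∈ Λ then if y ∈ Λ then β * J x y * (φ x * φ y) else 0
        else 0) = ∑ x ∈ Λ, ∑ y ∈ Λ, β * J x y * (φ x * φ y) := by
      rw [← e1]
      refine Finset.sum_congr rfl fun x _ => ?_
      split_ifs
      · exact e1 _
      · simp
    rw [e1, e2]
    ring
  rw [this]
  refine pairEnergy_mem_griffithsCone (fun x _ y _ => ?_) fun x _ => ?_
  · have := mul_nonneg hβ (hJ x y)
    split_ifs <;> simp [this]
  · have h1 : β * h ≤ β * h' := mul_le_mul_of_nonneg_left hh hβ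
    have h2 : 0 ≤ β * h' := mul_nonneg hβ (h0.trans hh)
    split_ifs <;> simp [h1, h2]

lemma energy_mem_griffithsCone [Nonempty V] {J : V → V → ℝ} {β h : ℝ} (Λ : Finset V)
    (hJ : ∀ x y, 0 ≤ J x y) (hβ : 0 ≤ β) (h0 : 0 ≤ h) : energy J β h Λ ∈ griffithsCone V :=
  pairEnergy_mem_griffithsCone (fun x _ y _ => mul_nonneg hβ (hJ x y)) fun _ _ => mul_nonneg hβ h0

lemma isQuadratic_energy (J : V → V → ℝ) (β h : ℝ) (Λ : Finset V) :
    IsQuadratic (energy J β h Λ) :=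
  isQuadratic_pairEnergy _ _ _

lemma gibbs_le_gibbs [Nonempty V] {ρ : Measure ℝ} (hρ : IsSiteMeasure ρ) {F H H' : (V → ℝ) → ℝ}
    (hF : F ∈ griffithsCone V) (hH : H ∈ griffithsCone V) (hq : IsQuadratic H)
    (hD : (fun φ => H' φ - H φ) ∈ griffithsCone V) (hq' : IsQuadratic H') :
    ∫ φ, F φ ∂(gibbs ρ H) ≤ ∫ φ, F φ ∂(gibbs ρ H') := by
  have h := gibbs_mono hρ hF hH hq hD (hq'.sub hq)
  simpa using h

lemma gibbs_energy_mono [Nonempty V] {ρ : Measure ℝ} (hρ : IsSiteMeasure ρ) {F : (V → ℝ) → ℝ}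
    (hF : F ∈ griffithsCone V) {J : V → V → ℝ} {β h h' : ℝ} {Λ Λ' : Finset V}
    (hJ : ∀ x y, 0 ≤ J x y) (hβ : 0 ≤ β) (h0 : 0 ≤ h) (hh : h ≤ h') (hΛ : Λ ⊆ Λ') :
    ∫ φ, F φ ∂(gibbs ρ (energy J β h Λ)) ≤ ∫ φ, F φ ∂(gibbs ρ (energy J β h' Λ')) :=
  gibbs_le_gibbs hρ hF (energy_mem_griffithsCone Λ hJ hβ h0) (isQuadratic_energy _ _ _ _)
    (energy_sub_mem_griffithsCone hJ hβ h0 hh hΛ) (isQuadratic_energy _ _ _ _)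

lemma tilted_map {X Y : Type*} [MeasurableSpace X] [MeasurableSpace Y] {μ : Measure X}
    {f : X → Y} (hf : Measurable f) {H : Y → ℝ} (hH : Measurable H) :
    (μ.map f).tilted H = (μ.tilted fun x => H (f x)).map f := by
  ext s hs
  rw [tilted_apply' _ _ hs, Measure.map_apply hf hs, tilted_apply' _ _ (hf hs),
    setLIntegral_map hs (by fun_prop) hf, integral_map hf.aemeasurable (by fun_prop)]

/-- The configuration that agrees with `φ` on `Λ` and vanishes elsewhere. -/
def cutoff (Λ : Finset V) (φ : V → ℝ) : V → ℝ := (Λ : Set V).indicator φ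

lemma measurable_cutoff (Λ : Finset V) : Measurable (cutoff Λ) := by
  classical
  refine measurable_pi_lambda _ fun x => ?_
  by_cases hx : x ∈ Λ
  · simpa [cutoff, hx] using measurable_pi_apply x
  · simp [cutoff, hx]

/-- Keeping the spins outside `Λ` as independent spins puts all volumes over the same product
measure, where Griffiths' inequalities compare them. Applying `cutoff` restores the zero boundary
condition and does not affect functions of the spins in `Λ`. -/
lemma freeMeasureOn_eq (J : V → V → ℝ) {g a : ℝ} (hg : 0 < g) (β h : ℝ) (Λ : Finset V) :
    freeMeasureOn J g a β h Λ = (gibbs (singleSite g a) (energy J β h Λ)).map (cutoff Λ) := by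
  have := (isSiteMeasure_singleSite a hg).isProb
  have hext : Measurable fun φ : Λ → ℝ => Function.extend (Subtype.val : Λ → V) φ 0 := by
    refine measurable_pi_lambda _ fun x => ?_
    by_cases hx : x ∈ Λ
    · have : (fun φ : Λ → ℝ => Function.extend (Subtype.val : Λ → V) φ 0 x) =
          fun φ => φ ⟨x, hx⟩ := by
        ext φ
        exact Subtype.val_injective.extend_apply φ 0 ⟨x, hx⟩
      rw [this]
      exact measurable_pi_apply _
    · have : (fun φ : Λ → ℝ => Function.extend (Subtype.val : Λ → V) φ 0 x) = fun _ => 0 := by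
        ext φ
        exact Function.extend_apply' _ _ _ (by simpa using hx)
      rw [this]
      exact measurable_const
  have hham : Measurable fun φ : Λ → ℝ => -β * hamiltonian J h Λ φ := by
    unfold hamiltonian
    fun_prop
  rw [freeMeasureOn, finiteVolume, ← Measure.infinitePi_map_restrict (fun _ : V => singleSite g a),
    tilted_map (Finset.measurable_restrict Λ) hham,
    Measure.map_map hext (Finset.measurable_restrict Λ), gibbs]
  have h1 : (fun φ : V → ℝ => -β * hamiltonian J h Λ (Λ.restrict φ)) = energy J β h Λ := by
    ext φ
    simp only [hamiltonian, energy, pairEnergy, Finset.restrict]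
    have e1 := Finset.sum_coe_sort Λ fun x => h * φ x
    have e2 := Finset.sum_coe_sort Λ fun x => ∑ y : Λ, J x y * φ x * φ y
    have e3 : ∀ x, ∑ y : Λ, J x y * φ x * φ y = ∑ y ∈ Λ, J x y * φ x * φ y := fun x =>
      Finset.sum_coe_sort Λ fun y => J x y * φ x * φ y
    rw [e1, e2]
    simp only [e3]
    simp only [mul_assoc, ← Finset.mul_sum]
    ring
  have h2 : (fun φ : Λ → ℝ => Function.extend (Subtype.val : Λ → V) φ 0) ∘ Λ.restrict =
      cutoff Λ := by
    ext φ x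
    by_cases hx : x ∈ Λ
    · have := Subtype.val_injective.extend_apply (Λ.restrict φ) (0 : V → ℝ) ⟨x, hx⟩
      simp only [Function.comp_apply]
      rw [this]
      simp [cutoff, hx]
    · simp only [Function.comp_apply]
      rw [Function.extend_apply' _ _ _ (by simpa using hx)]
      simp [cutoff, hx]
  rw [h1, h2]

end

/-! ### Relabelling of sites by symmetries of the couplings. -/

section Relabel

lemma infinitePi_map_comp_equiv (ρ : Measure ℝ) [IsProbabilityMeasure ρ] (e : V ≃ V) :
    (Measure.infinitePi fun _ : V => ρ).map (fun φ x => φ (e x)) =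
      Measure.infinitePi fun _ : V => ρ := by
  have h := Measure.infinitePi_map_piCongrLeft (fun _ : V => ρ) e.symm
  convert h using 2
  ext φ x
  have := MeasurableEquiv.piCongrLeft_apply_apply (β := fun _ : V => ℝ) e.symm φ (e x)
  simpa using this.symm

lemma energy_map_equiv {J : V → V → ℝ} (β h : ℝ) (Λ : Finset V) (e : V ≃ V)
    (he : ∀ x y, J (e x) (e y) = J x y) (φ : V → ℝ) :
    energy J β h (Λ.map e.toEmbedding) φ = energy J β h Λ fun x => φ (e x) := by
  simp [energy, pairEnergy, he]

lemma gibbs_map_equiv {ρ : Measure ℝ} (hρ : IsSiteMeasure ρ) {J : V → V → ℝ} (β h : ℝ)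
    (Λ : Finset V) (e : V ≃ V) (he : ∀ x y, J (e x) (e y) = J x y) :
    (gibbs ρ (energy J β h (Λ.map e.toEmbedding))).map (fun φ x => φ (e x)) =
      gibbs ρ (energy J β h Λ) := by
  have := hρ.isProb
  have hT : Measurable fun (φ : V → ℝ) x => φ (e x) := by fun_prop
  have h1 := tilted_map (μ := Measure.infinitePi fun _ : V => ρ) hT
    (isQuadratic_energy J β h Λ).1
  rw [infinitePi_map_comp_equiv] at h1
  rw [gibbs, gibbs, h1]
  congr 2
  ext φ
  exact energy_map_equiv β h Λ e he φ

end Relabel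

/-! ### Balls and summability of the couplings. -/

section Geometry

variable {G : SimpleGraph V}

lemma dist_map_le (hconn : G.Connected) (γ : G ≃g G) (x y : V) :
    G.dist (γ x) (γ y) ≤ G.dist x y := by
  obtain ⟨w, hw⟩ := hconn.exists_walk_length_eq_dist x y
  rw [← hw, ← SimpleGraph.Walk.length_map γ.toHom w]
  exact G.dist_le (w.map γ.toHom)

lemma dist_map (hconn : G.Connected) (γ : G ≃g G) (x y : V) :
    G.dist (γ x) (γ y) = G.dist x y := by
  refine le_antisymm (dist_map_le hconn γ x y) ?_
  simpa using dist_map_le hconn γ.symm (γ x) (γ y)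

lemma exists_balls {o : V} {d : ℝ} (hgrowth : HasPolynomialGrowth G o d) :
    ∃ ball : ℕ → Finset V, (∀ k x, x ∈ ball k ↔ G.dist o x ≤ k) ∧ ∃ c C : ℝ, 0 < c ∧ 0 < C ∧
      ∀ k : ℕ, 1 ≤ k → c * (k : ℝ) ^ d ≤ (ball k).card ∧ ((ball k).card : ℝ) ≤ C * (k : ℝ) ^ d := by
  obtain ⟨c, C, hc, hC, h⟩ := hgrowth
  have h1 : ∀ k : ℕ, 1 ≤ k → {x : V | G.dist o x ≤ k}.Finite := fun k hk => by
    -- `ncard` is zero on infinite sets, so the lower growth bound forces balls to be finite.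
    refine Set.finite_of_ncard_pos ?_
    have h2 : (0 : ℝ) < c * (k : ℝ) ^ d := by
      have : (0 : ℝ) < k := by exact_mod_cast hk
      positivity
    exact_mod_cast h2.trans_le (h k hk).1
  have h2 : ∀ k : ℕ, {x : V | G.dist o x ≤ k}.Finite := fun k =>
    (h1 (k + 1) (by omega)).subset fun x (hx : G.dist o x ≤ k) => show G.dist o x ≤ k + 1 by omega
  refine ⟨fun k => (h2 k).toFinset, fun k x => by simp, c, C, hc, hC, fun k hk => ?_⟩
  rw [← Set.ncard_eq_toFinset_card _ (h2 k)]
  exact h k hk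

lemma countable_of_growth {o : V} {d : ℝ} (hgrowth : HasPolynomialGrowth G o d) :
    Countable V := by
  obtain ⟨ball, hball, -⟩ := exists_balls hgrowth
  have : (Set.univ : Set V) = ⋃ k : ℕ, (ball k : Set V) := by
    ext x
    simp only [Set.mem_univ, Set.mem_iUnion, true_iff]
    exact ⟨G.dist o x, by simp [hball]⟩
  rw [← Set.countable_univ_iff, this]
  exact Set.countable_iUnion fun k => (ball k).countable_toSet

/-- Dyadic shells: at most `C 2 ^ ((j + 1) d)` points satisfy `2 ^ j ≤ dist < 2 ^ (j + 1)`, and each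
contributes at most `2 ^ (-j (d + ε))`. The shells sum to a geometric series of ratio `2 ^ (-ε)`. -/
lemma exists_sum_dist_rpow_le (hconn : G.Connected) {o : V} {d ε : ℝ} (hd : 0 ≤ d)
    (hgrowth : HasPolynomialGrowth G o d) (hε : 0 < ε) :
    ∃ S : ℝ, 0 ≤ S ∧ ∀ T : Finset V, o ∉ T →
      ∑ y ∈ T, (G.dist o y : ℝ) ^ (-(d + ε)) ≤ S := by
  classical
  obtain ⟨ball, hball, c, C, hc, hC, hb⟩ := exists_balls hgrowth
  set q : ℝ := (2 : ℝ) ^ (-ε) with hq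
  have hq0 : 0 ≤ q := by positivity
  have hq1 : q < 1 := Real.rpow_lt_one_of_one_lt_of_neg one_lt_two (by linarith)
  have hsum := summable_geometric_of_lt_one hq0 hq1
  refine ⟨C * 2 ^ d * ∑' j : ℕ, q ^ j, by positivity, fun T hT => ?_⟩
  set N := T.sup (fun y => Nat.log 2 (G.dist o y)) + 1 with hN
  have hmaps : ∀ y ∈ T, Nat.log 2 (G.dist o y) ∈ Finset.range N := fun y hy => by
    have := Finset.le_sup (f := fun y => Nat.log 2 (G.dist o y)) hy
    simp only [Finset.mem_range, hN]
    omega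
  rw [← Finset.sum_fiberwise_of_maps_to hmaps]
  refine le_trans (Finset.sum_le_sum fun j _ => ?_)
    (le_trans (le_of_eq (Finset.mul_sum (Finset.range N) (fun j => q ^ j) (C * 2 ^ d)).symm)
      (mul_le_mul_of_nonneg_left (hsum.sum_le_tsum _ fun _ _ => by positivity) (by positivity)))
  have hterm : ∀ y ∈ T.filter (fun y => Nat.log 2 (G.dist o y) = j),
      (G.dist o y : ℝ) ^ (-(d + ε)) ≤ ((2 : ℝ) ^ j) ^ (-(d + ε)) := fun y hy => by
    rw [Finset.mem_filter] at hy
    have hne : o ≠ y := fun h => hT (h ▸ hy.1)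
    have h1 : 2 ^ j ≤ G.dist o y := by
      have := Nat.pow_log_le_self 2 (hconn.pos_dist_of_ne hne).ne'
      rwa [hy.2] at this
    refine Real.rpow_le_rpow_of_nonpos (by positivity) (by exact_mod_cast h1) (by linarith)
  refine (Finset.sum_le_card_nsmul _ _ _ hterm).trans ?_
  have hcard : ((T.filter (fun y => Nat.log 2 (G.dist o y) = j)).card : ℝ) ≤
      C * ((2 : ℝ) ^ (j + 1)) ^ d := by
    refine le_trans ?_ (le_of_le_of_eq (hb (2 ^ (j + 1)) Nat.one_le_two_pow).2 (by push_cast; rfl))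
    refine Nat.cast_le.2 (Finset.card_le_card fun y hy => ?_)
    rw [Finset.mem_filter] at hy
    rw [hball, ← hy.2]
    exact (Nat.lt_pow_succ_log_self one_lt_two _).le
  rw [nsmul_eq_mul]
  refine (mul_le_mul_of_nonneg_right hcard (by positivity)).trans (le_of_eq ?_)
  rw [pow_succ, Real.mul_rpow (by positivity) (by positivity), neg_add,
    Real.rpow_add (by positivity), hq]
  have e1 : ((2 : ℝ) ^ j) ^ d * ((2 : ℝ) ^ j) ^ (-d) = 1 := by
    rw [← Real.rpow_add (by positivity), add_neg_cancel, Real.rpow_zero]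
  have e2 : ((2 : ℝ) ^ j) ^ (-ε) = ((2 : ℝ) ^ (-ε)) ^ j := by
    rw [← Real.rpow_natCast, ← Real.rpow_natCast, ← Real.rpow_mul (by norm_num),
      ← Real.rpow_mul (by norm_num), mul_comm]
  rw [e2]
  linear_combination (C * 2 ^ d * ((2 : ℝ) ^ (-ε)) ^ j) * e1

/-- An automorphism moving `x` to `o` reduces to the sum at `o`, and the diagonal couplings are all
equal. Row and column sums are bounded separately because `J` need not be symmetric. -/
lemma exists_coupling_bound (hconn : G.Connected) {o : V} {d : ℝ} (hd : 0 ≤ d)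
    (hgrowth : HasPolynomialGrowth G o d) {Γ : Subgroup (G ≃g G)} (hΓ : IsVertexTransitive Γ)
    {J : V → V → ℝ} (hJ : IsAdmissible G Γ d J) :
    ∃ κ : ℝ, 0 ≤ κ ∧ ∀ (Λ : Finset V) (x : V), ∑ y ∈ Λ, J x y ≤ κ ∧ ∑ y ∈ Λ, J y x ≤ κ := by
  classical
  obtain ⟨C, ε, hC, hε, hb⟩ := hJ.integrable
  obtain ⟨S, hS, hs⟩ := exists_sum_dist_rpow_le hconn hd hgrowth hε
  have hoo := hJ.ferromagnetic o o
  have key : ∀ (B : V → ℝ) (Λ : Finset V) (x : V), (∀ y, 0 ≤ B y) → B x = J o o →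
      (∀ y, y ≠ x → B y ≤ C * (G.dist x y : ℝ) ^ (-(d + ε))) → ∑ y ∈ Λ, B y ≤ J o o + C * S := by
    intro B Λ x hB hx hle
    obtain ⟨γ, -, hγ⟩ := hΓ x o
    have h1 : ∑ y ∈ Λ, B y ≤ ∑ y ∈ insert x (Λ.erase x), B y :=
      Finset.sum_le_sum_of_subset_of_nonneg
        (fun y hy => by by_cases h : y = x <;> simp [h, hy]) fun y _ _ => hB y
    refine h1.trans ?_
    rw [Finset.sum_insert (Finset.notMem_erase _ _), hx]
    refine add_le_add le_rfl ?_
    refine (Finset.sum_le_sum fun y hy => hle y (Finset.ne_of_mem_erase hy)).trans ?_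
    rw [← Finset.mul_sum]
    refine mul_le_mul_of_nonneg_left ?_ hC.le
    have h2 := hs ((Λ.erase x).map γ.toEquiv.toEmbedding) (by
      rw [← hγ]
      simp)
    rw [Finset.sum_map] at h2
    refine le_trans (le_of_eq (Finset.sum_congr rfl fun y _ => ?_)) h2
    have h3 := dist_map hconn γ x y
    rw [hγ] at h3
    rw [← h3]
    rfl
  have hdiag : ∀ x, J x x = J o o := fun x => by
    obtain ⟨γ, hγ, hγx⟩ := hΓ o x
    rw [← hγx, hJ.invariant γ hγ]
  refine ⟨J o o + C * S, by positivity, fun Λ x => ⟨key (fun y => J x y) Λ x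
    (fun y => hJ.ferromagnetic x y) (hdiag x) fun y hy => hb x y hy.symm, ?_⟩⟩
  refine key (fun y => J y x) Λ x (fun y => hJ.ferromagnetic y x) (hdiag x) fun y hy => ?_
  rw [G.dist_comm]
  exact hb y x hy

end Geometry

/-! ### Uniform bounds on second moments. -/

section Moments

variable {ρ : Measure ℝ}

/-- The inequality `2 φ x φ y ≤ φ x ^ 2 + φ y ^ 2` decouples the sites, so exponential moments
factor. -/
lemma energy_le {J : V → V → ℝ} (hJ : ∀ x y, 0 ≤ J x y) {β h κ : ℝ} (hβ : 0 ≤ β)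
    (hκ : ∀ (Λ : Finset V) (x : V), ∑ y ∈ Λ, J x y ≤ κ ∧ ∑ y ∈ Λ, J y x ≤ κ) (Λ : Finset V)
    (φ : V → ℝ) : energy J β h Λ φ ≤ ∑ x ∈ Λ, (β * κ * φ x ^ 2 + β * h * φ x) := by
  have h1 : ∀ x y, β * J x y * (φ x * φ y) ≤
      β / 2 * (J x y * φ x ^ 2) + β / 2 * (J x y * φ y ^ 2) := fun x y => by
    have := mul_nonneg (mul_nonneg hβ (hJ x y)) (sq_nonneg (φ x - φ y))
    linarith
  have h2 : ∑ x ∈ Λ, ∑ y ∈ Λ, J x y * φ x ^ 2 ≤ ∑ x ∈ Λ, κ * φ x ^ 2 :=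
    Finset.sum_le_sum fun x _ => by
      rw [← Finset.sum_mul]
      exact mul_le_mul_of_nonneg_right (hκ Λ x).1 (sq_nonneg _)
  have h3 : ∑ x ∈ Λ, ∑ y ∈ Λ, J x y * φ y ^ 2 ≤ ∑ x ∈ Λ, κ * φ x ^ 2 := by
    rw [Finset.sum_comm]
    exact Finset.sum_le_sum fun x _ => by
      rw [← Finset.sum_mul]
      exact mul_le_mul_of_nonneg_right (hκ Λ x).2 (sq_nonneg _)
  have h4 : ∑ x ∈ Λ, ∑ y ∈ Λ, β * J x y * (φ x * φ y) ≤ β * ∑ x ∈ Λ, κ * φ x ^ 2 := by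
    refine (Finset.sum_le_sum fun x _ => Finset.sum_le_sum fun y _ => h1 x y).trans ?_
    simp only [Finset.sum_add_distrib, ← Finset.mul_sum] at h2 h3 ⊢
    nlinarith [mul_le_mul_of_nonneg_left h2 hβ, mul_le_mul_of_nonneg_left h3 hβ]
  rw [Finset.sum_add_distrib]
  refine add_le_add (h4.trans (le_of_eq ?_)) le_rfl
  rw [Finset.mul_sum]
  exact Finset.sum_congr rfl fun x _ => by ring

/-- Use `exp H ≥ 1 + H`; the integral of `H` is nonnegative by Griffiths' first inequality at zero
energy. -/
lemma one_le_partition [Nonempty V] (hρ : IsSiteMeasure ρ) {H : (V → ℝ) → ℝ}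
    (hH : H ∈ griffithsCone V) (hq : IsQuadratic H) :
    1 ≤ ∫ φ, Real.exp (H φ) ∂(Measure.infinitePi fun _ : V => ρ) := by
  have := hρ.isProb
  have h1 := gibbs_nonneg hρ hH (zero_mem (griffithsCone V)) (QuadBounded.const 0)
  rw [gibbs, tilted_zero] at h1
  have h2 : ∫ φ, (H φ + 1) ∂(Measure.infinitePi fun _ : V => ρ) ≤
      ∫ φ, Real.exp (H φ) ∂(Measure.infinitePi fun _ : V => ρ) :=
    integral_mono ((IsTame.integrable hρ hq.tame).add (integrable_const 1))
      (IsTame.integrable hρ hq.tame_exp) fun φ => Real.add_one_le_exp _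
  rw [integral_add (IsTame.integrable hρ hq.tame) (integrable_const 1)] at h2
  simp only [integral_const, probReal_univ, smul_eq_mul, mul_one] at h2
  linarith

lemma isGriffiths_min_sq {K : ℝ} (hK : 0 ≤ K) : IsGriffiths fun t => min (t ^ 2) K := by
  refine ⟨by fun_prop, Or.inl (by simp), fun t _ => le_min (sq_nonneg t) hK,
    fun s hs t ht hst => ?_, K, 0, hK, le_rfl, fun t => ?_⟩
  · exact min_le_min_right _ (pow_le_pow_left₀ hs hst 2)
  · rw [abs_of_nonneg (le_min (sq_nonneg t) hK)]
    simp

/-- By Jensen's inequality the exponential of the sum of moments is at most the expectation of `exp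
(∑ φ x ^ 2)`. As the partition function is at least `1` and the energy is dominated site by site,
this is at most the `Λ.card`-th power of a one-site integral, whose logarithm is `L`. -/
lemma sum_moment_le [Nonempty V] (hρ : IsSiteMeasure ρ) {J : V → V → ℝ} (hJ : ∀ x y, 0 ≤ J x y)
    {β h κ : ℝ} (hβ : 0 ≤ β) (h0 : 0 ≤ h)
    (hκ : ∀ (Λ : Finset V) (x : V), ∑ y ∈ Λ, J x y ≤ κ ∧ ∑ y ∈ Λ, J y x ≤ κ) :
    ∃ L : ℝ, ∀ (K : ℝ), 0 ≤ K → ∀ Λ : Finset V,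
      ∑ x ∈ Λ, ∫ φ, min (φ x ^ 2) K ∂(gibbs ρ (energy J β h Λ)) ≤ L * Λ.card := by
  have := hρ.isProb
  set w : ℝ → ℝ := fun t => Real.exp ((1 + β * κ) * t ^ 2 + β * h * t) with hw
  have hwi : Integrable w ρ := by
    refine ((hρ.integrable_exp (1 + β * κ + (β * h) ^ 2)).const_mul (Real.exp 1)).mono'
      (by fun_prop) (ae_of_all _ fun t => ?_)
    rw [Real.norm_eq_abs, abs_of_pos (Real.exp_pos _), ← Real.exp_add]
    refine Real.exp_le_exp.2 ?_
    nlinarith [sq_nonneg (β * h * t - 1)]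
  have hwpos : 0 < ∫ t, w t ∂ρ := integral_exp_pos hwi
  refine ⟨Real.log (∫ t, w t ∂ρ), fun K hK Λ => ?_⟩
  have hq := isQuadratic_energy J β h Λ
  have hprob := isProbabilityMeasure_gibbs hρ hq
  have hm : ∀ x : V, Measurable fun φ : V → ℝ => min (φ x ^ 2) K := fun x => by fun_prop
  have hbd : ∀ (x : V) (φ : V → ℝ), |min (φ x ^ 2) K| ≤ K := fun x φ => by
    rw [abs_of_nonneg (le_min (sq_nonneg _) hK)]
    exact min_le_right _ _
  have hxq : ∀ x : V, IsQuadratic fun φ : V → ℝ => min (φ x ^ 2) K := fun x =>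
    IsQuadratic.of_bounded (hm x) (hbd x)
  set X : (V → ℝ) → ℝ := fun φ => ∑ x ∈ Λ, min (φ x ^ 2) K with hX
  have hXq : IsQuadratic X := QuadBounded.sum (fun t => sq_nonneg t) _ _ fun x _ => hxq x
  rw [← integral_finsetSum _ fun x _ => IsTame.integrable_gibbs hρ (hxq x).tame hq]
  change ∫ φ, X φ ∂_ ≤ _
  have hJensen : Real.exp (∫ φ, X φ ∂(gibbs ρ (energy J β h Λ))) ≤
      ∫ φ, Real.exp (X φ) ∂(gibbs ρ (energy J β h Λ)) :=
    convexOn_exp.map_integral_le Real.continuous_exp.continuousOn isClosed_univ (by simp)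
      (IsTame.integrable_gibbs hρ hXq.tame hq) (IsTame.integrable_gibbs hρ hXq.tame_exp hq)
  have hZ := one_le_partition hρ (energy_mem_griffithsCone Λ hJ hβ h0) hq
  have hle : ∫ φ, Real.exp (X φ) ∂(gibbs ρ (energy J β h Λ)) ≤ (∫ t, w t ∂ρ) ^ Λ.card := by
    rw [integral_gibbs]
    refine (div_le_self (integral_nonneg fun φ => by positivity) hZ).trans ?_
    rw [← Finset.prod_const, ← integral_prod_infinitePi ρ Λ (fun _ => w) fun _ => by fun_prop]
    refine integral_mono (IsTame.integrable hρ (hXq.tame_exp.mul (fun t => sq_nonneg t)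
      hq.tame_exp)) (integrable_prod_infinitePi ρ Λ _ fun _ => hwi) fun φ => ?_
    dsimp only
    rw [← Real.exp_add, hw, ← Real.exp_sum]
    refine Real.exp_le_exp.2 ?_
    have h1 : X φ ≤ ∑ x ∈ Λ, φ x ^ 2 := Finset.sum_le_sum fun x _ => min_le_left _ _
    have h2 := energy_le (h := h) hJ hβ hκ Λ φ
    calc X φ + energy J β h Λ φ
        ≤ ∑ x ∈ Λ, φ x ^ 2 + ∑ x ∈ Λ, (β * κ * φ x ^ 2 + β * h * φ x) := add_le_add h1 h2
      _ = ∑ x ∈ Λ, ((1 + β * κ) * φ x ^ 2 + β * h * φ x) := by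
        rw [← Finset.sum_add_distrib]
        exact Finset.sum_congr rfl fun x _ => by ring
  have h3 := Real.log_le_log (Real.exp_pos _) (hJensen.trans hle)
  rw [Real.log_exp, Real.log_pow] at h3
  linarith

/-- Truncated second moments are bounded uniformly in the volume, the site, the field and the
truncation. -/
lemma exists_moment_bound (hρ : IsSiteMeasure ρ) {G : SimpleGraph V} (hconn : G.Connected)
    {o : V} {d : ℝ} (hd : 0 ≤ d) (hgrowth : HasPolynomialGrowth G o d) {Γ : Subgroup (G ≃g G)}
    (hΓ : IsVertexTransitive Γ) {J : V → V → ℝ} (hJ : IsAdmissible G Γ d J) {β h : ℝ}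
    (hβ : 0 ≤ β) (h0 : 0 ≤ h) :
    ∃ M : ℝ, 0 ≤ M ∧ ∀ (K : ℝ), 0 ≤ K → ∀ (Λ : Finset V) (x : V),
      ∫ φ, min (φ x ^ 2) K ∂(gibbs ρ (energy J β h Λ)) ≤ M := by
  have : Nonempty V := ⟨o⟩
  obtain ⟨κ, -, hκ⟩ := exists_coupling_bound hconn hd hgrowth hΓ hJ
  obtain ⟨L, hL⟩ := sum_moment_le hρ hJ.ferromagnetic hβ h0 hκ
  obtain ⟨ball, hball, c, C, hc, hC, hb⟩ := exists_balls hgrowth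
  have hmove : ∀ (γ : G ≃g G), γ ∈ Γ → ∀ (K : ℝ) (Λ : Finset V) (x : V),
      ∫ φ, min (φ (γ x) ^ 2) K ∂(gibbs ρ (energy J β h (Λ.map γ.toEquiv.toEmbedding))) =
        ∫ φ, min (φ x ^ 2) K ∂(gibbs ρ (energy J β h Λ)) := by
    intro γ hγ K Λ x
    rw [← gibbs_map_equiv hρ β h Λ γ.toEquiv (hJ.invariant γ hγ), integral_map]
    · rfl
    · exact (measurable_pi_lambda _ fun x => measurable_pi_apply _).aemeasurable
    · exact Measurable.aestronglyMeasurable (by fun_prop)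
  -- If `Λ ⊆ B_r`, its translates taking `o` to a point `x` of `B_r` lie in `B_{2r}`. By
  -- monotonicity in the volume, the moment `m` at `o` in `Λ` is at most the moment at each such `x`
  -- in `B_{2r}`. Summing over `x` gives `|B_r| m ≤ L |B_{2r}|`, and polynomial growth bounds the
  -- ratio of the balls.
  have horigin : ∀ (K : ℝ), 0 ≤ K → ∀ Λ : Finset V,
      ∫ φ, min (φ o ^ 2) K ∂(gibbs ρ (energy J β h Λ)) ≤ |L| * (C * 2 ^ d) / c := by
    intro K hK Λ
    set m := ∫ φ, min (φ o ^ 2) K ∂(gibbs ρ (energy J β h Λ)) with hm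
    -- The `+ 1` ensures `r ≥ 1`, where the growth bounds apply.
    set r := Λ.sup (G.dist o) + 1 with hr
    have hsite : ∀ x ∈ ball r,
        m ≤ ∫ φ, min (φ x ^ 2) K ∂(gibbs ρ (energy J β h (ball (2 * r)))) := by
      intro x hx
      obtain ⟨γ, hγ, hγx⟩ := hΓ o x
      rw [hm, ← hmove γ hγ, hγx]
      refine gibbs_energy_mono hρ (mem_griffithsCone x (isGriffiths_min_sq hK)) hJ.ferromagnetic hβ
        h0 le_rfl fun z hz => ?_
      obtain ⟨y, hy, rfl⟩ := Finset.mem_map.1 hz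
      rw [hball] at hx ⊢
      have h1 := hconn.dist_triangle (u := o) (v := x) (w := γ y)
      have h2 := dist_map hconn γ o y
      rw [hγx] at h2
      have h3 : G.dist o y ≤ Λ.sup (G.dist o) := Finset.le_sup hy
      change G.dist o (γ y) ≤ 2 * r
      omega
    have hsub : ball r ⊆ ball (2 * r) := fun x hx => by
      rw [hball] at hx ⊢
      omega
    have hpos : ∀ x, 0 ≤ ∫ φ, min (φ x ^ 2) K ∂(gibbs ρ (energy J β h (ball (2 * r)))) :=
      fun x => integral_nonneg fun φ => le_min (sq_nonneg _) hK
    have h1 : (ball r).card * m ≤ L * (ball (2 * r)).card := by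
      refine le_trans ?_ (hL K hK (ball (2 * r)))
      refine le_trans ?_ (Finset.sum_le_sum_of_subset_of_nonneg hsub fun x _ _ => hpos x)
      rw [← nsmul_eq_mul]
      exact Finset.card_nsmul_le_sum _ _ _ hsite
    have hm0 : 0 ≤ m := integral_nonneg fun φ => le_min (sq_nonneg _) hK
    have hr0 : (0 : ℝ) < r := by rw [hr]; positivity
    have h2 : c * (r : ℝ) ^ d * m ≤ |L| * (C * (2 ^ d * (r : ℝ) ^ d)) := by
      refine (mul_le_mul_of_nonneg_right (hb r (by omega)).1 hm0).trans (h1.trans ?_)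
      refine (mul_le_mul_of_nonneg_right (le_abs_self L) (Nat.cast_nonneg _)).trans ?_
      refine mul_le_mul_of_nonneg_left ?_ (abs_nonneg L)
      refine (hb (2 * r) (by omega)).2.trans (le_of_eq ?_)
      push_cast
      rw [Real.mul_rpow (by norm_num) hr0.le]
    rw [le_div_iff₀ hc]
    have hrd : 0 < (r : ℝ) ^ d := by positivity
    refine le_of_mul_le_mul_right ?_ hrd
    linarith
  refine ⟨|L| * (C * 2 ^ d) / c, by positivity, fun K hK Λ x => ?_⟩
  obtain ⟨γ, hγ, hγx⟩ := hΓ x o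
  rw [← hmove γ hγ, hγx]
  exact horigin K hK _

end Moments

/-! ### Monomials in bounded spins, tightness and weak limits. -/

/-- A bounded, odd, increasing function of a spin. -/
def boundedSpin (t : ℝ) : ℝ := Real.arctan t / 2

lemma continuous_boundedSpin : Continuous boundedSpin := Real.continuous_arctan.div_const 2

lemma boundedSpin_strictMono : StrictMono boundedSpin := fun s t h => by
  have := Real.arctan_strictMono h
  unfold boundedSpin
  linarith

/-- The factor `1 / 2` in `boundedSpin` serves this bound: `π / 4 ≤ 1`. -/
lemma abs_boundedSpin_le_one (t : ℝ) : |boundedSpin t| ≤ 1 := by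
  rw [abs_le]
  unfold boundedSpin
  have h1 := Real.arctan_lt_pi_div_two t
  have h2 := Real.neg_pi_div_two_lt_arctan t
  have h3 := Real.pi_le_four
  constructor <;> linarith

lemma boundedSpin_neg (t : ℝ) : boundedSpin (-t) = -boundedSpin t := by
  unfold boundedSpin
  rw [Real.arctan_neg]
  ring

lemma boundedSpin_nonneg {t : ℝ} (ht : 0 ≤ t) : 0 ≤ boundedSpin t := by
  have := Real.arctan_nonneg.2 ht
  unfold boundedSpin
  linarith

lemma isGriffiths_boundedSpin : IsGriffiths boundedSpin :=
  ⟨continuous_boundedSpin.measurable, Or.inr boundedSpin_neg, fun _ ht => boundedSpin_nonneg ht,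
    boundedSpin_strictMono.monotone.monotoneOn _, 1, 0, zero_le_one, le_rfl,
    fun t => by simpa using abs_boundedSpin_le_one t⟩

/-- Products of bounded spins over a multiset of sites. -/
def monomial (A : Multiset V) (φ : V → ℝ) : ℝ := (A.map fun x => boundedSpin (φ x)).prod

lemma monomial_zero (φ : V → ℝ) : monomial 0 φ = 1 := by simp [monomial]

lemma monomial_cons (x : V) (A : Multiset V) (φ : V → ℝ) :
    monomial (x ::ₘ A) φ = boundedSpin (φ x) * monomial A φ := by simp [monomial]

lemma monomial_singleton (x : V) (φ : V → ℝ) : monomial {x} φ = boundedSpin (φ x) := by simp [monomial]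

lemma monomial_add (A B : Multiset V) (φ : V → ℝ) :
    monomial (A + B) φ = monomial A φ * monomial B φ := by simp [monomial]

lemma monomial_map (A : Multiset V) (e : V → V) (φ : V → ℝ) :
    monomial (A.map e) φ = monomial A fun x => φ (e x) := by
  simp [monomial]

lemma continuous_monomial (A : Multiset V) : Continuous (monomial A) :=
  continuous_multiset_prod _ fun x _ => continuous_boundedSpin.comp (continuous_apply x)

lemma abs_monomial_le_one (A : Multiset V) (φ : V → ℝ) : |monomial A φ| ≤ 1 := by
  induction A using Multiset.induction_on with
  | empty => simp [monomial]
  | cons x A ih =>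
    rw [monomial_cons, abs_mul]
    exact mul_le_one₀ (abs_boundedSpin_le_one _) (abs_nonneg _) ih

lemma monomial_mem_griffithsCone (A : Multiset V) : monomial A ∈ griffithsCone V := by
  induction A using Multiset.induction_on with
  | empty =>
    have : monomial (0 : Multiset V) = 1 := by
      ext φ
      exact monomial_zero φ
    rw [this]
    exact one_mem _
  | cons x A ih =>
    have : monomial (x ::ₘ A) = (fun φ => boundedSpin (φ x)) * monomial A := by
      ext φ
      exact monomial_cons x A φ
    rw [this]
    exact mul_mem (mem_griffithsCone x isGriffiths_boundedSpin) ih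

lemma monomial_congr {A : Multiset V} {φ ψ : V → ℝ} (h : ∀ x ∈ A, φ x = ψ x) :
    monomial A φ = monomial A ψ := by
  unfold monomial
  rw [Multiset.map_congr rfl fun x hx => by rw [h x hx]]

/-- Monomials as bounded continuous functions. -/
def monomialBCF (A : Multiset V) : (V → ℝ) →ᵇ ℝ :=
  BoundedContinuousFunction.ofNormedAddCommGroup (monomial A) (continuous_monomial A) 1
    fun φ => by simpa using abs_monomial_le_one A φ

@[simp] lemma monomialBCF_apply (A : Multiset V) (φ : V → ℝ) :
    monomialBCF A φ = monomial A φ := rfl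

lemma integrable_monomial [Countable V] (A : Multiset V) (μ : Measure (V → ℝ))
    [IsFiniteMeasure μ] : Integrable (monomial A) μ :=
  (monomialBCF A).integrable μ

/-- The algebra spanned by monomials. -/
def monomialAlgebra (V : Type*) : StarSubalgebra ℝ ((V → ℝ) →ᵇ ℝ) :=
  { Submodule.toSubalgebra (Submodule.span ℝ (Set.range (monomialBCF (V := V))))
      (Submodule.subset_span ⟨0, by ext φ; simp [monomial_zero]⟩)
      (fun f g hf hg => by
        induction hf using Submodule.span_induction with
        | mem f hf =>
          obtain ⟨A, rfl⟩ := hf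
          induction hg using Submodule.span_induction with
          | mem g hg =>
            obtain ⟨B, rfl⟩ := hg
            exact Submodule.subset_span ⟨A + B, by ext φ; simp [monomial_add]⟩
          | zero => simp
          | add g g' _ _ h h' => rw [mul_add]; exact add_mem h h'
          | smul r g _ h => rw [mul_smul_comm]; exact Submodule.smul_mem _ r h
        | zero => simp
        | add f f' _ _ h h' => rw [add_mul]; exact add_mem h h'
        | smul r f _ h => rw [smul_mul_assoc]; exact Submodule.smul_mem _ r h) with
    star_mem' := fun {f} hf => by
      have : star f = f := by
        ext φ
        simp
      rwa [this] }

lemma mem_monomialAlgebra {f : (V → ℝ) →ᵇ ℝ} :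
    f ∈ monomialAlgebra V ↔ f ∈ Submodule.span ℝ (Set.range (monomialBCF (V := V))) := Iff.rfl

/-- Finite measures on `ℝ^V` are determined by their integrals of monomials. -/
lemma ext_of_integral_monomial [Countable V] {μ ν : Measure (V → ℝ)} [IsFiniteMeasure μ]
    [IsFiniteMeasure ν] (h : ∀ A, ∫ φ, monomial A φ ∂μ = ∫ φ, monomial A φ ∂ν) : μ = ν := by
  refine ext_of_forall_mem_subalgebra_integral_eq_of_polish (𝕜 := ℝ) (A := monomialAlgebra V) ?_ ?_
  -- Since `boundedSpin` is injective, one-site monomials already separate points.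
  · intro φ ψ hne
    obtain ⟨x, hx⟩ := Function.ne_iff.1 hne
    refine ⟨monomialBCF {x}, ⟨BoundedContinuousFunction.toContinuousMapStarₐ ℝ (monomialBCF {x}),
      ⟨monomialBCF {x}, Submodule.subset_span ⟨_, rfl⟩, rfl⟩, rfl⟩, ?_⟩
    simpa [monomial_singleton] using fun h => hx (boundedSpin_strictMono.injective h)
  · intro f hf
    rw [mem_monomialAlgebra] at hf
    induction hf using Submodule.span_induction with
    | mem f hf =>
      obtain ⟨A, rfl⟩ := hf
      exact h A
    | zero => simp
    | add f g _ _ hf hg =>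
      simp only [BoundedContinuousFunction.coe_add, Pi.add_apply]
      rw [integral_add (f.integrable μ) (g.integrable μ),
        integral_add (f.integrable ν) (g.integrable ν), hf, hg]
    | smul r f _ hf =>
      simp only [BoundedContinuousFunction.coe_smul, integral_smul, hf]

lemma WeakLimit.unique [Countable V] {ι : Type*} {ν : ι → Measure (V → ℝ)} {l : Filter ι} [NeBot l]
    {μ μ' : Measure (V → ℝ)} (h : WeakLimit ν l μ) (h' : WeakLimit ν l μ') : μ = μ' := by
  have := h.1
  have := h'.1
  exact ext_of_integral_monomial fun A =>
    tendsto_nhds_unique (h.2 (monomialBCF A)) (h'.2 (monomialBCF A))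

/-- Truncated second moments are at most `M`. -/
def HasMomentBound (M : ℝ) (μ : Measure (V → ℝ)) : Prop :=
  ∀ K : ℝ, 0 ≤ K → ∀ x : V, ∫ φ, min (φ x ^ 2) K ∂μ ≤ M

lemma HasMomentBound.measureReal_le {M : ℝ} {μ : Measure (V → ℝ)} [IsFiniteMeasure μ]
    (h : HasMomentBound M μ) (x : V) {k : ℝ} (hk : 0 < k) :
    μ.real {φ | k < |φ x|} ≤ M / k ^ 2 := by
  have hint : Integrable (fun φ : V → ℝ => min (φ x ^ 2) (k ^ 2)) μ := by
    refine Integrable.of_bound (C := k ^ 2) (Measurable.aestronglyMeasurable (by fun_prop))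
      (ae_of_all _ fun φ => ?_)
    rw [Real.norm_eq_abs, abs_of_nonneg (le_min (by positivity) (by positivity))]
    exact min_le_right _ _
  have h1 := mul_meas_ge_le_integral_of_nonneg
    (ae_of_all μ fun φ : V → ℝ => (le_min (by positivity) (by positivity) :
      0 ≤ min (φ x ^ 2) (k ^ 2))) hint (k ^ 2)
  rw [le_div_iff₀ (by positivity), mul_comm]
  refine le_trans (mul_le_mul_of_nonneg_left (measureReal_mono fun φ hφ => ?_) (by positivity))
    (h1.trans (h (k ^ 2) (by positivity) x))
  have h2 : k ^ 2 ≤ φ x ^ 2 := by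
    rw [← sq_abs (φ x)]
    exact pow_le_pow_left₀ hk.le (le_of_lt hφ) 2
  exact le_min h2 le_rfl

/-- The compact set is a product of intervals. The radius at `x` is chosen so that Chebyshev's
inequality gives exit probability at most `δ x`, with `δ` of total mass below `ε`; such a `δ` exists
as `V` is countable. -/
lemma isTightMeasureSet_of_moment [Countable V] (M : ℝ) :
    IsTightMeasureSet {μ : Measure (V → ℝ) | IsProbabilityMeasure μ ∧ HasMomentBound M μ} := by
  rw [isTightMeasureSet_iff_exists_isCompact_measure_compl_le]
  intro ε hε
  obtain ⟨δ, hδ, hsum⟩ := ENNReal.exists_pos_sum_of_countable hε.ne' V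
  set k : V → ℝ := fun x => Real.sqrt (|M| / δ x) + 1 with hk
  have hkpos : ∀ x, 0 < k x := fun x => by positivity
  refine ⟨Set.univ.pi fun x => Set.Icc (-k x) (k x), isCompact_univ_pi fun x => isCompact_Icc,
    fun μ hμ => ?_⟩
  have := hμ.1
  have hcompl : (Set.univ.pi fun x => Set.Icc (-k x) (k x))ᶜ ⊆ ⋃ x, {φ : V → ℝ | k x < |φ x|} := by
    intro φ hφ
    simp only [Set.mem_compl_iff, Set.mem_pi, Set.mem_univ, true_imp_iff, not_forall] at hφ
    obtain ⟨x, hx⟩ := hφ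
    refine Set.mem_iUnion.2 ⟨x, ?_⟩
    rw [Set.mem_Icc, ← abs_le, not_le] at hx
    exact hx
  refine (measure_mono hcompl).trans ((measure_iUnion_le _).trans
    (le_trans (ENNReal.tsum_le_tsum fun x => ?_) hsum.le))
  have hδ' : (0 : ℝ) < δ x := hδ x
  have h1 : μ.real {φ : V → ℝ | k x < |φ x|} ≤ δ x := by
    refine (hμ.2.measureReal_le x (hkpos x)).trans ?_
    rw [div_le_iff₀ (by have := hkpos x; positivity)]
    have h2 : |M| / δ x ≤ k x ^ 2 := by
      have h3 := Real.sq_sqrt (show 0 ≤ |M| / δ x by positivity)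
      have h4 := Real.sqrt_nonneg (|M| / δ x)
      simp only [hk]
      nlinarith
    rw [div_le_iff₀ hδ'] at h2
    linarith [le_abs_self M]
  rw [← ENNReal.ofReal_coe_nnreal, ← ofReal_measureReal]
  exact ENNReal.ofReal_le_ofReal h1

/-- Prokhorov's theorem gives a cluster point. Every cluster point has the limiting monomial
integrals, which determine it, so the family converges. -/
lemma exists_weakLimit [Countable V] {ι : Type*} {ν : ι → Measure (V → ℝ)} {l : Filter ι} [NeBot l]
    {M : ℝ} (hν : ∀ᶠ i in l, IsProbabilityMeasure (ν i) ∧ HasMomentBound M (ν i))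
    (hlim : ∀ A : Multiset V, ∃ a, Tendsto (fun i => ∫ φ, monomial A φ ∂(ν i)) l (𝓝 a)) :
    ∃ μ, WeakLimit ν l μ := by
  classical
  choose a ha using hlim
  set p : ι → ProbabilityMeasure (V → ℝ) := fun i =>
    if h : IsProbabilityMeasure (ν i) then ⟨ν i, h⟩ else ⟨Measure.dirac 0, inferInstance⟩
  have hpν : ∀ᶠ i in l, (p i : Measure (V → ℝ)) = ν i := by
    filter_upwards [hν] with i hi
    have : p i = ⟨ν i, hi.1⟩ := dif_pos hi.1
    rw [this]
    rfl
  set S : Set (ProbabilityMeasure (V → ℝ)) := {q | HasMomentBound M (q : Measure (V → ℝ))} with hS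
  have hcomp : IsCompact (closure S) := by
    refine isCompact_closure_of_isTightMeasureSet ((isTightMeasureSet_of_moment M).subset ?_)
    rintro _ ⟨q, hq, rfl⟩
    exact ⟨inferInstance, hq⟩
  have hmem : ∀ᶠ i in l, p i ∈ closure S := by
    filter_upwards [hν, hpν] with i hi hpi
    refine subset_closure ?_
    change HasMomentBound M (p i : Measure (V → ℝ))
    rw [hpi]
    exact hi.2
  have hcluster : ∀ q, MapClusterPt q l p →
      ∀ A, ∫ φ, monomial A φ ∂(q : Measure (V → ℝ)) = a A := by
    intro q hq A
    obtain ⟨U, hU, hUq⟩ := mapClusterPt_iff_ultrafilter.1 hq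
    have h1 := (ProbabilityMeasure.tendsto_iff_forall_integral_tendsto.1 hUq) (monomialBCF A)
    refine tendsto_nhds_unique h1 (((ha A).mono_left hU).congr' ?_)
    filter_upwards [hU hpν] with i hi
    simp only [hi, monomialBCF_apply]
  obtain ⟨q, -, hq⟩ := hcomp.exists_mapClusterPt (f := l) (u := p)
    (le_principal_iff.2 hmem)
  have htend : Tendsto p l (𝓝 q) := by
    refine hcomp.tendsto_nhds_of_unique_mapClusterPt hmem fun q' _ hq' => ?_
    have h : (q' : Measure (V → ℝ)) = q := ext_of_integral_monomial fun A =>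
      (hcluster q' hq' A).trans (hcluster q hq A).symm
    exact Subtype.ext h
  refine ⟨q, inferInstance, fun F => ?_⟩
  refine ((ProbabilityMeasure.tendsto_iff_forall_integral_tendsto.1 htend) F).congr' ?_
  filter_upwards [hpν] with i hi
  rw [hi]

/-- Truncated squares of spins as bounded continuous functions. -/
def minSqBCF (x : V) {K : ℝ} (hK : 0 ≤ K) : (V → ℝ) →ᵇ ℝ :=
  BoundedContinuousFunction.ofNormedAddCommGroup (fun φ => min (φ x ^ 2) K) (by fun_prop) K
    fun φ => by
      rw [Real.norm_eq_abs, abs_of_nonneg (le_min (sq_nonneg _) hK)]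
      exact min_le_right _ _

lemma WeakLimit.hasMomentBound {ι : Type*} {ν : ι → Measure (V → ℝ)} {l : Filter ι} [NeBot l]
    {μ : Measure (V → ℝ)} (h : WeakLimit ν l μ) {M : ℝ} (hν : ∀ᶠ i in l, HasMomentBound M (ν i)) :
    HasMomentBound M μ := fun K hK x =>
  le_of_tendsto (h.2 (minSqBCF x hK)) (hν.mono fun _ hi => hi K hK x)

/-! ### Existence of the free and plus measures. -/

/-- The finite-volume Gibbs measure on `ℝ^V` in which spins outside `Λ` do not interact. -/
abbrev volumeGibbs (J : V → V → ℝ) (g a β h : ℝ) (Λ : Finset V) : Measure (V → ℝ) :=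
  gibbs (singleSite g a) (energy J β h Λ)

/-- For each nonnegative field, truncated second moments are bounded uniformly in the volume. -/
def HasUniformMoments (J : V → V → ℝ) (g a β : ℝ) : Prop :=
  ∀ h : ℝ, 0 ≤ h → ∃ M : ℝ, ∀ Λ : Finset V, HasMomentBound M (volumeGibbs J g a β h Λ)

section

variable {J : V → V → ℝ} {g a β : ℝ}

lemma isProbabilityMeasure_freeMeasureOn (hg : 0 < g) (h : ℝ) (Λ : Finset V) :
    IsProbabilityMeasure (freeMeasureOn J g a β h Λ) := by
  have := isProbabilityMeasure_gibbs (isSiteMeasure_singleSite a hg) (isQuadratic_energy J β h Λ)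
  rw [freeMeasureOn_eq J hg]
  exact Measure.isProbabilityMeasure_map (measurable_cutoff Λ).aemeasurable

lemma integral_monomial_freeMeasureOn (hg : 0 < g) (h : ℝ) {Λ : Finset V} {A : Multiset V}
    (hA : ∀ x ∈ A, x ∈ Λ) :
    ∫ φ, monomial A φ ∂(freeMeasureOn J g a β h Λ) =
      ∫ φ, monomial A φ ∂(volumeGibbs J g a β h Λ) := by
  rw [freeMeasureOn_eq J hg, integral_map (measurable_cutoff Λ).aemeasurable
    (monomial_mem_griffithsCone A |> tame_of_mem_griffithsCone).1.aestronglyMeasurable]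
  refine integral_congr_ae (ae_of_all _ fun φ => monomial_congr fun x hx => ?_)
  simp [cutoff, hA x hx]

lemma integrable_min_sq {μ : Measure (V → ℝ)} [IsFiniteMeasure μ] {T : (V → ℝ) → V → ℝ}
    (hT : Measurable T) (x : V) {K : ℝ} (hK : 0 ≤ K) :
    Integrable (fun φ : V → ℝ => min (T φ x ^ 2) K) μ := by
  refine Integrable.of_bound (C := K) (Measurable.aestronglyMeasurable (by fun_prop))
    (ae_of_all _ fun φ => ?_)
  rw [Real.norm_eq_abs, abs_of_nonneg (le_min (by positivity) hK)]
  exact min_le_right _ _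

lemma hasMomentBound_freeMeasureOn (hg : 0 < g) {h M : ℝ} {Λ : Finset V}
    (hM : HasMomentBound M (volumeGibbs J g a β h Λ)) :
    HasMomentBound M (freeMeasureOn J g a β h Λ) := fun K hK x => by
  have := isProbabilityMeasure_gibbs (isSiteMeasure_singleSite a hg) (isQuadratic_energy J β h Λ)
  refine le_trans ?_ (hM K hK x)
  rw [freeMeasureOn_eq J hg, integral_map (measurable_cutoff Λ).aemeasurable
    (Measurable.aestronglyMeasurable (by fun_prop))]
  refine integral_mono (integrable_min_sq (measurable_cutoff Λ) x hK)
    (integrable_min_sq measurable_id x hK) fun φ => min_le_min_right _ ?_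
  by_cases hx : x ∈ Λ
  · simp [cutoff, hx]
  · simpa [cutoff, hx] using sq_nonneg (φ x)

lemma eventually_mem_finset (A : Multiset V) : ∀ᶠ Λ : Finset V in atTop, ∀ x ∈ A, x ∈ Λ := by
  classical
  filter_upwards [eventually_ge_atTop A.toFinset] with Λ hΛ x hx
  exact hΛ (Multiset.mem_toFinset.2 hx)

lemma IsFreeMeasure.tendsto_monomial (hg : 0 < g) {h : ℝ} {μ : Measure (V → ℝ)}
    (hμ : IsFreeMeasure J g a β h μ) (A : Multiset V) :
    Tendsto (fun Λ : Finset V => ∫ φ, monomial A φ ∂(volumeGibbs J g a β h Λ)) atTop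
      (𝓝 (∫ φ, monomial A φ ∂μ)) := by
  refine (hμ.2 (monomialBCF A)).congr' ?_
  filter_upwards [eventually_mem_finset A] with Λ hΛ
  exact integral_monomial_freeMeasureOn hg h hΛ

lemma monotone_volumeGibbs (hg : 0 < g) (hJ : ∀ x y, 0 ≤ J x y) (hβ : 0 ≤ β) {h : ℝ} (h0 : 0 ≤ h)
    {F : (V → ℝ) → ℝ} (hF : F ∈ griffithsCone V) :
    Monotone fun Λ : Finset V => ∫ φ, F φ ∂(volumeGibbs J g a β h Λ) := by
  intro Λ Λ' hΛ
  rcases isEmpty_or_nonempty V with hV | hV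
  · rw [Subsingleton.elim Λ Λ']
  · exact gibbs_energy_mono (isSiteMeasure_singleSite a hg) hF hJ hβ h0 le_rfl hΛ

/-- Monomial expectations increase with the volume and are at most `1`, hence converge; the moments
give tightness. -/
lemma exists_isFreeMeasure [Countable V] (hg : 0 < g) (hJ : ∀ x y, 0 ≤ J x y) (hβ : 0 ≤ β)
    (hM : HasUniformMoments J g a β) {h : ℝ} (h0 : 0 ≤ h) :
    ∃ μ, IsFreeMeasure J g a β h μ := by
  obtain ⟨M, hM⟩ := hM h h0
  refine exists_weakLimit (M := M) (Eventually.of_forall fun Λ =>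
    ⟨isProbabilityMeasure_freeMeasureOn hg h Λ, hasMomentBound_freeMeasureOn hg (hM Λ)⟩) fun A => ?_
  refine ⟨_, (tendsto_atTop_ciSup
    (monotone_volumeGibbs (g := g) (a := a) hg hJ hβ h0 (monomial_mem_griffithsCone A))
      ⟨1, ?_⟩).congr' ?_⟩
  · rintro _ ⟨Λ, rfl⟩
    have := isProbabilityMeasure_gibbs (isSiteMeasure_singleSite a hg)
      (isQuadratic_energy J β h Λ)
    refine (integral_mono (g := fun _ => 1) (integrable_monomial A _) (integrable_const 1)
      fun φ => (le_abs_self _).trans (abs_monomial_le_one A φ)).trans (by simp)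
  · filter_upwards [eventually_mem_finset A] with Λ hΛ
    exact (integral_monomial_freeMeasureOn hg h hΛ).symm

lemma IsFreeMeasure.volumeGibbs_le (hg : 0 < g) (hJ : ∀ x y, 0 ≤ J x y) (hβ : 0 ≤ β) {h : ℝ}
    (h0 : 0 ≤ h) {μ : Measure (V → ℝ)} (hμ : IsFreeMeasure J g a β h μ) (A : Multiset V)
    (Λ : Finset V) : ∫ φ, monomial A φ ∂(volumeGibbs J g a β h Λ) ≤ ∫ φ, monomial A φ ∂μ :=
  (monotone_volumeGibbs hg hJ hβ h0 (monomial_mem_griffithsCone A)).ge_of_tendsto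
    (hμ.tendsto_monomial hg A) Λ

lemma IsFreeMeasure.mono [Nonempty V] (hg : 0 < g) (hJ : ∀ x y, 0 ≤ J x y) (hβ : 0 ≤ β) {h h' : ℝ}
    (h0 : 0 ≤ h) (hh : h ≤ h') {μ μ' : Measure (V → ℝ)} (hμ : IsFreeMeasure J g a β h μ)
    (hμ' : IsFreeMeasure J g a β h' μ') (A : Multiset V) :
    ∫ φ, monomial A φ ∂μ ≤ ∫ φ, monomial A φ ∂μ' :=
  le_of_tendsto_of_tendsto' (hμ.tendsto_monomial hg A) (hμ'.tendsto_monomial hg A) fun _ =>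
    gibbs_energy_mono (isSiteMeasure_singleSite a hg) (monomial_mem_griffithsCone A) hJ hβ h0 hh
      subset_rfl

/-- Comparison with the larger field `h'` makes the bound uniform in `h ≤ h'`, as tightness along `h
↓ 0` requires. -/
lemma IsFreeMeasure.hasMomentBound [Nonempty V] (hg : 0 < g) (hJ : ∀ x y, 0 ≤ J x y) (hβ : 0 ≤ β)
    {h h' M : ℝ} (h0 : 0 ≤ h) (hh : h ≤ h') {μ : Measure (V → ℝ)}
    (hμ : IsFreeMeasure J g a β h μ)
    (hM : ∀ Λ : Finset V, HasMomentBound M (volumeGibbs J g a β h' Λ)) : HasMomentBound M μ := by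
  refine WeakLimit.hasMomentBound hμ (Eventually.of_forall fun Λ =>
    hasMomentBound_freeMeasureOn hg fun K hK x => le_trans ?_ (hM Λ K hK x))
  exact gibbs_energy_mono (isSiteMeasure_singleSite a hg)
    (mem_griffithsCone x (isGriffiths_min_sq hK)) hJ hβ h0 hh subset_rfl

/-- As `h ↓ 0` monomial expectations decrease and stay nonnegative by Griffiths' first inequality;
tightness comes from comparison with `h = 1`. -/
lemma exists_isPlusMeasure [Countable V] [Nonempty V] (hg : 0 < g) (hJ : ∀ x y, 0 ≤ J x y)
    (hβ : 0 ≤ β) (hM : HasUniformMoments J g a β) : ∃ μ, IsPlusMeasure J g a β μ := by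
  choose! ν hν using fun h (h0 : 0 < h) => exists_isFreeMeasure hg hJ hβ hM (le_of_lt h0)
  obtain ⟨M, hM1⟩ := hM 1 zero_le_one
  suffices ∃ μ, WeakLimit ν (𝓝[>] 0) μ from ⟨this.choose, ν, hν, this.choose_spec⟩
  refine exists_weakLimit (M := M) ?_ fun A => ?_
  · filter_upwards [Ioo_mem_nhdsGT zero_lt_one] with h hh
    exact ⟨(hν h hh.1).1, (hν h hh.1).hasMomentBound hg hJ hβ hh.1.le hh.2.le hM1⟩
  · refine ⟨_, MonotoneOn.tendsto_nhdsGT (fun h h0 h' h0' hh =>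
      (hν h h0).mono hg hJ hβ (le_of_lt h0) hh (hν h' h0') A) ⟨0, ?_⟩⟩
    rintro _ ⟨h, h0, rfl⟩
    refine ge_of_tendsto' ((hν h h0).tendsto_monomial hg A) fun Λ => ?_
    exact gibbs_nonneg (isSiteMeasure_singleSite a hg) (monomial_mem_griffithsCone A)
      (energy_mem_griffithsCone Λ hJ hβ (le_of_lt h0)) (isQuadratic_energy J β h Λ)

/-- Two admissible families agree for `h > 0` by uniqueness of weak limits; their values at `h ≤ 0`
do not affect the limit. -/
lemma IsPlusMeasure.unique [Countable V] {μ μ' : Measure (V → ℝ)} (h : IsPlusMeasure J g a β μ)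
    (h' : IsPlusMeasure J g a β μ') : μ = μ' := by
  obtain ⟨ν, hν, hμ⟩ := h
  obtain ⟨ν', hν', hμ'⟩ := h'
  refine hμ.unique ⟨hμ'.1, fun F => (hμ'.2 F).congr' ?_⟩
  filter_upwards [self_mem_nhdsWithin] with h h0
  rw [WeakLimit.unique (hν h h0) (hν' h h0)]

/-- The plus measure is a decreasing limit of free measures along monomials. -/
lemma le_of_weakLimit_plus [Nonempty V] (hg : 0 < g) (hJ : ∀ x y, 0 ≤ J x y) (hβ : 0 ≤ β)
    {ν : ℝ → Measure (V → ℝ)} (hν : ∀ h : ℝ, 0 < h → IsFreeMeasure J g a β h (ν h))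
    {μ : Measure (V → ℝ)} (hμ : WeakLimit ν (𝓝[>] 0) μ) (A : Multiset V) {h : ℝ} (h0 : 0 < h) :
    ∫ φ, monomial A φ ∂μ ≤ ∫ φ, monomial A φ ∂(ν h) := by
  refine le_of_tendsto (hμ.2 (monomialBCF A)) ?_
  filter_upwards [Ioo_mem_nhdsGT h0] with h' hh
  exact (hν h' hh.1).mono hg hJ hβ hh.1.le hh.2.le (hν h h0) A

end

/-! ### Invariance of the limits under symmetries of the couplings. -/

section Invariance

variable {J : V → V → ℝ} {g a β : ℝ}

lemma tendsto_map_equiv_atTop (e : V ≃ V) :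
    Tendsto (fun Λ : Finset V => Λ.map e.toEmbedding) atTop atTop := by
  refine tendsto_atTop.2 fun Λ₀ => ?_
  filter_upwards [eventually_ge_atTop (Λ₀.map e.symm.toEmbedding)] with Λ hΛ
  intro x hx
  refine Finset.mem_map.2 ⟨e.symm x, hΛ (Finset.mem_map_of_mem _ hx), by simp⟩

/-- The relabelled volumes also exhaust `V`, so both sides are limits of the same finite-volume
expectations. -/
lemma IsFreeMeasure.integral_monomial_map (hg : 0 < g) {h : ℝ} {μ : Measure (V → ℝ)}
    (hμ : IsFreeMeasure J g a β h μ) (e : V ≃ V) (he : ∀ x y, J (e x) (e y) = J x y)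
    (A : Multiset V) : ∫ φ, monomial (A.map e) φ ∂μ = ∫ φ, monomial A φ ∂μ := by
  refine tendsto_nhds_unique
    ((hμ.tendsto_monomial hg (A.map e)).comp (tendsto_map_equiv_atTop e))
    ((hμ.tendsto_monomial hg A).congr fun Λ => ?_)
  rw [Function.comp_apply, volumeGibbs, volumeGibbs,
    ← gibbs_map_equiv (isSiteMeasure_singleSite a hg) β h Λ e he, integral_map
      (measurable_pi_lambda _ fun x => measurable_pi_apply _).aemeasurable
      (tame_of_mem_griffithsCone (monomial_mem_griffithsCone A)).1.aestronglyMeasurable]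
  simp only [monomial_map]

lemma IsPlusMeasure.map_equiv [Countable V] (hg : 0 < g) {μ : Measure (V → ℝ)}
    (hμ : IsPlusMeasure J g a β μ) (e : V ≃ V) (he : ∀ x y, J (e x) (e y) = J x y) :
    μ.map (fun φ x => φ (e x)) = μ := by
  obtain ⟨ν, hν, hμ⟩ := hμ
  have := hμ.1
  have hT : Measurable fun (φ : V → ℝ) x => φ (e x) :=
    measurable_pi_lambda _ fun x => measurable_pi_apply _
  have := Measure.isProbabilityMeasure_map hT.aemeasurable (μ := μ)
  refine ext_of_integral_monomial fun A => ?_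
  rw [integral_map hT.aemeasurable
    (tame_of_mem_griffithsCone (monomial_mem_griffithsCone A)).1.aestronglyMeasurable]
  simp only [← monomial_map]
  refine tendsto_nhds_unique (hμ.2 (monomialBCF (A.map e)))
    ((hμ.2 (monomialBCF A)).congr' ?_)
  filter_upwards [self_mem_nhdsWithin] with h h0
  exact ((hν h h0).integral_monomial_map hg e he A).symm

end Invariance

/-! ### Discretization of spins. -/

section Discretization

/-- The index of the cell of mesh `1 / (n + 1)` containing `t`, truncated. -/
def cellIndex (n : ℕ) (t : ℝ) : Set.Icc (-((n : ℤ) + 1) ^ 2) (((n : ℤ) + 1) ^ 2) :=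
  Set.projIcc _ _ (by nlinarith) ⌊t * (n + 1)⌋

/-- The point representing a cell. -/
def cellPoint (n : ℕ) (k : Set.Icc (-((n : ℤ) + 1) ^ 2) (((n : ℤ) + 1) ^ 2)) : ℝ :=
  (k : ℤ) / ((n : ℝ) + 1)

lemma cellPoint_mono (n : ℕ) : Monotone (cellPoint n) := fun k l h => by
  unfold cellPoint
  have : ((k : ℤ) : ℝ) ≤ ((l : ℤ) : ℝ) := by exact_mod_cast h
  gcongr

lemma measurable_cellIndex (n : ℕ) : Measurable (cellIndex n) := by
  have h1 : Measurable fun t : ℝ => ⌊t * ((n : ℝ) + 1)⌋ :=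
    Int.measurable_floor.comp (measurable_id.mul_const _)
  exact (measurable_from_top (f := Set.projIcc (-((n : ℤ) + 1) ^ 2) (((n : ℤ) + 1) ^ 2)
    (by nlinarith))).comp h1

/-- Discretization of a spin. -/
def discretize (n : ℕ) (t : ℝ) : ℝ := cellPoint n (cellIndex n t)

lemma discretize_eq (n : ℕ) (t : ℝ) : discretize n t =
    ((max (-((n : ℤ) + 1) ^ 2) (min (((n : ℤ) + 1) ^ 2) ⌊t * (n + 1)⌋) : ℤ) : ℝ) / (n + 1) := by
  simp [discretize, cellPoint, cellIndex, Set.coe_projIcc]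

lemma measurable_discretize (n : ℕ) : Measurable (discretize n) :=
  (Measurable.of_discrete (f := cellPoint n)).comp (measurable_cellIndex n)

lemma abs_discretize_le (n : ℕ) (t : ℝ) : |discretize n t| ≤ |t| + 1 := by
  have hn : (0 : ℝ) < n + 1 := by positivity
  rw [discretize_eq, abs_div, abs_of_pos hn, div_le_iff₀ hn]
  have h1 : |max (-((n : ℤ) + 1) ^ 2) (min (((n : ℤ) + 1) ^ 2) ⌊t * (n + 1)⌋)| ≤
      |⌊t * ((n : ℝ) + 1)⌋| := by
    have hM := sq_nonneg ((n : ℤ) + 1)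
    generalize ((n : ℤ) + 1) ^ 2 = M at *
    grind
  have h2 : |((⌊t * ((n : ℝ) + 1)⌋ : ℤ) : ℝ)| ≤ |t| * (n + 1) + 1 := by
    have h3 := Int.floor_le (t * ((n : ℝ) + 1))
    have h4 := Int.lt_floor_add_one (t * ((n : ℝ) + 1))
    have h5 : |t * ((n : ℝ) + 1)| = |t| * (n + 1) := by rw [abs_mul, abs_of_pos hn]
    rw [← h5]
    rw [abs_le]
    constructor
    · linarith [neg_abs_le (t * ((n : ℝ) + 1))]
    · linarith [le_abs_self (t * ((n : ℝ) + 1))]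
  have h1' : |((max (-((n : ℤ) + 1) ^ 2) (min (((n : ℤ) + 1) ^ 2) ⌊t * (n + 1)⌋) : ℤ) : ℝ)| ≤
      |((⌊t * ((n : ℝ) + 1)⌋ : ℤ) : ℝ)| := by exact_mod_cast h1
  refine h1'.trans (h2.trans ?_)
  nlinarith

lemma tendsto_discretize (t : ℝ) : Tendsto (fun n => discretize n t) atTop (𝓝 t) := by
  have hlim : Tendsto (fun n : ℕ => t - 1 / ((n : ℝ) + 1)) atTop (𝓝 t) := by
    simpa using tendsto_one_div_add_atTop_nhds_zero_nat.const_sub t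
  refine tendsto_of_tendsto_of_tendsto_of_le_of_le' hlim tendsto_const_nhds ?_ ?_
  all_goals
    filter_upwards [eventually_ge_atTop ⌈|t| + 1⌉₊] with n hn
    have hn' : |t| + 1 ≤ n := (Nat.le_ceil _).trans (by exact_mod_cast hn)
    have hn0 : (0 : ℝ) < n + 1 := by positivity
    have h3 := Int.floor_le (t * ((n : ℝ) + 1))
    have h4 := Int.lt_floor_add_one (t * ((n : ℝ) + 1))
    have h5 : ⌊t * ((n : ℝ) + 1)⌋ ≤ ((n : ℤ) + 1) ^ 2 := by
      have : ((⌊t * ((n : ℝ) + 1)⌋ : ℤ) : ℝ) ≤ ((n : ℝ) + 1) ^ 2 := by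
        nlinarith [le_abs_self t]
      exact_mod_cast this
    have h6 : -((n : ℤ) + 1) ^ 2 ≤ ⌊t * ((n : ℝ) + 1)⌋ := by
      have : -((n : ℝ) + 1) ^ 2 ≤ ((⌊t * ((n : ℝ) + 1)⌋ : ℤ) : ℝ) := by
        nlinarith [neg_abs_le t]
      exact_mod_cast this
    rw [discretize_eq, min_eq_right h5, max_eq_right h6]
  · rw [sub_le_iff_le_add, ← add_div, le_div_iff₀ hn0]
    exact h4.le
  · rw [div_le_iff₀ hn0]
    exact h3

variable {ρ : Measure ℝ}

lemma tendsto_integral_discretize (hρ : IsSiteMeasure ρ) {W : (V → ℝ) → ℝ} (hW : IsTame W)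
    (hc : Continuous W) :
    Tendsto (fun n => ∫ φ, W (fun x => discretize n (φ x)) ∂(Measure.infinitePi fun _ : V => ρ))
      atTop (𝓝 (∫ φ, W φ ∂(Measure.infinitePi fun _ : V => ρ))) := by
  have := hρ.isProb
  obtain ⟨hm, A, C, c, hC, hc0, h⟩ := hW
  have hT : IsTame fun φ : V → ℝ => C * Real.exp (c * ∑ x ∈ A, (2 * φ x ^ 2 + 2)) := by
    refine ⟨by fun_prop, A, C * Real.exp (c * (2 * A.card)), c * 2, by positivity, by positivity,
      fun φ => ?_⟩
    have e : c * ∑ x ∈ A, (2 * φ x ^ 2 + 2) = c * (2 * A.card) + c * 2 * ∑ x ∈ A, φ x ^ 2 := by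
      rw [Finset.sum_add_distrib, ← Finset.mul_sum, Finset.sum_const, nsmul_eq_mul]
      ring
    rw [abs_of_nonneg (by positivity), mul_assoc, ← Real.exp_add]
    change C * Real.exp (c * ∑ x ∈ A, (2 * φ x ^ 2 + 2)) ≤
      C * Real.exp (c * (2 * A.card) + c * 2 * ∑ x ∈ A, φ x ^ 2)
    rw [e]
  refine tendsto_integral_of_dominated_convergence _ (fun n => ?_) (IsTame.integrable hρ hT)
    (fun n => ae_of_all _ fun φ => ?_) (ae_of_all _ fun φ => ?_)
  · have := measurable_discretize n
    exact Measurable.aestronglyMeasurable (by fun_prop)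
  · refine (h _).trans (mul_le_mul_of_nonneg_left (Real.exp_le_exp.2
      (mul_le_mul_of_nonneg_left (Finset.sum_le_sum fun x _ => ?_) hc0)) hC)
    have h1 := abs_discretize_le n (φ x)
    have h2 : discretize n (φ x) ^ 2 ≤ (|φ x| + 1) ^ 2 := by
      rw [← sq_abs (discretize n (φ x))]
      exact pow_le_pow_left₀ (abs_nonneg _) h1 2
    nlinarith [sq_nonneg (|φ x| - 1), sq_abs (φ x)]
  · exact (hc.tendsto _).comp (tendsto_pi_nhds.2 fun x => tendsto_discretize (φ x))

end Discretization

/-! ### The FKG inequality and covariances of monomials. -/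

section FKG

variable {ρ : Measure ℝ}

/-- The configuration with the cells `ψ` on `A`, and zero elsewhere. -/
def cellConfig (n : ℕ) (A : Finset V)
    (ψ : A → Set.Icc (-((n : ℤ) + 1) ^ 2) (((n : ℤ) + 1) ^ 2)) : V → ℝ :=
  Function.extend (Subtype.val : A → V) (fun x => cellPoint n (ψ x)) 0

lemma cellConfig_apply (n : ℕ) (A : Finset V)
    (ψ : A → Set.Icc (-((n : ℤ) + 1) ^ 2) (((n : ℤ) + 1) ^ 2)) (x : A) :
    cellConfig n A ψ x = cellPoint n (ψ x) :=
  Subtype.val_injective.extend_apply _ _ x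

lemma cellConfig_apply_of_notMem (n : ℕ) (A : Finset V)
    (ψ : A → Set.Icc (-((n : ℤ) + 1) ^ 2) (((n : ℤ) + 1) ^ 2)) {x : V} (hx : x ∉ A) :
    cellConfig n A ψ x = 0 :=
  Function.extend_apply' _ _ _ (by simpa using hx)

lemma cellConfig_mono (n : ℕ) (A : Finset V) : Monotone (cellConfig n A) := fun ψ ψ' h x => by
  by_cases hx : x ∈ A
  · rw [cellConfig_apply n A ψ ⟨x, hx⟩, cellConfig_apply n A ψ' ⟨x, hx⟩]
    exact cellPoint_mono n (h ⟨x, hx⟩)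
  · rw [cellConfig_apply_of_notMem n A ψ hx, cellConfig_apply_of_notMem n A ψ' hx]

lemma cellConfig_inf (n : ℕ) (A : Finset V)
    (ψ ψ' : A → Set.Icc (-((n : ℤ) + 1) ^ 2) (((n : ℤ) + 1) ^ 2)) :
    cellConfig n A (ψ ⊓ ψ') = cellConfig n A ψ ⊓ cellConfig n A ψ' := by
  ext x
  by_cases hx : x ∈ A
  · rw [Pi.inf_apply, cellConfig_apply n A ψ ⟨x, hx⟩, cellConfig_apply n A ψ' ⟨x, hx⟩,
      cellConfig_apply n A _ ⟨x, hx⟩]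
    exact (cellPoint_mono n).map_inf _ _
  · rw [Pi.inf_apply, cellConfig_apply_of_notMem n A ψ hx, cellConfig_apply_of_notMem n A ψ' hx,
      cellConfig_apply_of_notMem n A _ hx, inf_idem]

lemma cellConfig_sup (n : ℕ) (A : Finset V)
    (ψ ψ' : A → Set.Icc (-((n : ℤ) + 1) ^ 2) (((n : ℤ) + 1) ^ 2)) :
    cellConfig n A (ψ ⊔ ψ') = cellConfig n A ψ ⊔ cellConfig n A ψ' := by
  ext x
  by_cases hx : x ∈ A
  · rw [Pi.sup_apply, cellConfig_apply n A ψ ⟨x, hx⟩, cellConfig_apply n A ψ' ⟨x, hx⟩,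
      cellConfig_apply n A _ ⟨x, hx⟩]
    exact (cellPoint_mono n).map_sup _ _
  · rw [Pi.sup_apply, cellConfig_apply_of_notMem n A ψ hx, cellConfig_apply_of_notMem n A ψ' hx,
      cellConfig_apply_of_notMem n A _ hx, sup_idem]

/-- The integral becomes a sum over a finite distributive lattice, the setting of the combinatorial
inequality `fkg`. -/
lemma integral_discretize [DecidableEq V] [IsProbabilityMeasure ρ] (n : ℕ) (A : Finset V) {W : (V → ℝ) → ℝ}
    (hW : DependsOn W (A : Set V)) :
    ∫ φ, W (fun x => discretize n (φ x)) ∂(Measure.infinitePi fun _ : V => ρ) =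
      ∑ ψ : A → Set.Icc (-((n : ℤ) + 1) ^ 2) (((n : ℤ) + 1) ^ 2),
        (∏ x, (ρ.map (cellIndex n)).real {ψ x}) * W (cellConfig n A ψ) := by
  have hm := measurable_cellIndex n
  have := Measure.isProbabilityMeasure_map hm.aemeasurable (μ := ρ)
  have hκ : Measurable fun (φ : V → ℝ) x => cellIndex n (φ x) := by fun_prop
  have hmap := Measure.infinitePi_map_restrict (fun _ : V => ρ.map (cellIndex n)) (I := A)
  rw [← Measure.infinitePi_map_pi (fun _ : V => ρ) fun _ => hm,
    Measure.map_map (Finset.measurable_restrict A) hκ] at hmap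
  have h1 : ∀ φ : V → ℝ, W (fun x => discretize n (φ x)) =
      W (cellConfig n A ((A.restrict ∘ fun (φ : V → ℝ) x => cellIndex n (φ x)) φ)) := fun φ =>
    hW fun x hx => (cellConfig_apply n A (A.restrict fun x => cellIndex n (φ x)) ⟨x, hx⟩).symm
  simp only [h1]
  rw [← integral_map (f := fun ψ => W (cellConfig n A ψ))
    ((Finset.measurable_restrict A).comp hκ).aemeasurable
    (Measurable.of_discrete).aestronglyMeasurable, hmap, integral_fintype Integrable.of_finite]
  refine Finset.sum_congr rfl fun ψ _ => ?_
  rw [smul_eq_mul, measureReal_def, Measure.pi_singleton, ENNReal.toReal_prod]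
  rfl

/-- The discretized FKG inequality. -/
lemma fkg_discretize [IsProbabilityMeasure ρ] (n : ℕ) (A : Finset V) {H F G : (V → ℝ) → ℝ}
    (hH : DependsOn H (A : Set V)) (hF : DependsOn F (A : Set V)) (hG : DependsOn G (A : Set V))
    (hsup : ∀ φ ψ, H φ + H ψ ≤ H (φ ⊓ ψ) + H (φ ⊔ ψ)) (hFm : Monotone F) (hGm : Monotone G)
    (hF0 : 0 ≤ F) (hG0 : 0 ≤ G) :
    (∫ φ, (fun φ => F φ * Real.exp (H φ)) (fun x => discretize n (φ x))
        ∂(Measure.infinitePi fun _ : V => ρ)) *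
      ∫ φ, (fun φ => G φ * Real.exp (H φ)) (fun x => discretize n (φ x))
        ∂(Measure.infinitePi fun _ : V => ρ) ≤
    (∫ φ, (fun φ => Real.exp (H φ)) (fun x => discretize n (φ x))
        ∂(Measure.infinitePi fun _ : V => ρ)) *
      ∫ φ, (fun φ => F φ * G φ * Real.exp (H φ)) (fun x => discretize n (φ x))
        ∂(Measure.infinitePi fun _ : V => ρ) := by
  classical
  have hHe : DependsOn (fun φ => Real.exp (H φ)) (A : Set V) := fun φ ψ h => by
    simp only [hH h]
  have hFe : DependsOn (fun φ => F φ * Real.exp (H φ)) (A : Set V) := fun φ ψ h => by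
    simp only [hH h, hF h]
  have hGe : DependsOn (fun φ => G φ * Real.exp (H φ)) (A : Set V) := fun φ ψ h => by
    simp only [hH h, hG h]
  have hFGe : DependsOn (fun φ => F φ * G φ * Real.exp (H φ)) (A : Set V) := fun φ ψ h => by
    simp only [hH h, hF h, hG h]
  rw [integral_discretize n A hHe, integral_discretize n A hFe, integral_discretize n A hGe,
    integral_discretize n A hFGe]
  set w : (A → Set.Icc (-((n : ℤ) + 1) ^ 2) (((n : ℤ) + 1) ^ 2)) → ℝ := fun ψ =>
    (∏ x, (ρ.map (cellIndex n)).real {ψ x}) * Real.exp (H (cellConfig n A ψ)) with hw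
  have hlat : ∀ ψ ψ', w ψ * w ψ' ≤ w (ψ ⊓ ψ') * w (ψ ⊔ ψ') := by
    intro ψ ψ'
    simp only [hw]
    rw [mul_mul_mul_comm, mul_mul_mul_comm (∏ x, (ρ.map (cellIndex n)).real {(ψ ⊓ ψ') x}),
      ← Real.exp_add, ← Real.exp_add, ← Finset.prod_mul_distrib, ← Finset.prod_mul_distrib,
      cellConfig_inf, cellConfig_sup]
    -- Each coordinate is totally ordered, so meet and join only permute the two values: the product
    -- weight gives equality in the lattice condition.
    have he : ∀ x, (ρ.map (cellIndex n)).real {ψ x} * (ρ.map (cellIndex n)).real {ψ' x} =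
        (ρ.map (cellIndex n)).real {(ψ ⊓ ψ') x} * (ρ.map (cellIndex n)).real {(ψ ⊔ ψ') x} := by
      intro x
      rw [Pi.inf_apply, Pi.sup_apply]
      rcases le_total (ψ x) (ψ' x) with h | h
      · rw [inf_eq_left.2 h, sup_eq_right.2 h]
      · rw [inf_eq_right.2 h, sup_eq_left.2 h, mul_comm]
    rw [Finset.prod_congr rfl fun x _ => he x]
    exact mul_le_mul_of_nonneg_left (Real.exp_le_exp.2 (hsup _ _))
      (Finset.prod_nonneg fun x _ => by positivity)
  have h := fkg (μ := w) (f := fun ψ => F (cellConfig n A ψ)) (g := fun ψ => G (cellConfig n A ψ))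
    (fun ψ => by simp only [hw, Pi.zero_apply]; positivity) (fun ψ => hF0 _) (fun ψ => hG0 _)
    (hFm.comp (cellConfig_mono n A)) (hGm.comp (cellConfig_mono n A)) hlat
  refine le_of_eq_of_le ?_ (h.trans_eq ?_) <;> congr 1 <;>
    refine Finset.sum_congr rfl fun ψ _ => ?_ <;> first | rfl | (simp only [hw]; ring)

/-- The FKG inequality for Gibbs measures with continuous spins. -/
lemma gibbs_fkg (hρ : IsSiteMeasure ρ) (A : Finset V) {H : (V → ℝ) → ℝ}
    (hH : DependsOn H (A : Set V)) (hq : IsQuadratic H) (hHc : Continuous H)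
    (hsup : ∀ φ ψ, H φ + H ψ ≤ H (φ ⊓ ψ) + H (φ ⊔ ψ)) {F G : (V → ℝ) →ᵇ ℝ} [Countable V]
    (hF : DependsOn F (A : Set V)) (hG : DependsOn G (A : Set V)) (hFm : Monotone F)
    (hGm : Monotone G) :
    (∫ φ, F φ ∂(gibbs ρ H)) * ∫ φ, G φ ∂(gibbs ρ H) ≤ ∫ φ, F φ * G φ ∂(gibbs ρ H) := by
  have := hρ.isProb
  have hs : ∀ t : ℝ, 0 ≤ t ^ 2 := fun t => sq_nonneg t
  have hpr := isProbabilityMeasure_gibbs hρ hq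
  have key : ∀ F G : (V → ℝ) →ᵇ ℝ, DependsOn F (A : Set V) → DependsOn G (A : Set V) →
      Monotone F → Monotone G → 0 ≤ (F : (V → ℝ) → ℝ) → 0 ≤ (G : (V → ℝ) → ℝ) →
      (∫ φ, F φ ∂(gibbs ρ H)) * ∫ φ, G φ ∂(gibbs ρ H) ≤ ∫ φ, F φ * G φ ∂(gibbs ρ H) := by
    intro F G hF hG hFm hGm hF0 hG0
    have hb : ∀ F : (V → ℝ) →ᵇ ℝ, IsTame F := fun F =>
      Tame.of_bounded F.continuous.measurable fun φ => F.norm_coe_le_norm φ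
    have hHe := hHc.rexp
    have h := le_of_tendsto_of_tendsto'
      ((tendsto_integral_discretize hρ ((hb F).mul hs hq.tame_exp) (F.continuous.mul hHe)).mul
        (tendsto_integral_discretize hρ ((hb G).mul hs hq.tame_exp) (G.continuous.mul hHe)))
      ((tendsto_integral_discretize hρ hq.tame_exp hHe).mul
        (tendsto_integral_discretize hρ (((hb F).mul hs (hb G)).mul hs hq.tame_exp)
          ((F.continuous.mul G.continuous).mul hHe)))
      fun n => fkg_discretize n A hH hF hG hsup hFm hGm hF0 hG0
    have hZ := partition_pos hρ hq
    rw [integral_gibbs, integral_gibbs, integral_gibbs, div_mul_div_comm,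
      div_le_div_iff₀ (mul_pos hZ hZ) hZ, ← mul_assoc]
    refine mul_le_mul_of_nonneg_right ?_ hZ.le
    linarith
  -- The combinatorial inequality needs nonnegative functions; adding constants does not change the
  -- covariance.
  have h := key (F + BoundedContinuousFunction.const _ ‖F‖)
    (G + BoundedContinuousFunction.const _ ‖G‖)
    (fun φ ψ h => by simp [hF h]) (fun φ ψ h => by simp [hG h])
    (fun φ ψ h => by simpa using hFm h) (fun φ ψ h => by simpa using hGm h)
    (fun φ => by
      have := neg_le_of_abs_le (F.norm_coe_le_norm φ)
      simp only [Pi.zero_apply, BoundedContinuousFunction.coe_add, Pi.add_apply,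
        BoundedContinuousFunction.const_apply]
      linarith)
    (fun φ => by
      have := neg_le_of_abs_le (G.norm_coe_le_norm φ)
      simp only [Pi.zero_apply, BoundedContinuousFunction.coe_add, Pi.add_apply,
        BoundedContinuousFunction.const_apply]
      linarith)
  have hFi := F.integrable (gibbs ρ H)
  have hGi := G.integrable (gibbs ρ H)
  have hFGi : Integrable (fun φ => F φ * G φ) (gibbs ρ H) := (F * G).integrable (gibbs ρ H)
  simp only [BoundedContinuousFunction.coe_add, Pi.add_apply,
    BoundedContinuousFunction.const_apply] at h
  have e : ∀ φ, (F φ + ‖F‖) * (G φ + ‖G‖) = F φ * G φ + (‖G‖ * F φ + (‖F‖ * G φ + ‖F‖ * ‖G‖)) :=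
    fun φ => by ring
  simp only [e] at h
  have hG' : Integrable (fun φ => ‖F‖ * G φ + ‖F‖ * ‖G‖) (gibbs ρ H) :=
    (hGi.const_mul _).add (integrable_const _)
  have hFG' : Integrable (fun φ => ‖G‖ * F φ + (‖F‖ * G φ + ‖F‖ * ‖G‖)) (gibbs ρ H) :=
    (hFi.const_mul _).add hG'
  rw [integral_add hFi (integrable_const _), integral_add hGi (integrable_const _),
    integral_add hFGi hFG', integral_add (hFi.const_mul _) hG', integral_add (hGi.const_mul _) (integrable_const _), integral_const_mul,
    integral_const_mul] at h
  simp only [integral_const, probReal_univ, smul_eq_mul, one_mul] at h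
  nlinarith

/-- Field terms give equality. A pair term has a strict gain only if `φ - ψ` changes sign between
`x` and `y`, and the gain is then `|φ x - ψ x| |φ y - ψ y|`. -/
lemma pairEnergy_supermodular {K : V → V → ℝ} (hK : ∀ x y, 0 ≤ K x y) (b : V → ℝ) (Λ : Finset V)
    (φ ψ : V → ℝ) : pairEnergy K b Λ φ + pairEnergy K b Λ ψ ≤
      pairEnergy K b Λ (φ ⊓ ψ) + pairEnergy K b Λ (φ ⊔ ψ) := by
  have h1 : ∀ x y, φ x * φ y + ψ x * ψ y ≤
      (φ ⊓ ψ) x * (φ ⊓ ψ) y + (φ ⊔ ψ) x * (φ ⊔ ψ) y := fun x y => by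
    simp only [Pi.inf_apply, Pi.sup_apply]
    rcases le_total (φ x) (ψ x) with hx | hx <;> rcases le_total (φ y) (ψ y) with hy | hy <;>
      simp only [hx, hy, inf_of_le_left, inf_of_le_right, sup_of_le_left, sup_of_le_right] <;>
      nlinarith [mul_nonneg (sub_nonneg.2 hx) (sub_nonneg.2 hy)]
  have h2 : ∀ x, φ x + ψ x = (φ ⊓ ψ) x + (φ ⊔ ψ) x := fun x => by
    rw [Pi.inf_apply, Pi.sup_apply, inf_add_sup]
  unfold pairEnergy
  rw [add_add_add_comm, add_add_add_comm (∑ x ∈ Λ, ∑ y ∈ Λ, K x y * ((φ ⊓ ψ) x * (φ ⊓ ψ) y))]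
  simp only [← Finset.sum_add_distrib, ← mul_add, ← h2]
  exact Finset.sum_le_sum fun x _ => add_le_add (Finset.sum_le_sum fun y _ =>
    mul_le_mul_of_nonneg_left (h1 x y) (hK x y)) le_rfl

lemma dependsOn_pairEnergy (K : V → V → ℝ) (b : V → ℝ) (Λ : Finset V) :
    DependsOn (pairEnergy K b Λ) (Λ : Set V) := fun φ ψ h => by
  unfold pairEnergy
  congr 1
  · exact Finset.sum_congr rfl fun x hx => Finset.sum_congr rfl fun y hy => by
      rw [h x hx, h y hy]
  · exact Finset.sum_congr rfl fun x hx => by rw [h x hx]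

/-- Covariance of bounded continuous functions. -/
def cov (μ : Measure (V → ℝ)) (F G : (V → ℝ) →ᵇ ℝ) : ℝ :=
  ∫ φ, F φ * G φ ∂μ - (∫ φ, F φ ∂μ) * ∫ φ, G φ ∂μ

lemma cov_add_left [Countable V] (μ : Measure (V → ℝ)) [IsFiniteMeasure μ] (F F' G : (V → ℝ) →ᵇ ℝ) :
    cov μ (F + F') G = cov μ F G + cov μ F' G := by
  have h1 : Integrable (fun φ => F φ * G φ) μ := (F * G).integrable μ
  have h2 : Integrable (fun φ => F' φ * G φ) μ := (F' * G).integrable μ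
  simp only [cov, BoundedContinuousFunction.coe_add, Pi.add_apply, add_mul]
  rw [integral_add h1 h2, integral_add (F.integrable μ) (F'.integrable μ)]
  ring

lemma cov_neg_left (μ : Measure (V → ℝ)) (F G : (V → ℝ) →ᵇ ℝ) :
    cov μ (-F) G = -cov μ F G := by
  simp only [cov, BoundedContinuousFunction.coe_neg, Pi.neg_apply, neg_mul, integral_neg]
  ring

lemma cov_comm (μ : Measure (V → ℝ)) (F G : (V → ℝ) →ᵇ ℝ) : cov μ F G = cov μ G F := by
  simp only [cov, mul_comm]

lemma WeakLimit.tendsto_cov {ι : Type*} {ν : ι → Measure (V → ℝ)} {l : Filter ι}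
    {μ : Measure (V → ℝ)} (h : WeakLimit ν l μ) (F G : (V → ℝ) →ᵇ ℝ) :
    Tendsto (fun i => cov (ν i) F G) l (𝓝 (cov μ F G)) :=
  (h.2 (F * G)).sub ((h.2 F).mul (h.2 G))

lemma cov_freeMeasureOn_nonneg [Countable V] {J : V → V → ℝ} {g a β : ℝ} (hg : 0 < g) (hJ : ∀ x y, 0 ≤ J x y)
    (hβ : 0 ≤ β) (h : ℝ) (Λ : Finset V) {F G : (V → ℝ) →ᵇ ℝ} (hF : Monotone F) (hG : Monotone G) :
    0 ≤ cov (freeMeasureOn J g a β h Λ) F G := by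
  have hcc : Continuous (cutoff Λ : (V → ℝ) → V → ℝ) := by
    refine continuous_pi fun x => ?_
    by_cases hx : x ∈ Λ
    · simpa [cutoff, hx] using continuous_apply x
    · simp [cutoff, hx, continuous_const]
  have hcm : Monotone (cutoff Λ : (V → ℝ) → V → ℝ) := fun φ ψ hle x => by
    by_cases hx : x ∈ Λ
    · simpa [cutoff, hx] using hle x
    · simp [cutoff, hx]
  have hcd : DependsOn (cutoff Λ : (V → ℝ) → V → ℝ) (Λ : Set V) := fun φ ψ heq => by
    ext x
    by_cases hx : x ∈ Λ
    · simpa [cutoff, hx] using heq x hx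
    · simp [cutoff, hx]
  have hHc : Continuous (energy J β h Λ) := by
    unfold energy pairEnergy
    fun_prop
  have hfkg := gibbs_fkg (isSiteMeasure_singleSite a hg) Λ
    (dependsOn_pairEnergy (fun x y => β * J x y) (fun _ => β * h) Λ)
    (isQuadratic_energy J β h Λ) hHc
    (pairEnergy_supermodular (fun x y => mul_nonneg hβ (hJ x y)) _ Λ)
    (F := F.compContinuous ⟨cutoff Λ, hcc⟩) (G := G.compContinuous ⟨cutoff Λ, hcc⟩)
    (fun φ ψ heq => by simp [hcd heq]) (fun φ ψ heq => by simp [hcd heq])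
    (hF.comp hcm) (hG.comp hcm)
  simp only [BoundedContinuousFunction.compContinuous_apply, ContinuousMap.coe_mk] at hfkg
  have hFG := integral_map (μ := gibbs (singleSite g a) (energy J β h Λ))
    hcc.measurable.aemeasurable (f := fun φ => F φ * G φ)
    (F.continuous.mul G.continuous).measurable.aestronglyMeasurable
  rw [cov, freeMeasureOn_eq J hg, hFG, integral_map hcc.measurable.aemeasurable
      F.continuous.measurable.aestronglyMeasurable, integral_map hcc.measurable.aemeasurable
      G.continuous.measurable.aestronglyMeasurable]
  exact sub_nonneg.2 hfkg

/-- Association of the plus measure. -/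
lemma IsPlusMeasure.cov_nonneg [Countable V] {J : V → V → ℝ} {g a β : ℝ} (hg : 0 < g) (hJ : ∀ x y, 0 ≤ J x y)
    (hβ : 0 ≤ β) {μ : Measure (V → ℝ)} (hμ : IsPlusMeasure J g a β μ) {F G : (V → ℝ) →ᵇ ℝ}
    (hF : Monotone F) (hG : Monotone G) : 0 ≤ cov μ F G := by
  obtain ⟨ν, hν, hμ⟩ := hμ
  refine ge_of_tendsto (hμ.tendsto_cov F G) ?_
  filter_upwards [self_mem_nhdsWithin] with h h0
  exact ge_of_tendsto' (WeakLimit.tendsto_cov (hν h h0) F G) fun Λ =>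
    cov_freeMeasureOn_nonneg hg hJ hβ h Λ hF hG

/-- The sum of bounded spins over a multiset of sites. -/
def spinSum (A : Multiset V) : (V → ℝ) →ᵇ ℝ := (A.map fun x => monomialBCF {x}).sum

lemma spinSum_cons (x : V) (A : Multiset V) : spinSum (x ::ₘ A) = monomialBCF {x} + spinSum A := by
  simp [spinSum]

/-- Factors are changed one at a time, the others being at most `1` in absolute value. Consequently
`spinSum A ± monomial A` are increasing. -/
lemma abs_monomial_sub_le (A : Multiset V) {φ ψ : V → ℝ} (h : φ ≤ ψ) :
    |monomial A ψ - monomial A φ| ≤ spinSum A ψ - spinSum A φ := by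
  induction A using Multiset.induction_on with
  | empty => simp [monomial, spinSum]
  | cons x A ih =>
    rw [monomial_cons, monomial_cons, spinSum_cons]
    simp only [BoundedContinuousFunction.coe_add, Pi.add_apply, monomialBCF_apply,
      monomial_singleton]
    have h1 : boundedSpin (φ x) ≤ boundedSpin (ψ x) := boundedSpin_strictMono.monotone (h x)
    have h2 : boundedSpin (ψ x) * monomial A ψ - boundedSpin (φ x) * monomial A φ =
        (boundedSpin (ψ x) - boundedSpin (φ x)) * monomial A ψ +
          boundedSpin (φ x) * (monomial A ψ - monomial A φ) := by ring
    rw [h2]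
    refine (abs_add_le _ _).trans ?_
    rw [abs_mul, abs_mul, abs_of_nonneg (sub_nonneg.2 h1)]
    have h3 := mul_le_of_le_one_right (sub_nonneg.2 h1) (abs_monomial_le_one A ψ)
    have h4 := mul_le_of_le_one_left (abs_nonneg (monomial A ψ - monomial A φ))
      (abs_boundedSpin_le_one (φ x))
    linarith

/-- Apply association to the increasing functions `spinSum ± monomial`. Adding the two inequalities
with equal signs, and the two with opposite signs, cancels the mixed terms and leaves the two
bounds. -/
lemma abs_cov_monomial_le [Countable V] {μ : Measure (V → ℝ)} [IsFiniteMeasure μ]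
    (hμ : ∀ F G : (V → ℝ) →ᵇ ℝ, Monotone F → Monotone G → 0 ≤ cov μ F G) (A B : Multiset V) :
    |cov μ (monomialBCF A) (monomialBCF B)| ≤ cov μ (spinSum A) (spinSum B) := by
  have hp : ∀ A : Multiset V, Monotone (spinSum A + monomialBCF A) := fun A φ ψ h => by
    have := neg_le_of_abs_le (abs_monomial_sub_le A h)
    simp only [BoundedContinuousFunction.coe_add, Pi.add_apply, monomialBCF_apply]
    linarith
  have hn : ∀ A : Multiset V, Monotone (spinSum A + -monomialBCF A) := fun A φ ψ h => by
    have := le_of_abs_le (abs_monomial_sub_le A h)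
    simp only [BoundedContinuousFunction.coe_add, Pi.add_apply, monomialBCF_apply,
      BoundedContinuousFunction.coe_neg, Pi.neg_apply]
    linarith
  have cov_add_right : ∀ F G G' : (V → ℝ) →ᵇ ℝ, cov μ F (G + G') = cov μ F G + cov μ F G' :=
    fun F G G' => by rw [cov_comm, cov_add_left, cov_comm _ G, cov_comm _ G']
  have cov_neg_right : ∀ F G : (V → ℝ) →ᵇ ℝ, cov μ F (-G) = -cov μ F G :=
    fun F G => by rw [cov_comm, cov_neg_left, cov_comm]
  have h1 := hμ _ _ (hp A) (hp B)
  have h2 := hμ _ _ (hn A) (hn B)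
  have h3 := hμ _ _ (hp A) (hn B)
  have h4 := hμ _ _ (hn A) (hp B)
  simp only [cov_add_left, cov_add_right, cov_neg_left, cov_neg_right] at h1 h2 h3 h4
  rw [abs_le]
  constructor <;> linarith

end FKG

/-! ### Decay of two-point covariances by counting bounded sources. -/

lemma IsGriffiths.comp_boundedSpin {f : ℝ → ℝ} (hf : Continuous f)
    (hpar : (∀ t, f (-t) = f t) ∨ ∀ t, f (-t) = -f t) (h0 : ∀ t, 0 ≤ t → 0 ≤ f t)
    (hm : MonotoneOn f (Set.Ici 0)) : IsGriffiths fun t => f (boundedSpin t) := by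
  obtain ⟨C, hC⟩ := (isCompact_Icc (a := (-1 : ℝ)) (b := 1)).exists_bound_of_continuousOn
    hf.continuousOn
  refine ⟨(hf.comp continuous_boundedSpin).measurable, ?_, fun t ht => h0 _ (boundedSpin_nonneg ht),
    fun s hs t ht hst => hm (boundedSpin_nonneg hs) (boundedSpin_nonneg ht)
      (boundedSpin_strictMono.monotone hst), |C|, 0, abs_nonneg _, le_rfl, fun t => ?_⟩
  · rcases hpar with h | h
    · exact Or.inl fun t => by rw [boundedSpin_neg, h]
    · exact Or.inr fun t => by rw [boundedSpin_neg, h]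
  · have := hC (boundedSpin t) (Set.mem_Icc.2 (abs_le.1 (abs_boundedSpin_le_one t)))
    rw [Real.norm_eq_abs] at this
    simpa using this.trans (le_abs_self C)

lemma isGriffiths_cosh_boundedSpin {δ : ℝ} (hδ : 0 ≤ δ) :
    IsGriffiths fun t => Real.cosh (δ * boundedSpin t) := by
  refine IsGriffiths.comp_boundedSpin (f := fun t => Real.cosh (δ * t)) (by fun_prop)
    (Or.inl fun t => by rw [mul_neg, Real.cosh_neg]) (fun t _ => (Real.cosh_pos _).le)
    fun s hs t ht hst => ?_
  rw [Real.cosh_le_cosh, abs_of_nonneg (mul_nonneg hδ hs), abs_of_nonneg (mul_nonneg hδ ht)]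
  exact mul_le_mul_of_nonneg_left hst hδ

/-- Together with the `cosh` part, this puts `exp (δ u) - δ u`, for `u` a bounded spin, in the
Griffiths cone. -/
lemma isGriffiths_sinh_sub_boundedSpin {δ : ℝ} (hδ : 0 ≤ δ) :
    IsGriffiths fun t => Real.sinh (δ * boundedSpin t) - δ * boundedSpin t := by
  refine IsGriffiths.comp_boundedSpin (f := fun t => Real.sinh (δ * t) - δ * t) (by fun_prop)
    (Or.inr fun t => by rw [mul_neg, Real.sinh_neg]; ring) (fun t ht => ?_)
    fun s hs t ht hst => Real.sinh_sub_id_strictMono.monotone (mul_le_mul_of_nonneg_left hst hδ)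
  have := Real.sinh_sub_id_strictMono.monotone (mul_nonneg hδ ht)
  simpa using this

/-- The derivative of `boundedSpin` is at most `1 / 2`, so `t - boundedSpin t` is increasing.
Replacing a bounded source by a linear field of the same strength thus raises correlations. -/
lemma isGriffiths_mul_sub_boundedSpin {r : ℝ} (hr : 0 ≤ r) :
    IsGriffiths fun t => r * t - r * boundedSpin t := by
  have hmono : Monotone fun t : ℝ => t - boundedSpin t := by
    have hd : ∀ t, HasDerivAt (fun t : ℝ => t - boundedSpin t) (1 - 1 / (1 + t ^ 2) / 2) t :=
      fun t => (hasDerivAt_id t).sub ((Real.hasDerivAt_arctan t).div_const 2)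
    refine monotone_of_deriv_nonneg (fun t => (hd t).differentiableAt) fun t => ?_
    rw [(hd t).deriv, sub_nonneg, div_div, div_le_one (by positivity)]
    nlinarith [sq_nonneg t]
  have hmono' : Monotone fun t : ℝ => r * t - r * boundedSpin t := fun s t hst => by
    have := mul_le_mul_of_nonneg_left (hmono hst) hr
    simp only at this ⊢
    linarith
  have hc := continuous_boundedSpin
  have h0 : boundedSpin 0 = 0 := by simp [boundedSpin]
  have hnn : ∀ t, 0 ≤ t → 0 ≤ r * t - r * boundedSpin t := fun t ht => by
    have := hmono' ht
    simp only [h0, mul_zero, sub_zero] at this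
    exact this
  have hpar : ∀ t, r * -t - r * boundedSpin (-t) = -(r * t - r * boundedSpin t) := fun t => by
    rw [boundedSpin_neg]
    ring
  refine ⟨by fun_prop, Or.inr hpar, hnn, hmono'.monotoneOn _, ?_⟩
  obtain ⟨C, c, hC, hc0, h⟩ := isGriffiths_id.growth
  refine ⟨r * C, c, by positivity, hc0, fun t => ?_⟩
  have hle : |r * t - r * boundedSpin t| ≤ r * |t| := by
    rw [abs_le]
    rcases le_total 0 t with ht | ht
    · rw [abs_of_nonneg ht]
      have h1 := hnn t ht
      have h2 := mul_nonneg hr (boundedSpin_nonneg ht)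
      have h3 := mul_nonneg hr ht
      constructor <;> linarith
    · rw [abs_of_nonpos ht]
      have h1 := hnn (-t) (by linarith)
      rw [hpar] at h1
      have h2 := mul_nonneg hr (boundedSpin_nonneg (by linarith : 0 ≤ -t))
      rw [boundedSpin_neg] at h2
      have h3 := mul_nonneg hr (by linarith : 0 ≤ -t)
      constructor <;> linarith
  refine hle.trans ?_
  rw [mul_assoc]
  exact mul_le_mul_of_nonneg_left (h t) hr

section

variable {ρ : Measure ℝ}

lemma integral_gibbs_add (hρ : IsSiteMeasure ρ) {H D : (V → ℝ) → ℝ} (hq : IsQuadratic H)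
    (F : (V → ℝ) → ℝ) :
    ∫ φ, F φ ∂(gibbs ρ fun φ => H φ + D φ) =
      (∫ φ, F φ * Real.exp (D φ) ∂(gibbs ρ H)) / ∫ φ, Real.exp (D φ) ∂(gibbs ρ H) := by
  rw [integral_gibbs, integral_gibbs, integral_gibbs,
    div_div_div_cancel_right₀ (partition_pos hρ hq).ne']
  simp only [Real.exp_add]
  congr 2
  · ext φ
    ring
  · ext φ
    ring

/-- Adding a bounded source at `y` raises the expectation of the bounded spin at `x` by at least
a multiple of their covariance. -/
lemma add_cov_le_gibbs_add [Nonempty V] [Countable V] (hρ : IsSiteMeasure ρ) {H : (V → ℝ) → ℝ}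
    (hH : H ∈ griffithsCone V) (hq : IsQuadratic H) {δ : ℝ} (hδ : 0 ≤ δ) (x y : V) :
    ∫ φ, monomial {x} φ ∂(gibbs ρ H) + δ * Real.exp (-δ) *
        cov (gibbs ρ H) (monomialBCF {x}) (monomialBCF {y}) ≤
      ∫ φ, monomial {x} φ ∂(gibbs ρ fun φ => H φ + δ * boundedSpin (φ y)) := by
  have hprob := isProbabilityMeasure_gibbs hρ hq
  set ν := gibbs ρ H with hν
  have hcov : 0 ≤ cov ν (monomialBCF {x}) (monomialBCF {y}) := sub_nonneg.2
    (gibbs_griffiths hρ (monomial_mem_griffithsCone {x}) (monomial_mem_griffithsCone {y}) hH hq)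
  have hS : (fun φ : V → ℝ => Real.exp (δ * boundedSpin (φ y)) - δ * boundedSpin (φ y)) ∈
      griffithsCone V := by
    convert add_mem (mem_griffithsCone y (isGriffiths_cosh_boundedSpin hδ))
      (mem_griffithsCone y (isGriffiths_sinh_sub_boundedSpin hδ)) using 1
    ext φ
    simp only [Pi.add_apply]
    rw [← Real.cosh_add_sinh]
    ring
  -- For `u` the bounded spin, this says that the covariance of `u_x` with `exp (δ u_y)` is at least
  -- `δ` times that of `u_x` with `u_y`.
  have hg := gibbs_griffiths hρ (monomial_mem_griffithsCone {x}) hS hH hq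
  have hle : ∀ φ : V → ℝ, δ * boundedSpin (φ y) ≤ δ := fun φ =>
    mul_le_of_le_one_right hδ (le_of_abs_le (abs_boundedSpin_le_one _))
  have hcu := continuous_boundedSpin
  have hcm := continuous_monomial ({x} : Multiset V)
  have i1 : Integrable (fun φ : V → ℝ => Real.exp (δ * boundedSpin (φ y))) ν := by
    refine Integrable.of_bound (C := Real.exp δ)
      (Continuous.measurable (by fun_prop)).aestronglyMeasurable (ae_of_all _ fun φ => ?_)
    rw [Real.norm_eq_abs, abs_of_pos (Real.exp_pos _)]
    exact Real.exp_le_exp.2 (hle φ)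
  have i2 : Integrable (fun φ : V → ℝ => monomial {x} φ * Real.exp (δ * boundedSpin (φ y))) ν := by
    refine Integrable.of_bound (C := Real.exp δ)
      (Continuous.measurable (by fun_prop)).aestronglyMeasurable (ae_of_all _ fun φ => ?_)
    rw [norm_mul, Real.norm_eq_abs, Real.norm_eq_abs, abs_of_pos (Real.exp_pos _)]
    exact (mul_le_of_le_one_left (Real.exp_pos _).le (abs_monomial_le_one _ _)).trans
      (Real.exp_le_exp.2 (hle φ))
  have i3 : Integrable (fun φ : V → ℝ => monomial {x} φ * monomial {y} φ) ν :=
    (monomialBCF {x} * monomialBCF {y}).integrable ν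
  have i4 := integrable_monomial ({y} : Multiset V) ν
  have e1 : ∀ φ : V → ℝ, Real.exp (δ * boundedSpin (φ y)) - δ * boundedSpin (φ y) =
      Real.exp (δ * boundedSpin (φ y)) - δ * monomial {y} φ := fun φ => by rw [monomial_singleton]
  have e2 : ∀ φ : V → ℝ, monomial {x} φ * (Real.exp (δ * boundedSpin (φ y)) - δ * monomial {y} φ) =
      monomial {x} φ * Real.exp (δ * boundedSpin (φ y)) - δ * (monomial {x} φ * monomial {y} φ) :=
    fun φ => by ring
  simp only [e1, e2] at hg
  rw [integral_sub i1 (i4.const_mul δ), integral_sub i2 (i3.const_mul δ), integral_const_mul,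
    integral_const_mul] at hg
  rw [integral_gibbs_add hρ hq]
  -- The new measure is normalized by `E ≤ exp δ`, which is the origin of the factor `exp (-δ)`.
  set E := ∫ φ, Real.exp (δ * boundedSpin (φ y)) ∂ν with hE
  have hEpos : 0 < E := integral_exp_pos i1
  have hEle : E ≤ Real.exp δ := by
    refine (integral_mono i1 (integrable_const (Real.exp δ)) fun φ =>
      Real.exp_le_exp.2 (hle φ)).trans ?_
    simp
  rw [le_div_iff₀ hEpos, add_mul]
  have h1 : Real.exp (-δ) * E ≤ 1 := by
    rw [Real.exp_neg, inv_mul_le_iff₀ (Real.exp_pos _), mul_one]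
    exact hEle
  have h2 : δ * Real.exp (-δ) * cov ν (monomialBCF {x}) (monomialBCF {y}) * E ≤
      δ * cov ν (monomialBCF {x}) (monomialBCF {y}) := by
    have := mul_le_mul_of_nonneg_left h1 (mul_nonneg hδ hcov)
    linarith
  have h3 : cov ν (monomialBCF {x}) (monomialBCF {y}) = ∫ φ, monomial {x} φ * monomial {y} φ ∂ν -
      (∫ φ, monomial {x} φ ∂ν) * ∫ φ, monomial {y} φ ∂ν := rfl
  rw [h3] at h2 ⊢
  linarith

/-- The energy with field `h` and bounded sources of strength `β h` on `Y`. -/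
def sourceEnergy (J : V → V → ℝ) (β h : ℝ) (Λ Y : Finset V) (φ : V → ℝ) : ℝ :=
  energy J β h Λ φ + ∑ y ∈ Y, β * h * boundedSpin (φ y)

lemma isQuadratic_sourceEnergy (J : V → V → ℝ) (β h : ℝ) (Λ Y : Finset V) :
    IsQuadratic (sourceEnergy J β h Λ Y) := by
  refine (isQuadratic_energy J β h Λ).add
    (QuadBounded.sum (fun t => sq_nonneg t) _ _ fun y _ => QuadBounded.const_mul ?_ _)
  exact IsQuadratic.of_bounded (continuous_boundedSpin.measurable.comp (measurable_pi_apply y))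
    fun φ => abs_boundedSpin_le_one _

lemma sum_sources_mem [Nonempty V] {r : ℝ} (hr : 0 ≤ r) (Y : Finset V) :
    (fun φ : V → ℝ => ∑ y ∈ Y, r * boundedSpin (φ y)) ∈ griffithsCone V :=
  sum_mem_griffithsCone _ _ fun y _ =>
    const_mul_mem_griffithsCone hr (mem_griffithsCone y isGriffiths_boundedSpin)

/-- Field `2h` dominates field `h` with sources: on `Y` the linear term exceeds the bounded one by a
Griffiths function, and off `Y` a full extra field remains. -/
lemma energy_two_mul_sub_mem [Nonempty V] {J : V → V → ℝ} {β h : ℝ} (hβ : 0 ≤ β) (h0 : 0 ≤ h)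
    {Λ Y : Finset V} (hY : Y ⊆ Λ) :
    (fun φ => energy J β (2 * h) Λ φ - sourceEnergy J β h Λ Y φ) ∈ griffithsCone V := by
  classical
  have hr : 0 ≤ β * h := mul_nonneg hβ h0
  convert add_mem (sum_mem_griffithsCone Y (fun y φ => β * h * φ y - β * h * boundedSpin (φ y))
    fun y _ => mem_griffithsCone y (isGriffiths_mul_sub_boundedSpin hr))
    (sum_mem_griffithsCone (Λ \ Y) (fun y φ => β * h * φ y)
      fun y _ => const_mul_mem_griffithsCone hr (mem_griffithsCone y isGriffiths_id)) using 1
  ext φ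
  simp only [sourceEnergy, energy, pairEnergy, Pi.add_apply, Finset.sum_sub_distrib,
    ← Finset.mul_sum]
  rw [← Finset.sum_sdiff hY (f := fun y => φ y)]
  ring

/-- Counting sites with covariance bounded below: each source increases the expectation of the
spin at `x` by a definite amount. -/
lemma card_mul_le_one [Nonempty V] [Countable V] (hρ : IsSiteMeasure ρ) {J : V → V → ℝ}
    (hJ : ∀ x y, 0 ≤ J x y) {β h : ℝ} (hβ : 0 ≤ β) (h0 : 0 ≤ h) {Λ Y : Finset V} (hY : Y ⊆ Λ)
    (x : V) {q m : ℝ} (hm0 : 0 ≤ m)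
    (hq : ∀ y ∈ Y, q ≤ ∫ φ, monomial {x, y} φ ∂(gibbs ρ (energy J β h Λ)))
    (hm : ∀ y, ∫ φ, monomial {y} φ ∂(gibbs ρ (energy J β (2 * h) Λ)) ≤ m) :
    Y.card * (β * h * Real.exp (-(β * h)) * (q - m ^ 2)) ≤ 1 := by
  classical
  have hr : 0 ≤ β * h := mul_nonneg hβ h0
  have hcone := energy_mem_griffithsCone Λ hJ hβ h0
  have hsrc : ∀ Y, sourceEnergy J β h Λ Y ∈ griffithsCone V := fun Y =>
    add_mem hcone (sum_sources_mem hr Y)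
  -- Every intermediate measure lies between field `h`, which keeps pair correlations at least `q`,
  -- and field `2h`, which keeps one-point expectations at most `m`. The covariance is therefore at
  -- least `q - m ^ 2` at every stage.
  have hup : ∀ Y', Y' ⊆ Y → ∀ y, ∫ φ, monomial {y} φ ∂(gibbs ρ (sourceEnergy J β h Λ Y')) ≤ m :=
    fun Y' hY' y => (gibbs_le_gibbs hρ (monomial_mem_griffithsCone {y}) (hsrc Y')
      (isQuadratic_sourceEnergy J β h Λ Y') (energy_two_mul_sub_mem hβ h0 (hY'.trans hY))
      (isQuadratic_energy _ _ _ _)).trans (hm y)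
  have hlow : ∀ Y', ∀ y ∈ Y, q ≤ ∫ φ, monomial {x, y} φ ∂(gibbs ρ (sourceEnergy J β h Λ Y')) := by
    intro Y' y hy
    refine (hq y hy).trans (gibbs_mono hρ (monomial_mem_griffithsCone _) hcone
      (isQuadratic_energy _ _ _ _) (sum_sources_mem hr Y')
      (QuadBounded.sum (fun t => sq_nonneg t) _ _ fun y _ => QuadBounded.const_mul ?_ _))
    exact IsQuadratic.of_bounded (continuous_boundedSpin.measurable.comp (measurable_pi_apply y))
      fun φ => abs_boundedSpin_le_one _
  have hind : ∀ Y', Y' ⊆ Y → Y'.card * (β * h * Real.exp (-(β * h)) * (q - m ^ 2)) ≤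
      ∫ φ, monomial {x} φ ∂(gibbs ρ (sourceEnergy J β h Λ Y')) := by
    intro Y'
    induction Y' using Finset.induction_on with
    | empty =>
      intro _
      simpa using gibbs_nonneg hρ (monomial_mem_griffithsCone {x}) (hsrc ∅)
        (isQuadratic_sourceEnergy J β h Λ ∅)
    | insert y Y' hy ih =>
      intro hsub
      have hsub' : Y' ⊆ Y := (Finset.subset_insert y Y').trans hsub
      have hyY : y ∈ Y := hsub (Finset.mem_insert_self y Y')
      have hstep := add_cov_le_gibbs_add hρ (hsrc Y') (isQuadratic_sourceEnergy J β h Λ Y') hr x y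
      have heq : (fun φ => sourceEnergy J β h Λ Y' φ + β * h * boundedSpin (φ y)) =
          sourceEnergy J β h Λ (insert y Y') := by
        ext φ
        simp only [sourceEnergy, Finset.sum_insert hy]
        ring
      rw [heq] at hstep
      have hpair : ∀ φ : V → ℝ, monomial {x} φ * monomial {y} φ = monomial {x, y} φ := fun φ => by
        rw [← monomial_add]
        rfl
      have hcov : q - m ^ 2 ≤ cov (gibbs ρ (sourceEnergy J β h Λ Y')) (monomialBCF {x})
          (monomialBCF {y}) := by
        simp only [cov, monomialBCF_apply, hpair]
        have h1 := hlow Y' y hyY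
        have h2 := mul_le_mul (hup Y' hsub' x) (hup Y' hsub' y)
          (gibbs_nonneg hρ (monomial_mem_griffithsCone {y}) (hsrc Y')
            (isQuadratic_sourceEnergy J β h Λ Y')) hm0
        linarith [sq m]
      have hmul := mul_le_mul_of_nonneg_left hcov
        (mul_nonneg hr (Real.exp_pos (-(β * h))).le)
      rw [Finset.card_insert_of_notMem hy]
      push_cast
      linarith [ih hsub']
  refine (hind Y subset_rfl).trans ?_
  have := isProbabilityMeasure_gibbs hρ (isQuadratic_sourceEnergy J β h Λ Y)
  refine (integral_mono (g := fun _ => 1) (integrable_monomial {x} _) (integrable_const 1)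
      fun φ => (le_abs_self _).trans (abs_monomial_le_one _ φ)).trans (by simp)

end

/-- In the plus measure, only finitely many spins have covariance at least `η` with a given
spin. -/
lemma IsPlusMeasure.finite_cov_ge [Nonempty V] [Countable V] {J : V → V → ℝ} {g a β : ℝ}
    (hg : 0 < g) (hJ : ∀ x y, 0 ≤ J x y) (hβ : 0 < β)
    (hT : ∀ x y : V, ∃ e : V ≃ V, e x = y ∧ ∀ u v, J (e u) (e v) = J u v)
    {μ : Measure (V → ℝ)} (hμ : IsPlusMeasure J g a β μ) (x : V) {η : ℝ} (hη : 0 < η) :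
    {y : V | η ≤ cov μ (monomialBCF {x}) (monomialBCF {y})}.Finite := by
  obtain ⟨ν, hν, hμ⟩ := hμ
  have hsite : ∀ h, 0 < h → ∀ y, ∫ φ, monomial {y} φ ∂(ν h) = ∫ φ, monomial {x} φ ∂(ν h) := by
    intro h h0 y
    obtain ⟨e, he, hinv⟩ := hT x y
    have := (hν h h0).integral_monomial_map hg e hinv {x}
    rwa [Multiset.map_singleton, he] at this
  have hlim : ∀ y, Tendsto (fun h => ∫ φ, monomial {y} φ ∂(ν h)) (𝓝[>] 0)
      (𝓝 (∫ φ, monomial {y} φ ∂μ)) := fun y => hμ.2 (monomialBCF {y})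
  have hsiteμ : ∀ y, ∫ φ, monomial {y} φ ∂μ = ∫ φ, monomial {x} φ ∂μ := fun y =>
    tendsto_nhds_unique (hlim y) ((hlim x).congr' (by
      filter_upwards [self_mem_nhdsWithin] with h h0
      exact (hsite h h0 y).symm))
  set m := ∫ φ, monomial {x} φ ∂μ with hm
  -- Sources are added at field `k / 2`, so `k` is the doubled field, whose one-point expectation
  -- must still be close to that of the plus measure.
  obtain ⟨k, hk0, hk⟩ : ∃ k : ℝ, 0 < k ∧ (∫ φ, monomial {x} φ ∂(ν k)) ^ 2 < m ^ 2 + η / 2 :=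
    ((eventually_nhdsWithin_of_forall (s := Set.Ioi (0 : ℝ)) fun k hk => Set.mem_Ioi.1 hk).and
      (((hlim x).pow 2).eventually_lt_const (by linarith))).exists
  set m' := ∫ φ, monomial {x} φ ∂(ν k) with hm'
  have hk2 : 0 < k / 2 := by positivity
  have hρ := isSiteMeasure_singleSite a hg
  set c := β * (k / 2) * Real.exp (-(β * (k / 2))) with hc
  have hcpos : 0 < c := by positivity
  by_contra hinf
  -- The covariance lower bound will be `3η/4 - η/2 = η/4`, so more than `4 / (c η)` sources
  -- contradict the bound `1`.
  obtain ⟨Y, hYsub, hYcard⟩ := Set.Infinite.exists_subset_card_eq hinf (⌈4 / (c * η)⌉₊ + 1)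
  have hev : ∀ y ∈ Y, ∀ᶠ Λ : Finset V in atTop,
      m ^ 2 + 3 / 4 * η ≤ ∫ φ, monomial {x, y} φ ∂(volumeGibbs J g a β (k / 2) Λ) := by
    intro y hy
    have h1 : η ≤ cov μ (monomialBCF {x}) (monomialBCF {y}) := hYsub hy
    have hpair : ∀ φ : V → ℝ, monomial {x} φ * monomial {y} φ = monomial {x, y} φ := fun φ => by
      rw [← monomial_add]
      rfl
    simp only [cov, monomialBCF_apply, hpair, hsiteμ y] at h1
    have h2 := le_of_weakLimit_plus hg hJ hβ.le hν hμ {x, y} hk2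
    have h3 : m ^ 2 + 3 / 4 * η < ∫ φ, monomial {x, y} φ ∂(ν (k / 2)) := by
      rw [← hm] at h1
      linarith [sq m]
    exact ((hν _ hk2).tendsto_monomial hg {x, y}).eventually_const_le h3
  -- As `Y` is finite, a single volume serves all its sites.
  obtain ⟨Λ, hΛY, hΛ⟩ :=
    ((eventually_ge_atTop Y).and ((Finset.eventually_all Y).2 hev)).exists
  have hm'0 : 0 ≤ m' :=
    (gibbs_nonneg hρ (monomial_mem_griffithsCone {x}) (energy_mem_griffithsCone ∅ hJ hβ.le hk0.le)
      (isQuadratic_energy _ _ _ _)).trans ((hν k hk0).volumeGibbs_le hg hJ hβ.le hk0.le {x} ∅)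
  have hcard := card_mul_le_one hρ hJ hβ.le hk2.le hΛY x hm'0 hΛ (fun y => by
    have h1 := (hν k hk0).volumeGibbs_le hg hJ hβ.le hk0.le {y} Λ
    rw [hsite k hk0 y] at h1
    rwa [mul_div_cancel₀ k two_ne_zero])
  rw [hYcard, ← hc] at hcard
  have h1 : η / 4 ≤ m ^ 2 + 3 / 4 * η - m' ^ 2 := by linarith
  have h2 : (4 / (c * η) : ℝ) < ((⌈4 / (c * η)⌉₊ + 1 : ℕ) : ℝ) := by
    push_cast
    linarith [Nat.le_ceil (4 / (c * η))]
  rw [div_lt_iff₀ (by positivity)] at h2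
  have h3 := mul_le_mul_of_nonneg_left (mul_le_mul_of_nonneg_left h1 hcpos.le)
    (Nat.cast_nonneg (α := ℝ) (⌈4 / (c * η)⌉₊ + 1))
  linarith

/-! ### From monomials to square-integrable functions. -/

section Clustering

variable {ι : Type*} {l : Filter ι} {μ : Measure (V → ℝ)}

lemma tendsto_cov_spinSum [Countable V] [IsFiniteMeasure μ] {e : ι → V → V}
    (h : ∀ x y, Tendsto (fun i => cov μ (monomialBCF {x}) (monomialBCF {e i y})) l (𝓝 0))
    (A B : Multiset V) :
    Tendsto (fun i => cov μ (spinSum A) (spinSum (B.map (e i)))) l (𝓝 0) := by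
  have hx : ∀ x, Tendsto (fun i => cov μ (monomialBCF {x}) (spinSum (B.map (e i)))) l (𝓝 0) := by
    intro x
    induction B using Multiset.induction_on with
    | empty => simpa [spinSum, cov] using tendsto_const_nhds
    | cons y B ih =>
      simp only [Multiset.map_cons, spinSum_cons, cov_comm μ (monomialBCF {x}), cov_add_left]
      simp only [cov_comm μ _ (monomialBCF {x})]
      simpa using (h x y).add ih
  induction A using Multiset.induction_on with
  | empty => simpa [spinSum, cov] using tendsto_const_nhds
  | cons x A ih =>
    simp only [spinSum_cons, cov_add_left]
    simpa using (hx x).add ih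

/-- Bounded functionals that tend to zero on a set with dense span tend to zero everywhere. -/
lemma tendsto_zero_of_dense_span {H : Type*} [NormedAddCommGroup H] [NormedSpace ℝ H]
    {L : ι → H →ₗ[ℝ] ℝ} {C : ℝ} (hL : ∀ i f, |L i f| ≤ C * ‖f‖) {S : Set H}
    (hS : (Submodule.span ℝ S).topologicalClosure = ⊤)
    (h : ∀ f ∈ S, Tendsto (fun i => L i f) l (𝓝 0)) (f : H) :
    Tendsto (fun i => L i f) l (𝓝 0) := by
  have hspan : ∀ p ∈ Submodule.span ℝ S, Tendsto (fun i => L i p) l (𝓝 0) := by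
    intro p hp
    induction hp using Submodule.span_induction with
    | mem p hp => exact h p hp
    | zero => simpa using tendsto_const_nhds
    | add p q _ _ hp hq => simpa using hp.add hq
    | smul r p _ hp => simpa using hp.const_mul r
  rw [Metric.tendsto_nhds]
  intro ε hε
  have hf : f ∈ closure (Submodule.span ℝ S : Set H) := by
    rw [← Submodule.topologicalClosure_coe, hS]
    trivial
  have hC : 0 < |C| + 1 := by positivity
  obtain ⟨p, hp, hfp⟩ := Metric.mem_closure_iff.1 hf (ε / 2 / (|C| + 1)) (by positivity)
  filter_upwards [Metric.tendsto_nhds.1 (hspan p hp) (ε / 2) (half_pos hε)] with i hi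
  rw [Real.dist_eq, sub_zero] at hi ⊢
  have h1 := hL i (f - p)
  rw [map_sub] at h1
  rw [dist_eq_norm, lt_div_iff₀ hC] at hfp
  have h2 : C * ‖f - p‖ ≤ ‖f - p‖ * (|C| + 1) := by
    nlinarith [norm_nonneg (f - p), le_abs_self C]
  have h3 := abs_sub_abs_le_abs_sub (L i f) (L i p)
  linarith

lemma memLp_of_bounded [IsFiniteMeasure μ] {f : (V → ℝ) → ℝ} (hf : Measurable f) {C : ℝ}
    (hC : ∀ φ, |f φ| ≤ C) : MemLp f 2 μ :=
  MemLp.of_bound hf.aestronglyMeasurable C (ae_of_all _ hC)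

lemma memLp_monomial (μ : Measure (V → ℝ)) [IsFiniteMeasure μ] (A : Multiset V) :
    MemLp (monomial A) 2 μ :=
  memLp_of_bounded (tame_of_mem_griffithsCone (monomial_mem_griffithsCone A)).1
    (abs_monomial_le_one A)

/-- Monomials in `L²`. -/
def monomialLp (μ : Measure (V → ℝ)) [IsFiniteMeasure μ] (A : Multiset V) : Lp ℝ 2 μ :=
  (memLp_monomial μ A).toLp _

lemma inner_toLp [IsFiniteMeasure μ] {f₁ f₂ : (V → ℝ) → ℝ} (h₁ : MemLp f₁ 2 μ)
    (h₂ : MemLp f₂ 2 μ) : inner ℝ (h₁.toLp f₁) (h₂.toLp f₂) = ∫ φ, f₁ φ * f₂ φ ∂μ := by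
  rw [L2.inner_def]
  refine integral_congr_ae ?_
  filter_upwards [h₁.coeFn_toLp, h₂.coeFn_toLp] with φ e₁ e₂
  rw [e₁, e₂, real_inner_comm]
  simp

/-- If `u` is orthogonal to all monomials, the finite measures with densities `u⁺` and `u⁻` have
equal monomial integrals, hence coincide, and `u = 0`. -/
lemma dense_span_monomialLp [Countable V] [IsFiniteMeasure μ] :
    (Submodule.span ℝ (Set.range (monomialLp μ))).topologicalClosure = ⊤ := by
  rw [Submodule.topologicalClosure_eq_top_iff, Submodule.eq_bot_iff]
  intro u hu
  have hmeas : ∀ A : Multiset V, Measurable (monomial A) := fun A =>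
    (tame_of_mem_griffithsCone (monomial_mem_griffithsCone A)).1
  have hint : Integrable (fun φ => u φ) μ := (Lp.memLp u).integrable one_le_two
  have horth : ∀ A, ∫ φ, u φ * monomial A φ ∂μ = 0 := by
    intro A
    have h := (Submodule.mem_orthogonal _ u).1 hu (monomialLp μ A)
      (Submodule.subset_span ⟨A, rfl⟩)
    rw [real_inner_comm, L2.inner_def] at h
    rw [← h]
    refine integral_congr_ae ?_
    filter_upwards [(memLp_monomial μ A).coeFn_toLp] with φ e
    rw [monomialLp, e, real_inner_comm]
    simp [mul_comm]
  have hfin : ∀ v : (V → ℝ) → ℝ, Integrable v μ →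
      ∫⁻ φ, ENNReal.ofReal (v φ) ∂μ ≠ ⊤ := fun v hv => hv.lintegral_lt_top.ne
  have hdens : ∀ v : (V → ℝ) → ℝ, Integrable v μ → ∀ A,
      ∫ φ, monomial A φ ∂(μ.withDensity fun φ => ENNReal.ofReal (v φ)) =
        ∫ φ, max (v φ) 0 * monomial A φ ∂μ := fun v hv A => by
    rw [integral_withDensity_eq_integral_toReal_smul₀ hv.aemeasurable.ennreal_ofReal
      (ae_of_all _ fun φ => ENNReal.ofReal_lt_top)]
    simp only [ENNReal.toReal_ofReal', smul_eq_mul]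
  have hneg : Integrable (fun φ => -u φ) μ := hint.neg
  have h1 : IsFiniteMeasure (μ.withDensity fun φ => ENNReal.ofReal (u φ)) :=
    isFiniteMeasure_withDensity (hfin _ hint)
  have h2 : IsFiniteMeasure (μ.withDensity fun φ => ENNReal.ofReal (-u φ)) :=
    isFiniteMeasure_withDensity (hfin _ hneg)
  have heq : (μ.withDensity fun φ => ENNReal.ofReal (u φ)) =
      μ.withDensity fun φ => ENNReal.ofReal (-u φ) := by
    refine ext_of_integral_monomial fun A => ?_
    rw [hdens _ hint, hdens _ hneg, ← sub_eq_zero, ← integral_sub]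
    · refine Eq.trans ?_ (horth A)
      refine integral_congr_ae (ae_of_all _ fun φ => ?_)
      simp only
      rw [← sub_mul, max_zero_sub_max_neg_zero_eq_self]
    · exact hint.pos_part.mul_bdd (c := 1) (hmeas A).aestronglyMeasurable
        (ae_of_all _ (abs_monomial_le_one A))
    · exact hneg.pos_part.mul_bdd (c := 1) (hmeas A).aestronglyMeasurable
        (ae_of_all _ (abs_monomial_le_one A))
  rw [withDensity_eq_iff hint.aemeasurable.ennreal_ofReal hneg.aemeasurable.ennreal_ofReal
    (hfin _ hint)] at heq
  refine (Lp.eq_zero_iff_ae_eq_zero).2 ?_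
  filter_upwards [heq] with φ h
  rw [Pi.zero_apply]
  rcases le_total 0 (u φ) with h0 | h0
  · rw [ENNReal.ofReal_of_nonpos (neg_nonpos.2 h0), ENNReal.ofReal_eq_zero] at h
    exact le_antisymm h h0
  · rw [ENNReal.ofReal_of_nonpos h0, eq_comm, ENNReal.ofReal_eq_zero] at h
    exact le_antisymm h0 (by linarith)

/-- Decorrelation of monomials under measure-preserving maps extends to bounded measurable
functions. -/
lemma tendsto_integral_mul_of_monomial [Countable V] [IsProbabilityMeasure μ]
    {T : ι → (V → ℝ) → V → ℝ} (hT : ∀ i, MeasurePreserving (T i) μ μ)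
    (h : ∀ A B, Tendsto (fun i => ∫ φ, monomial A φ * monomial B (T i φ) ∂μ) l
      (𝓝 ((∫ φ, monomial A φ ∂μ) * ∫ φ, monomial B φ ∂μ)))
    {f₁ f₂ : (V → ℝ) → ℝ} (hf₁ : MemLp f₁ 2 μ) (hf₂ : MemLp f₂ 2 μ) :
    Tendsto (fun i => ∫ φ, f₁ φ * f₂ (T i φ) ∂μ) l (𝓝 ((∫ φ, f₁ φ ∂μ) * ∫ φ, f₂ φ ∂μ)) := by
  -- Composition with a measure-preserving map is an `L²` isometry, so the covariance forms below
  -- are bounded uniformly in `i`; `w` is the constant function `1`.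
  set U : ι → Lp ℝ 2 μ →ₗᵢ[ℝ] Lp ℝ 2 μ := fun i => Lp.compMeasurePreservingₗᵢ ℝ (T i) (hT i) with hU
  have hUto : ∀ i (f : (V → ℝ) → ℝ) (hf : MemLp f 2 μ),
      U i (hf.toLp f) = (hf.comp_measurePreserving (hT i)).toLp _ := fun i f hf =>
    Lp.toLp_compMeasurePreserving hf (hT i)
  have h1 : MemLp (fun _ : V → ℝ => (1 : ℝ)) 2 μ := memLp_const 1
  set w : Lp ℝ 2 μ := h1.toLp _ with hw
  have hw1 : ‖w‖ ≤ 1 := by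
    have : ‖w‖ ^ 2 = 1 := by
      rw [← real_inner_self_eq_norm_sq, hw, inner_toLp]
      simp
    nlinarith [norm_nonneg w]
  have hbound : ∀ i (F K : Lp ℝ 2 μ),
      |inner ℝ F (U i K) - inner ℝ F w * inner ℝ w K| ≤ 2 * ‖F‖ * ‖K‖ := by
    intro i F K
    have b1 := abs_real_inner_le_norm F (U i K)
    rw [LinearIsometry.norm_map] at b1
    have b2 : |inner ℝ F w * inner ℝ w K| ≤ ‖F‖ * ‖K‖ := by
      rw [abs_mul]
      refine mul_le_mul ((abs_real_inner_le_norm F w).trans ?_)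
        ((abs_real_inner_le_norm w K).trans ?_) (abs_nonneg _) (norm_nonneg _)
      · exact mul_le_of_le_one_right (norm_nonneg _) hw1
      · exact mul_le_of_le_one_left (norm_nonneg _) hw1
    have b3 := abs_sub (inner ℝ F (U i K)) (inner ℝ F w * inner ℝ w K)
    linarith
  have hto : ∀ i (p q : (V → ℝ) → ℝ) (hp : MemLp p 2 μ) (hq : MemLp q 2 μ),
      inner ℝ (hp.toLp p) (U i (hq.toLp q)) - inner ℝ (hp.toLp p) w * inner ℝ w (hq.toLp q) =
        ∫ φ, p φ * q (T i φ) ∂μ - (∫ φ, p φ ∂μ) * ∫ φ, q φ ∂μ := by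
    intro i p q hp hq
    rw [hUto, hw, inner_toLp, inner_toLp, inner_toLp]
    simp
  suffices hmain : ∀ F K : Lp ℝ 2 μ,
      Tendsto (fun i => inner ℝ F (U i K) - inner ℝ F w * inner ℝ w K) l (𝓝 0) by
    have := hmain (hf₁.toLp f₁) (hf₂.toLp f₂)
    simp only [hto] at this
    exact tendsto_sub_nhds_zero_iff.1 this
  -- Density is used twice: first in the second argument with a monomial fixed in the first, then in
  -- the first argument.
  have hstep : ∀ A K,
      Tendsto (fun i => inner ℝ (monomialLp μ A) (U i K) -
        inner ℝ (monomialLp μ A) w * inner ℝ w K) l (𝓝 0) := by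
    intro A
    refine tendsto_zero_of_dense_span (L := fun i =>
      ((innerₛₗ ℝ (monomialLp μ A)).comp (U i).toLinearMap -
        inner ℝ (monomialLp μ A) w • innerₛₗ ℝ w)) (hbound · (monomialLp μ A))
        dense_span_monomialLp ?_
    rintro _ ⟨B, rfl⟩
    have := tendsto_sub_nhds_zero_iff.2 (h A B)
    refine this.congr fun i => ?_
    exact (hto i _ _ (memLp_monomial μ A) (memLp_monomial μ B)).symm
  intro F K
  have := tendsto_zero_of_dense_span (l := l) (C := 2 * ‖K‖) (L := fun i =>
      (innerₛₗ ℝ (U i K) - inner ℝ w K • innerₛₗ ℝ w)) (fun i F => ?_)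
        (dense_span_monomialLp (μ := μ)) ?_ F
  · refine this.congr fun i => ?_
    simp [real_inner_comm, mul_comm]
  · have := hbound i F K
    simp only [LinearMap.sub_apply, LinearMap.smul_apply, innerₛₗ_apply_apply, smul_eq_mul]
    rw [real_inner_comm, real_inner_comm F w, mul_comm (inner ℝ w K)]
    linarith
  · rintro _ ⟨A, rfl⟩
    refine (hstep A K).congr fun i => ?_
    simp [real_inner_comm, mul_comm]

end Clustering

/-! ### Mixing of the plus measure. -/

section Mixing

variable {G : SimpleGraph V} {Γ : Subgroup (G ≃g G)} {J : V → V → ℝ} {g a β : ℝ}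

/-- The plus measure is mixing. -/
lemma IsPlusMeasure.isMixing [Nonempty V] [Countable V] (hconn : G.Connected) {o : V}
    (hΓ : IsVertexTransitive Γ) (hg : 0 < g) (hJ : ∀ x y, 0 ≤ J x y) (hβ : 0 < β)
    (hinv : ∀ γ ∈ Γ, ∀ x y, J (γ x) (γ y) = J x y) {μ : Measure (V → ℝ)}
    (hμ : IsPlusMeasure J g a β μ) : IsMixing Γ o μ := by
  have hprob : IsProbabilityMeasure μ := hμ.choose_spec.2.1
  have hT : ∀ x y : V, ∃ e : V ≃ V, e x = y ∧ ∀ u v, J (e u) (e v) = J u v := fun x y => by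
    obtain ⟨γ, hγ, hxy⟩ := hΓ x y
    exact ⟨γ.toEquiv, hxy, hinv γ hγ⟩
  have hmeas : ∀ γ : Γ, Measurable fun (φ : V → ℝ) x => φ ((γ : G ≃g G) x) := fun γ =>
    measurable_pi_lambda _ fun x => measurable_pi_apply _
  have hpres : ∀ γ : Γ, MeasurePreserving (fun (φ : V → ℝ) x => φ ((γ : G ≃g G) x)) μ μ :=
    fun γ => ⟨hmeas γ, hμ.map_equiv hg (γ : G ≃g G).toEquiv (hinv γ γ.2)⟩
  set l : Filter Γ := comap (fun γ : Γ => G.dist o ((γ : G ≃g G) o)) atTop with hl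
  -- Automorphisms preserve distance, so `γ y` stays within `dist o y` of `γ o` and leaves every
  -- finite set.
  have hfar : ∀ (S : Set V), S.Finite → ∀ y, ∀ᶠ γ : Γ in l, (γ : G ≃g G) y ∉ S := by
    intro S hS y
    obtain ⟨n, hn⟩ := (hS.image (G.dist o)).bddAbove
    filter_upwards [(tendsto_comap (x := atTop)
      (f := fun γ : Γ => G.dist o ((γ : G ≃g G) o))).eventually
        (eventually_gt_atTop (n + G.dist o y))] with γ hγ hmem
    have h1 := hn (Set.mem_image_of_mem _ hmem)
    have h2 := hconn.dist_triangle (u := o) (v := (γ : G ≃g G) y) (w := (γ : G ≃g G) o)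
    rw [dist_map hconn, G.dist_comm (u := y)] at h2
    omega
  have hcov : ∀ x y, Tendsto (fun γ : Γ => cov μ (monomialBCF {x})
      (monomialBCF {(γ : G ≃g G) y})) l (𝓝 0) := by
    intro x y
    rw [Metric.tendsto_nhds]
    intro η hη
    filter_upwards [hfar _ (hμ.finite_cov_ge hg hJ hβ hT x hη) y] with γ hγ
    have hmono : ∀ z : V, Monotone (monomialBCF {z}) := fun z φ ψ h => by
      simpa [monomial_singleton] using boundedSpin_strictMono.monotone (h z)
    rw [Real.dist_eq, sub_zero, abs_of_nonneg (hμ.cov_nonneg hg hJ hβ.le (hmono _) (hmono _))]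
    exact not_le.1 hγ
  intro f₁ f₂ ⟨hf₁, ⟨C₁, hC₁⟩, _⟩ ⟨hf₂, ⟨C₂, hC₂⟩, _⟩
  refine tendsto_integral_mul_of_monomial hpres (fun A B => ?_) (memLp_of_bounded hf₁ hC₁)
    (memLp_of_bounded hf₂ hC₂)
  refine tendsto_sub_nhds_zero_iff.1 (squeeze_zero_norm (fun γ => ?_)
    (tendsto_cov_spinSum (e := fun γ : Γ => (γ : G ≃g G)) hcov A B))
  refine le_trans (le_of_eq ?_) (abs_cov_monomial_le
    (fun F G hF hG => hμ.cov_nonneg hg hJ hβ.le hF hG) A (B.map (γ : G ≃g G)))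
  have hB : ∫ φ, monomial B (fun x => φ ((γ : G ≃g G) x)) ∂μ = ∫ φ, monomial B φ ∂μ := by
    conv_rhs => rw [← (hpres γ).map_eq]
    exact (integral_map (hmeas γ).aemeasurable
      (continuous_monomial B).measurable.aestronglyMeasurable).symm
  simp only [cov, monomialBCF_apply, monomial_map, hB, Real.norm_eq_abs]

end Mixing

/-! ### Spin flip and the minus measure. -/

section SpinFlip

variable {J : V → V → ℝ} {g a β : ℝ}

lemma energy_neg (J : V → V → ℝ) (β h : ℝ) (Λ : Finset V) (φ : V → ℝ) :
    energy J β h Λ (-φ) = energy J β (-h) Λ φ := by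
  simp [energy, pairEnergy]

lemma infinitePi_map_neg {ρ : Measure ℝ} (hρ : IsSiteMeasure ρ) :
    (Measure.infinitePi fun _ : V => ρ).map (fun φ => -φ) = Measure.infinitePi fun _ : V => ρ := by
  have := hρ.isProb
  have h := Measure.infinitePi_map_pi (fun _ : V => ρ) (f := fun _ t => -t) fun _ => measurable_neg
  simp only [hρ.map_neg] at h
  exact h

/-- The single-site measure and the pair interaction are even, so a global flip changes only the
sign of the field. -/
lemma freeMeasureOn_map_neg (hg : 0 < g) (h : ℝ) (Λ : Finset V) :
    (freeMeasureOn J g a β h Λ).map (fun φ => -φ) = freeMeasureOn J g a β (-h) Λ := by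
  have hρ := isSiteMeasure_singleSite a hg
  have h1 := tilted_map (μ := Measure.infinitePi fun _ : V => singleSite g a)
    (measurable_neg (G := V → ℝ)) (isQuadratic_energy J β (-h) Λ).1
  simp only [energy_neg, neg_neg] at h1
  have h2 := infinitePi_map_neg (V := V) hρ
  rw [freeMeasureOn_eq J hg, freeMeasureOn_eq J hg, gibbs, gibbs,
    Measure.map_map measurable_neg (measurable_cutoff Λ), ← h2, h2]
  rw [show (Measure.infinitePi fun _ : V => singleSite g a).tilted (energy J β (-h) Λ) = _ from
    (congrArg (fun m => m.tilted (energy J β (-h) Λ)) h2.symm).trans h1,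
    Measure.map_map (measurable_cutoff Λ) measurable_neg]
  congr 1
  ext φ x
  by_cases hx : x ∈ Λ <;> simp [cutoff, hx]

lemma WeakLimit.map_neg [Countable V] {ι : Type*} {ν : ι → Measure (V → ℝ)} {l : Filter ι}
    {μ : Measure (V → ℝ)} (h : WeakLimit ν l μ) :
    WeakLimit (fun i => (ν i).map fun φ => -φ) l (μ.map fun φ => -φ) := by
  have := h.1
  refine ⟨Measure.isProbabilityMeasure_map measurable_neg.aemeasurable, fun F => ?_⟩
  have hF := h.2 (F.compContinuous ⟨fun φ => -φ, continuous_neg⟩)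
  have e : ∀ m : Measure (V → ℝ), ∫ φ, F φ ∂(m.map fun φ => -φ) =
      ∫ φ, F.compContinuous ⟨fun φ => -φ, continuous_neg⟩ φ ∂m := fun m =>
    integral_map measurable_neg.aemeasurable F.continuous.measurable.aestronglyMeasurable
  simpa only [e] using hF

lemma IsFreeMeasure.map_neg [Countable V] (hg : 0 < g) {h : ℝ} {μ : Measure (V → ℝ)}
    (hμ : IsFreeMeasure J g a β h μ) : IsFreeMeasure J g a β (-h) (μ.map fun φ => -φ) := by
  have := WeakLimit.map_neg hμ
  simp only [freeMeasureOn_map_neg hg] at this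
  exact this

lemma IsMinusMeasure.map_neg [Countable V] (hg : 0 < g) {μ : Measure (V → ℝ)}
    (hμ : IsMinusMeasure J g a β μ) : IsPlusMeasure J g a β (μ.map fun φ => -φ) := by
  obtain ⟨ν, hν, hμ⟩ := hμ
  refine ⟨fun h => (ν (-h)).map fun φ => -φ, fun h h0 => ?_, ?_⟩
  · simpa using (hν (-h) (neg_neg_of_pos h0)).map_neg hg
  · have ht : Tendsto (fun h : ℝ => -h) (𝓝[>] 0) (𝓝[<] 0) := by
      simpa using tendsto_neg_nhdsGT (a := (0 : ℝ))
    exact ⟨hμ.map_neg.1, fun F => (hμ.map_neg.2 F).comp ht⟩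

lemma IsPlusMeasure.map_neg [Countable V] (hg : 0 < g) {μ : Measure (V → ℝ)}
    (hμ : IsPlusMeasure J g a β μ) : IsMinusMeasure J g a β (μ.map fun φ => -φ) := by
  obtain ⟨ν, hν, hμ⟩ := hμ
  refine ⟨fun h => (ν (-h)).map fun φ => -φ, fun h h0 => ?_, ?_⟩
  · simpa using (hν (-h) (neg_pos_of_neg h0)).map_neg hg
  · have ht : Tendsto (fun h : ℝ => -h) (𝓝[<] 0) (𝓝[>] 0) := by
      simpa using tendsto_neg_nhdsLT (a := (0 : ℝ))
    exact ⟨hμ.map_neg.1, fun F => (hμ.map_neg.2 F).comp ht⟩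

lemma map_neg_map_neg (μ : Measure (V → ℝ)) : (μ.map fun φ => -φ).map (fun φ => -φ) = μ := by
  rw [Measure.map_map measurable_neg measurable_neg]
  simp

lemma IsLocalBounded.comp_neg {f : (V → ℝ) → ℝ} (hf : IsLocalBounded f) :
    IsLocalBounded fun φ => f (-φ) := by
  obtain ⟨hm, ⟨C, hC⟩, Λ, hΛ⟩ := hf
  exact ⟨hm.comp measurable_neg, ⟨C, fun φ => hC _⟩, Λ, fun φ ψ h =>
    hΛ fun x hx => by simp [h x hx]⟩

/-- The flip commutes with translations and preserves the class of test functions. -/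
lemma IsMixing.of_map_neg {G : SimpleGraph V} {Γ : Subgroup (G ≃g G)} {o : V}
    {μ : Measure (V → ℝ)} (h : IsMixing Γ o (μ.map fun φ => -φ)) : IsMixing Γ o μ := by
  intro f₁ f₂ hf₁ hf₂
  have := h _ _ hf₁.comp_neg hf₂.comp_neg
  have e : ∀ F : (V → ℝ) → ℝ, ∫ φ, F φ ∂(μ.map fun φ => -φ) = ∫ φ, F (-φ) ∂μ := fun F =>
    integral_map_equiv (MeasurableEquiv.neg (V → ℝ)) F
  simp only [e, translate, neg_neg] at this
  refine this.congr fun γ => ?_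
  refine integral_congr_ae (ae_of_all _ fun φ => ?_)
  have : -(fun x => (-φ) ((γ : G ≃g G) x)) = fun x => φ ((γ : G ≃g G) x) := by
    ext x
    simp
  simp only [translate, this]

end SpinFlip

end PhiFour

end

theorem proposition2p6 {V : Type*} [Infinite V] (G : SimpleGraph V) (hconn : G.Connected)
    (hfin : ∀ x : V, (G.neighborSet x).Finite) (o : V) (d : ℝ) (hd : 1 ≤ d)
    (hgrowth : PhiFour.HasPolynomialGrowth G o d)
    (Γ : Subgroup (G ≃g G)) (hΓ : PhiFour.IsVertexTransitive Γ)
    (J : V → V → ℝ) (hJ : PhiFour.IsAdmissible G Γ d J)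
    (g a β : ℝ) (hg : 0 < g) (hβ : 0 < β) :
    (∃! μ : Measure (V → ℝ), PhiFour.IsPlusMeasure J g a β μ) ∧
      (∃! μ : Measure (V → ℝ), PhiFour.IsMinusMeasure J g a β μ) ∧
      (∀ μ : Measure (V → ℝ), PhiFour.IsPlusMeasure J g a β μ → PhiFour.IsMixing Γ o μ) ∧
      (∀ μ : Measure (V → ℝ), PhiFour.IsMinusMeasure J g a β μ → PhiFour.IsMixing Γ o μ) := by
  have hcount := PhiFour.countable_of_growth hgrowth
  have hne : Nonempty V := ⟨o⟩
  have hM : PhiFour.HasUniformMoments J g a β := fun h h0 => by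
    obtain ⟨M, -, hM⟩ := PhiFour.exists_moment_bound (PhiFour.isSiteMeasure_singleSite a hg) hconn
      (zero_le_one.trans hd) hgrowth hΓ hJ hβ.le h0
    exact ⟨M, fun Λ K hK x => hM K hK Λ x⟩
  have hmix : ∀ μ : Measure (V → ℝ), PhiFour.IsPlusMeasure J g a β μ → PhiFour.IsMixing Γ o μ :=
    fun μ hμ => hμ.isMixing hconn hΓ hg hJ.ferromagnetic hβ hJ.invariant
  obtain ⟨μ, hμ⟩ := PhiFour.exists_isPlusMeasure (a := a) hg hJ.ferromagnetic hβ.le hM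
  refine ⟨⟨μ, hμ, fun ν hν => hν.unique hμ⟩, ⟨_, hμ.map_neg hg, fun ν hν => ?_⟩, hmix,
    fun ν hν => (hmix _ (hν.map_neg hg)).of_map_neg⟩
  rw [(hμ.unique (hν.map_neg hg)), PhiFour.map_neg_map_neg]
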